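/- Setting. All manifolds are smooth, finite-dimensional, without boundary, Hausdorff and paracompact. Let $G$ be a Lie group with Lie algebra $\mathfrak g$ (left-invariant bracket), $\pi:P\to M$ a smooth principal $G$-bundle (right action), and $\widehat g$ a Kaluza-Klein metric on $P$, i.e. a $G$-invariant Riemannian metric, with Levi-Civita connection $\nabla^P$. For $\xi\in\mathfrak g$ let $\xi^*$ be its fundamental vector field; for a function $\boldsymbol\xi\in C^\infty(P,\mathfrak g)$ let $\boldsymbol\xi^*$ be the vertical field $p\mapsto \boldsymbol\xi(p)^*_p$. Let $\mathcal VP=\ker\pi_*$, let $\omega:TP\to\mathcal VP$ be the $\widehat g$-orthogonal projection (this is the principal connection of $\widehat g$), write $\widehat\omega$ for its $\mathfrak g$-valued form, $\omega(v)=\widehat\omega(v)^*$, and $D^{\mathcal V}=\omega(D)$, $D^{\mathcal H}=D-\omega(D)$. Let $\beta_p(\xi,\eta)=\widehat g_p(\xi^*_p,\eta^*_p)$, and let $\mathrm{ad}^*_\zeta$ be the $\beta$-adjoint of $\mathrm{ad}_\zeta$: $\beta(\mathrm{ad}^*_\zeta\xi_1,\xi_2)=\beta(\xi_1,[\zeta,\xi_2])$.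 On $\mathcal VP$ consider the connections $$\nabla^{P,\mathcal V}_DV=\omega(\nabla^P_DV),\qquad \nabla^\omega_D\boldsymbol\xi^*=\big[D(\boldsymbol\xi)+\tfrac12[\widehat\omega(D),\boldsymbol\xi]\big]^*,$$ and set $$\Theta(D_1,D_2)=\nabla^{P,\mathcal V}_{D_1}D_2^{\mathcal V}-\nabla^\omega_{D_1}D_2^{\mathcal V},\qquad T(D_1,D_2)=\big[\nabla^P_{D_1^{\mathcal V}}D_2^{\mathcal H}\big]^{\mathcal V}+\big[\nabla^P_{D_1^{\mathcal V}}D_2^{\mathcal V}\big]^{\mathcal H}.$$ 1. $\Theta$ and $T$ are tensors, and for every vector field $D$ on $P$ and every $\boldsymbol\xi\in C^\infty(P,\mathfrak g)$, $$\Theta(D,\boldsymbol\xi^*)=\tfrac12\big\{\mathrm{ad}^*_{\boldsymbol\xi}(\widehat\omega(D))+\mathrm{ad}^*_{\widehat\omega(D)}(\boldsymbol\xi)\big\}^*+T(\boldsymbol\xi^*,D^{\mathcal H}).$$ 2. Let $\mathrm{ad}P=P\times_{\mathrm{Ad}}\mathfrak g$ be the adjoint bundle. Identify its smooth sections with the smooth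 maps $\nu:P\to\mathfrak g$ with $\nu(pa)=\mathrm{Ad}_{a^{-1}}\nu(p)$, and put $\widetilde\nu=\nu^*$; then $\nu\mapsto\widetilde\nu$ is a bijection of $\Gamma(M,\mathrm{ad}P)$ onto the space $\mathfrak X^{\mathcal V}(P)^G$ of smooth $G$-invariant vertical vector fields. If $X$ is a basic vector field on $P$ (horizontal and $\pi$-related to a vector field on $M$), then $\nabla^{P,\mathcal V}_X$ maps $\mathfrak X^{\mathcal V}(P)^G$ to itself. With $E^h$ the horizontal lift of $E\in\mathfrak X(M)$, there are a unique connection $\nabla^{\mathrm{ad},\mathcal V}$ on $\mathrm{ad}P$, a unique connection $\nabla^{\mathrm{ad}}$ on $\mathrm{ad}P$ and a unique $T^{\mathrm{ad}}\in\Omega^1(M,\mathrm{End}(\mathrm{ad}P))$ such that $$\widetilde{\nabla^{\mathrm{ad},\mathcal V}_E\nu}=\nabla^{P,\mathcal V}_{E^h}\widetilde\nu,\qquad \nabla^{\mathrm{ad}}_E\nu=E^h(\nu),\qquad \widetilde{T^{\mathrm{ad}}(E)(\nu)}=T(\widetilde\nu,E^h),$$ and $\nabla^{\mathrm{ad},\mathcal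 V}-\nabla^{\mathrm{ad}}=T^{\mathrm{ad}}$. 3. For every Riemannian manifold $(N,g)$, with Levi-Civita connection $\nabla^N$, and every smooth map $\widetilde\Phi:N\to P$, the vertical part of the tension field of $\widetilde\Phi:(N,g)\to(P,\widehat g)$ is $$[\tau(\widetilde\Phi)]^{\mathcal V}=-\delta^{(\nabla^N,\widetilde\Phi^*\nabla^\omega)}(\widetilde\Phi^*\omega)+\omega\big(\mathrm{Tr}_g\,\widetilde\Phi^*(\Theta+T)\big).$$ Here $\tau(\widetilde\Phi)=\mathrm{Tr}_g\,\mathrm{II}$ with $\mathrm{II}(X,Y)=(\widetilde\Phi^*\nabla^P)_X(\widetilde\Phi_*Y)-\widetilde\Phi_*(\nabla^N_XY)$; $\widetilde\Phi^*\omega$ is the $\widetilde\Phi^*\mathcal VP$-valued 1-form $X\mapsto\omega(\widetilde\Phi_*X)$; and for a $\widetilde\Phi^*\mathcal VP$-valued 1-form $\alpha$, $\delta\alpha=-\mathrm{Tr}_g\nabla\alpha$ with $(\nabla\alpha)(X,Y)=(\widetilde\Phi^*\nabla^\omega)_X(\alpha(Y))-\alpha(\nabla^N_XY)$. -/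

import Mathlib

open Bundle Manifold FiberBundle VectorField
open scoped ContDiff Manifold Topology

noncomputable section
namespace KK
/-! ### Extending a vector to a local section -/

section Extension

variable {E : Type*} [NormedAddCommGroup E] [NormedSpace ℝ E]
  {H : Type*} [TopologicalSpace H] {I : ModelWithCorners ℝ E H}
  {M : Type*} [TopologicalSpace M] [ChartedSpace H M]
  (F : Type*) [NormedAddCommGroup F] [NormedSpace ℝ F]
  {V : M → Type*} [TopologicalSpace (TotalSpace F V)]
  [∀ x, AddCommGroup (V x)] [∀ x, Module ℝ (V x)] [∀ x, TopologicalSpace (V x)]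
  [FiberBundle F V] [VectorBundle ℝ F V]

/-- The section through `v ∈ V x` that has constant components in the preferred local frame of the
vector bundle `V` around `x`; it is smooth near `x`. -/
def constExt {x : M} (v : V x) (y : M) : V y :=
  (trivializationAt F V x).symmL ℝ y ((trivializationAt F V x).continuousLinearMapAt ℝ x v)

variable {F} in
/-- The components, in the preferred local frame of `V` around `x`, of a vector of `V`. -/
def components (x : M) {y : M} (v : V y) : F :=
  (trivializationAt F V x).continuousLinearMapAt ℝ y v

lemma constExt_self {x : M} (v : V x) : constExt F v x = v :=
  (trivializationAt F V x).symmL_continuousLinearMapAt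
    (FiberBundle.mem_baseSet_trivializationAt F V x) v

lemma constExt_add {x : M} (v w : V x) (y : M) :
    constExt F (v + w) y = constExt F v y + constExt F w y := by
  simp only [constExt, map_add]

lemma constExt_smul {x : M} (c : ℝ) (v : V x) (y : M) :
    constExt F (c • v) y = c • constExt F v y := by
  simp only [constExt, map_smul]

lemma components_eventuallyEq {x : M} (σ : Π y, V y) :
    (fun y => (trivializationAt F V x ⟨y, σ y⟩).2) =ᶠ[𝓝 x] fun y => components x (σ y) := by
  filter_upwards [(trivializationAt F V x).open_baseSet.mem_nhds
    (FiberBundle.mem_baseSet_trivializationAt F V x)] with y hy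
  rw [components, Trivialization.continuousLinearMapAt_apply,
    Trivialization.coe_linearMapAt_of_mem _ hy]

lemma components_constExt {x : M} (v : V x) :
    ∀ᶠ y in 𝓝 x, components x (constExt F v y) = (components x v : F) := by
  filter_upwards [(trivializationAt F V x).open_baseSet.mem_nhds
    (FiberBundle.mem_baseSet_trivializationAt F V x)] with y hy
  exact (trivializationAt F V x).continuousLinearMapAt_symmL hy _

lemma mdifferentiableAt_components {x : M} {σ : Π y, V y} :
    MDifferentiableAt I (I.prod 𝓘(ℝ, F)) (fun y => TotalSpace.mk' F y (σ y)) x ↔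
      MDifferentiableAt I 𝓘(ℝ, F) (fun y => (components x (σ y) : F)) x := by
  rw [mdifferentiableAt_section]
  exact (components_eventuallyEq F σ).mdifferentiableAt_iff

lemma mdifferentiableAt_constExt {x : M} (v : V x) :
    MDifferentiableAt I (I.prod 𝓘(ℝ, F)) (fun y => TotalSpace.mk' F y (constExt F v y)) x := by
  rw [mdifferentiableAt_components]
  exact (Filter.EventuallyEq.mdifferentiableAt_iff (components_constExt F v)).2
    mdifferentiableAt_const

end Extension

/-! ### Riemannian metrics and the Levi-Civita connection -/

section LeviCivita

/-- A smooth Riemannian metric on the manifold `M`. -/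
abbrev Metric {E : Type*} [NormedAddCommGroup E] [NormedSpace ℝ E] {H : Type*} [TopologicalSpace H]
    (I : ModelWithCorners ℝ E H) (M : Type*) [TopologicalSpace M] [ChartedSpace H M]
    [IsManifold I ∞ M] :=
  ContMDiffRiemannianMetric I ∞ E (fun x : M => TangentSpace I x)

variable {E : Type*} [NormedAddCommGroup E] [NormedSpace ℝ E]
  {H : Type*} [TopologicalSpace H] {I : ModelWithCorners ℝ E H}
  {M : Type*} [TopologicalSpace M] [ChartedSpace H M] [IsManifold I ∞ M]

instance tangentFiniteDimensional [FiniteDimensional ℝ E] (x : M) :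
    FiniteDimensional ℝ (TangentSpace I x) :=
  inferInstanceAs (FiniteDimensional ℝ E)

instance tangentT2Space (x : M) : T2Space (TangentSpace I x) :=
  inferInstanceAs (T2Space E)

lemma mdifferentiableAt_metric (g : Metric I M) {x : M} {X Y : Π y : M, TangentSpace I y}
    (hX : MDiffAt (T% X) x) (hY : MDiffAt (T% Y) x) :
    MDiffAt (fun y => g.inner y (X y) (Y y)) x := by
  let _ : RiemannianBundle (fun x : M => TangentSpace I x) := ⟨g.toRiemannianMetric⟩
  exact MDifferentiableAt.inner_bundle (F := E) (E := fun x : M => TangentSpace I x) hX hY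

lemma mdifferentiableAt_metric_constExt (g : Metric I M) {x : M} (v w : TangentSpace I x) :
    MDiffAt (fun y => g.inner y (constExt E v y) (constExt E w y)) x :=
  mdifferentiableAt_metric g (mdifferentiableAt_constExt E v) (mdifferentiableAt_constExt E w)

/-- The first derivatives at `x` of the components of the metric in the chart at `x`:
`metricDeriv g x v w u = ∂_u g(v, w)`, the vectors `v`, `w` being extended by constants. -/
def metricDeriv (g : Metric I M) (x : M) :
    TangentSpace I x →ₗ[ℝ] TangentSpace I x →ₗ[ℝ] Module.Dual ℝ (TangentSpace I x) :=
  LinearMap.mk₂ ℝ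
    (fun v w => (mvfderiv I (fun y => g.inner y (constExt E v y) (constExt E w y)) x).toLinearMap)
    (fun v v' w => by
      rw [← ContinuousLinearMap.toLinearMap_add, ← mvfderiv_add
        (mdifferentiableAt_metric_constExt g v w) (mdifferentiableAt_metric_constExt g v' w)]
      congr 2
      ext y
      simp [constExt_add])
    (fun c v w => by
      have h := mvfderiv_smul (mdifferentiableAt_const (c := c) (x := x) (I := I))
        (mdifferentiableAt_metric_constExt g v w)
      rw [mvfderiv_const] at h
      rw [← ContinuousLinearMap.toLinearMap_smul]
      congr 1
      convert h using 1
      · congr 1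
        ext y
        simp [constExt_smul]
      · ext; simp)
    (fun v w w' => by
      rw [← ContinuousLinearMap.toLinearMap_add, ← mvfderiv_add
        (mdifferentiableAt_metric_constExt g v w) (mdifferentiableAt_metric_constExt g v w')]
      congr 2
      ext y
      simp [constExt_add])
    (fun c v w => by
      have h := mvfderiv_smul (mdifferentiableAt_const (c := c) (x := x) (I := I))
        (mdifferentiableAt_metric_constExt g v w)
      rw [mvfderiv_const] at h
      rw [← ContinuousLinearMap.toLinearMap_smul]
      congr 1
      convert h using 1
      · congr 1
        ext y
        simp [constExt_smul]
      · ext; simp)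

lemma metricDeriv_symm (g : Metric I M) (x : M) (v w u : TangentSpace I x) :
    metricDeriv g x v w u = metricDeriv g x w v u := by
  simp only [metricDeriv, LinearMap.mk₂_apply]
  congr 3
  ext y
  exact g.symm y _ _

lemma mlieBracket_constExt {x : M} (v w : TangentSpace I x) :
    mlieBracket I (constExt E v) (constExt E w) x = 0 := by
  have key : ∀ v : TangentSpace I x,
      mpullbackWithin 𝓘(ℝ, E) I (extChartAt I x).symm (constExt E v) (Set.range I)
        =ᶠ[𝓝[Set.range I] (extChartAt I x x)] fun _ => (components x v : E) := by
    intro v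
    filter_upwards [extChartAt_target_mem_nhdsWithin x] with z hz
    have hs : (extChartAt I x).symm z ∈ (chartAt H x).source := by
      rw [← extChartAt_source I]
      exact (extChartAt I x).map_target hz
    have e : constExt E v ((extChartAt I x).symm z) =
        mfderivWithin 𝓘(ℝ, E) I (extChartAt I x).symm (Set.range I) z (components x v : E) := by
      rw [constExt, TangentBundle.symmL_trivializationAt hs, (extChartAt I x).right_inv hz]
      rfl
    rw [mpullbackWithin_apply, e]
    exact ContinuousLinearMap.IsInvertible.inverse_apply_self
      (isInvertible_mfderivWithin_extChartAt_symm hz) _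
  rw [← mlieBracketWithin_univ, mlieBracketWithin_apply, Set.preimage_univ, Set.univ_inter,
    Filter.EventuallyEq.lieBracketWithin_vectorField_eq_of_mem (key v) (key w) (by simp)]
  have h0 : lieBracketWithin ℝ (fun _ : E => (components x v : E)) (fun _ => components x w)
      (Set.range I) (extChartAt I x x) = 0 := by
    rw [lieBracketWithin]
    simp only [fderivWithin_const_apply]
    exact sub_self (0 : E)
  refine (congrArg _ ?_).trans (map_zero _)
  rw [extChartAt_coe, Function.comp_apply]
  exact h0

variable [FiniteDimensional ℝ E]

/-- The isomorphism `T_xM ≃ T_xM^*` given by the metric. -/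
def flat (g : Metric I M) (x : M) : TangentSpace I x ≃ₗ[ℝ] Module.Dual ℝ (TangentSpace I x) :=
  LinearMap.linearEquivOfInjective
    (LinearMap.mk₂ ℝ (fun v w => g.inner x v w) (by simp) (by simp) (by simp) (by simp) :
      TangentSpace I x →ₗ[ℝ] Module.Dual ℝ (TangentSpace I x))
    ((injective_iff_map_eq_zero _).2 fun v hv => by
      by_contra h
      have := g.pos x v h
      have h2 := LinearMap.congr_fun hv v
      simp at h2
      exact this.ne' h2)
    Subspace.dual_finrank_eq.symm

lemma flat_apply (g : Metric I M) (x : M) (v w : TangentSpace I x) :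
    flat g x v w = g.inner x v w := rfl

/-- The Christoffel form of the metric in the chart at `x`: `Γ = christoffel g x v u` is given by
`g(Γ, w) = ½ (∂_u g(v, w) + ∂_v g(u, w) - ∂_w g(u, v))`. -/
def christoffel (g : Metric I M) (x : M) :
    TangentSpace I x →ₗ[ℝ] TangentSpace I x →ₗ[ℝ] TangentSpace I x :=
  LinearMap.mk₂ ℝ
    (fun v u => (flat g x).symm ((1 / 2 : ℝ) • ((metricDeriv g x v).flip u +
      (metricDeriv g x u).flip v - metricDeriv g x u v)))
    (fun v v' u => by
      rw [← map_add]
      congr 1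
      ext w
      simp
      ring)
    (fun c v u => by
      rw [← map_smul]
      congr 1
      ext w
      simp
      ring)
    (fun v u u' => by
      rw [← map_add]
      congr 1
      ext w
      simp
      ring)
    (fun c v u => by
      rw [← map_smul]
      congr 1
      ext w
      simp
      ring)

lemma christoffel_apply (g : Metric I M) (x : M) (v u w : TangentSpace I x) :
    g.inner x (christoffel g x v u) w =
      1 / 2 * (metricDeriv g x v w u + metricDeriv g x u w v - metricDeriv g x u v w) := by
  rw [← flat_apply]
  simp [christoffel]

/-- The Levi-Civita connection of `g`: in the chart at `x`, the components of
`(∇_u σ)(x)` are `∂_u σ^k + Γ^k_{ij} u^i σ^j`. -/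
def leviCivita (g : Metric I M) : CovariantDerivative I E (fun x : M => TangentSpace I x) where
  toFun σ x :=
    (trivializationAt E (TangentSpace I) x).symmL ℝ x ∘L
        mvfderiv I (fun y => (components x (σ y) : E)) x +
      (christoffel g x (σ x)).toContinuousLinearMap
  isCovariantDerivativeOnUniv :=
    { add := fun {σ σ' x} hσ hσ' _ => by
        rw [mdifferentiableAt_components] at hσ hσ'
        have : (fun y => (components x ((σ + σ') y) : E)) =
          (fun y => components x (σ y)) + (fun y => components x (σ' y)) := by
          ext y; simp [components]
        rw [this, mvfderiv_add hσ hσ']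
        ext u
        simp
        abel
      leibniz := fun {σ f x} hσ hf _ => by
        rw [mdifferentiableAt_components] at hσ
        have : (fun y => (components x ((f • σ) y) : E)) =
          f • (fun y => components x (σ y)) := by
          ext y; simp [components]
        rw [this, mvfderiv_smul hf hσ]
        ext u
        have h2 : (trivializationAt E (TangentSpace I) x).symmL ℝ x (components x (σ x)) = σ x :=
          constExt_self E (σ x)
        simp [h2]
        module }

lemma leviCivita_apply (g : Metric I M) (σ : Π x : M, TangentSpace I x) (x : M)
    (u : TangentSpace I x) :
    leviCivita g σ x u = (trivializationAt E (TangentSpace I) x).symmL ℝ x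
        (mvfderiv I (fun y => (components x (σ y) : E)) x u) + christoffel g x (σ x) u := rfl

lemma leviCivita_constExt (g : Metric I M) (x : M) (v u : TangentSpace I x) :
    leviCivita g (constExt E v) x u = christoffel g x v u := by
  have h : mvfderiv I (fun y => (components x (constExt E v y) : E)) x u = 0 := by
    have h1 : mfderiv I 𝓘(ℝ, E) (fun y => (components x (constExt E v y) : E)) x =
        mfderiv I 𝓘(ℝ, E) (fun _ => (components x v : E)) x :=
      Filter.EventuallyEq.mfderiv_eq (components_constExt E v)
    rw [mfderiv_const] at h1
    have h2 := DFunLike.congr_fun h1 u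
    exact h2
  rw [leviCivita_apply, h, constExt_self, map_zero, zero_add]

/-- The Levi-Civita connection is torsion free. -/
theorem leviCivita_torsion (g : Metric I M) : (leviCivita g).torsion = 0 := by
  ext x u v
  have h1 := CovariantDerivative.torsion_apply (leviCivita g) (mdifferentiableAt_constExt E u)
    (mdifferentiableAt_constExt E v)
  simp only [constExt_self, leviCivita_constExt, mlieBracket_constExt] at h1
  rw [h1, sub_zero]
  have : christoffel g x v u = christoffel g x u v := by
    apply (flat g x).injective
    ext w
    rw [flat_apply, flat_apply, christoffel_apply, christoffel_apply, metricDeriv_symm g x u v w]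
    ring
  simp [this]

/-- The Levi-Civita connection is compatible with the metric. -/
theorem leviCivita_metric (g : Metric I M) {x : M} {X Y : Π y : M, TangentSpace I y}
    (hX : MDiffAt (T% X) x) (hY : MDiffAt (T% Y) x) (u : TangentSpace I x) :
    mvfderiv I (fun y => g.inner y (X y) (Y y)) x u =
      g.inner x (leviCivita g X x u) (Y x) + g.inner x (X x) (leviCivita g Y x u) := by
  let Φ : (Π y : M, TangentSpace I y) → (Π y : M, TangentSpace I y) → ℝ := fun X Y =>
    mvfderiv I (fun y => g.inner y (X y) (Y y)) x u -
      g.inner x (leviCivita g X x u) (Y x) - g.inner x (X x) (leviCivita g Y x u)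
  have hsymm : ∀ X Y, Φ X Y = Φ Y X := by
    intro X Y
    have : (fun y => g.inner y (X y) (Y y)) = fun y => g.inner y (Y y) (X y) := by
      ext y; exact g.symm y _ _
    simp only [Φ, this, g.symm x (X x), g.symm x (Y x)]
    ring
  have h1 : ∀ Y : Π y : M, TangentSpace I y, MDiffAt (T% Y) x →
      TensorialAt I E (fun X => Φ X Y) x := by
    intro Y hY
    refine ⟨fun {f X} hf hX => ?_, fun {X X'} hX hX' => ?_⟩
    · have e : (fun y => g.inner y ((f • X) y) (Y y)) = f * fun y => g.inner y (X y) (Y y) := by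
        ext y; simp
      simp only [Φ]
      rw [e, mvfderiv_mul hf (mdifferentiableAt_metric g hX hY),
        (leviCivita g).isCovariantDerivativeOnUniv.leibniz hX hf]
      simp
      ring
    · have e : (fun y => g.inner y ((X + X') y) (Y y)) =
          (fun y => g.inner y (X y) (Y y)) + fun y => g.inner y (X' y) (Y y) := by
        ext y; simp
      simp only [Φ]
      rw [e, mvfderiv_add (mdifferentiableAt_metric g hX hY) (mdifferentiableAt_metric g hX' hY),
        (leviCivita g).isCovariantDerivativeOnUniv.add hX hX']
      simp
      ring
  have h2 : ∀ X : Π y : M, TangentSpace I y, MDiffAt (T% X) x → TensorialAt I E (Φ X) x := by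
    intro X hX
    have : Φ X = fun Y => Φ Y X := by ext Y; exact hsymm X Y
    rw [this]
    exact h1 X hX
  have h3 : Φ X Y = Φ (constExt E (X x)) (constExt E (Y x)) :=
    TensorialAt.pointwise₂ h1 h2 hX (mdifferentiableAt_constExt E _) hY
      (mdifferentiableAt_constExt E _) (constExt_self E _).symm (constExt_self E _).symm
  have h4 : Φ (constExt E (X x)) (constExt E (Y x)) = 0 := by
    simp only [Φ, constExt_self, leviCivita_constExt]
    have h5 : mvfderiv I (fun y => g.inner y (constExt E (X x) y) (constExt E (Y x) y)) x u =
      metricDeriv g x (X x) (Y x) u := rfl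
    rw [h5, g.symm x (X x), christoffel_apply, christoffel_apply,
      metricDeriv_symm g x (Y x) (X x) u]
    ring
  have h5 := h3.trans h4
  simp only [Φ] at h5
  linarith

end LeviCivita

/-! ### Calculus along a map: pullback connections, traces, tension field, codifferential -/

section Maps

/-- A smooth vector field. -/
def IsSmoothField {E : Type*} [NormedAddCommGroup E] [NormedSpace ℝ E] {H : Type*}
    [TopologicalSpace H] (I : ModelWithCorners ℝ E H) {M : Type*} [TopologicalSpace M]
    [ChartedSpace H M] [IsManifold I ∞ M] (X : Π x : M, TangentSpace I x) : Prop :=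
  ContMDiff I I.tangent ∞ fun x => (⟨x, X x⟩ : TangentBundle I M)

variable {EN : Type*} [NormedAddCommGroup EN] [NormedSpace ℝ EN] [FiniteDimensional ℝ EN]
  {HN : Type*} [TopologicalSpace HN] {IN : ModelWithCorners ℝ EN HN}
  {N : Type*} [TopologicalSpace N] [ChartedSpace HN N] [IsManifold IN ∞ N]
  {E : Type*} [NormedAddCommGroup E] [NormedSpace ℝ E] [FiniteDimensional ℝ E]
  {H : Type*} [TopologicalSpace H] {I : ModelWithCorners ℝ E H}
  {M : Type*} [TopologicalSpace M] [ChartedSpace H M] [IsManifold I ∞ M]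

/-- The trace `∑ g^{ij} B(e_i, e_j)` of a bilinear map `B` on `T_xN` with respect to the metric `g`,
where `(e_i)` is a basis and `(g^{ij})` is the inverse of its Gram matrix. -/
def metricTrace (g : Metric IN N) (x : N) {W : Type*} [AddCommGroup W] [Module ℝ W]
    (B : TangentSpace IN x → TangentSpace IN x → W) : W :=
  let b := Module.finBasis ℝ (TangentSpace IN x)
  let gram : Matrix _ _ ℝ := Matrix.of fun i j => g.inner x (b i) (b j)
  ∑ i, ∑ j, gram⁻¹ i j • B (b i) (b j)

/-- The pullback `(Φ^*∇)_u S ∈ V_{Φ(x)}`, where `S` is a section of the pullback `Φ^*V` of a vector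
bundle `V` with connection `∇`: writing `S = ∑ S^a (e_a ∘ Φ)` in the preferred frame `(e_a)` of `V`
around `Φ x`, it is `∑ dS^a(u) e_a + S^a ∇_{Φ_* u} e_a`. -/
def pullbackCov (F : Type*) [NormedAddCommGroup F] [NormedSpace ℝ F]
    {V : M → Type*} [TopologicalSpace (TotalSpace F V)]
    [∀ x, AddCommGroup (V x)] [∀ x, Module ℝ (V x)] [∀ x, TopologicalSpace (V x)]
    [FiberBundle F V] [VectorBundle ℝ F V]
    (cov : (Π q, V q) → Π q : M, TangentSpace I q → V q) (Φ : N → M)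
    (S : Π y : N, V (Φ y)) (x : N) (u : TangentSpace IN x) : V (Φ x) :=
  (trivializationAt F V (Φ x)).symmL ℝ (Φ x)
      (mvfderiv IN (fun y => (components (Φ x) (S y) : F)) x u) +
    cov (constExt F (S x)) (Φ x) (mfderiv IN I Φ x u)

/-- The second fundamental form `II(u, v) = (Φ^*∇^M)_u (Φ_* X) - Φ_* (∇^N_u X)`, with `X` a field
extending `v`, of a smooth map `Φ : (N, g) → (M, h)`. -/
def secondFund (g : Metric IN N) (h : Metric I M) (Φ : N → M) (x : N) (u v : TangentSpace IN x) :
    TangentSpace I (Φ x) :=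
  pullbackCov E (fun X q w => leviCivita h X q w) Φ
      (fun y => mfderiv IN I Φ y (constExt EN v y)) x u -
    mfderiv IN I Φ x (leviCivita g (constExt EN v) x u)

/-- The tension field `τ(Φ) = Tr_g II`. -/
def tension (g : Metric IN N) (h : Metric I M) (Φ : N → M) (x : N) : TangentSpace I (Φ x) :=
  metricTrace g x (secondFund g h Φ x)

/-- The codifferential `δα = - Tr_g (∇α)` of a 1-form `α` on `N` with values in a bundle `W`, where
`(∇α)(u, v) = ∇^W_u (α(X)) - α(∇^N_u X)`, with `X` a field extending `v`. -/
def codifferential (g : Metric IN N) {W : N → Type*} [∀ x, AddCommGroup (W x)]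
    [∀ x, Module ℝ (W x)] (covW : (Π y, W y) → Π y : N, TangentSpace IN y → W y)
    (α : Π y : N, TangentSpace IN y → W y) (x : N) : W x :=
  -metricTrace g x fun u v =>
    covW (fun y => α y (constExt EN v y)) x u - α x (leviCivita g (constExt EN v) x u)

end Maps

/-! ### Principal bundles and Kaluza-Klein metrics -/

section Principal

/-- A smooth principal `G`-bundle `proj : P → M`, with right action `act`. -/
structure PrincipalBundle
    {EP : Type*} [NormedAddCommGroup EP] [NormedSpace ℝ EP] {HP : Type*} [TopologicalSpace HP]
    (IP : ModelWithCorners ℝ EP HP)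
    {EM : Type*} [NormedAddCommGroup EM] [NormedSpace ℝ EM] {HM : Type*} [TopologicalSpace HM]
    (IM : ModelWithCorners ℝ EM HM)
    {EG : Type*} [NormedAddCommGroup EG] [NormedSpace ℝ EG] {HG : Type*} [TopologicalSpace HG]
    (IG : ModelWithCorners ℝ EG HG)
    (P : Type*) [TopologicalSpace P] [ChartedSpace HP P]
    (M : Type*) [TopologicalSpace M] [ChartedSpace HM M]
    (G : Type*) [TopologicalSpace G] [ChartedSpace HG G] [Group G] where
  /-- the bundle projection -/
  proj : P → M
  /-- the right action -/
  act : P → G → P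
  act_one : ∀ p, act p 1 = p
  act_mul : ∀ p g h, act (act p g) h = act p (g * h)
  proj_act : ∀ p g, proj (act p g) = proj p
  contMDiff_proj : ContMDiff IP IM ∞ proj
  contMDiff_act : ContMDiff (IP.prod IG) IP ∞ fun q : P × G => act q.1 q.2
  locally_trivial : ∀ x : M, ∃ e : Trivialization G proj, x ∈ e.baseSet ∧
    ContMDiffOn IP (IM.prod IG) ∞ e e.source ∧
    ContMDiffOn (IM.prod IG) IP ∞ e.toOpenPartialHomeomorph.symm e.target ∧
    ∀ p ∈ e.source, ∀ g, e (act p g) = ((e p).1, (e p).2 * g)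

/-- The adjoint representation `Ad_g` of a Lie group on its Lie algebra. -/
def Ad {EG : Type*} [NormedAddCommGroup EG] [NormedSpace ℝ EG] {HG : Type*} [TopologicalSpace HG]
    (IG : ModelWithCorners ℝ EG HG) {G : Type*} [TopologicalSpace G] [ChartedSpace HG G] [Group G]
    (g : G) : GroupLieAlgebra IG G →ₗ[ℝ] GroupLieAlgebra IG G :=
  (mfderiv IG IG (fun h : G => g * h * g⁻¹) 1).toLinearMap

variable
  {EP : Type*} [NormedAddCommGroup EP] [NormedSpace ℝ EP] [FiniteDimensional ℝ EP]
  {HP : Type*} [TopologicalSpace HP] {IP : ModelWithCorners ℝ EP HP}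
  {EM : Type*} [NormedAddCommGroup EM] [NormedSpace ℝ EM]
  {HM : Type*} [TopologicalSpace HM] {IM : ModelWithCorners ℝ EM HM}
  {EG : Type*} [NormedAddCommGroup EG] [NormedSpace ℝ EG]
  {HG : Type*} [TopologicalSpace HG] {IG : ModelWithCorners ℝ EG HG}
  {P : Type*} [TopologicalSpace P] [ChartedSpace HP P] [IsManifold IP ∞ P]
  {M : Type*} [TopologicalSpace M] [ChartedSpace HM M] [IsManifold IM ∞ M]
  {G : Type*} [TopologicalSpace G] [ChartedSpace HG G] [Group G]
  (B : PrincipalBundle IP IM IG P M G)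

/-- The differential `T_pP → T_{pa}P` of the right translation by `a ∈ G`. -/
def translate (a : G) (p : P) (v : TangentSpace IP p) : TangentSpace IP (B.act p a) :=
  mfderiv IP IP (fun q => B.act q a) p v

/-- A Kaluza-Klein metric: a Riemannian metric on `P` for which `G` acts by isometries. -/
def IsKaluzaKlein (γ : Metric IP P) : Prop :=
  ∀ (a : G) (p : P) (v w : TangentSpace IP p),
    γ.inner (B.act p a) (translate B a p v) (translate B a p w) = γ.inner p v w

/-- The value `ξ^*_p` at `p` of the fundamental vector field of `ξ` in the Lie algebra. -/
def fund (p : P) (ξ : GroupLieAlgebra IG G) : TangentSpace IP p :=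
  mfderiv IG IP (fun g => B.act p g) 1 ξ

variable (γ : Metric IP P)

/-- The Lie algebra valued connection form `ω̂` of the metric: `ξ = ω̂_p(v)` is the element such that
`ξ^*_p` is the orthogonal projection of `v` to the vertical space, the space of the `η^*_p`. -/
def connForm (p : P) (v : TangentSpace IP p) : GroupLieAlgebra IG G :=
  Classical.epsilon fun ξ : GroupLieAlgebra IG G =>
    ∀ η : GroupLieAlgebra IG G, γ.inner p (v - fund B p ξ) (fund B p η) = 0

/-- The vertical projection `ω_p(v)`, that is the vertical part of `v`. -/
def vert (p : P) (v : TangentSpace IP p) : TangentSpace IP p :=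
  fund B p (connForm B γ p v)

/-- The horizontal part of `v`. -/
def horiz (p : P) (v : TangentSpace IP p) : TangentSpace IP p :=
  v - vert B γ p v

/-- The inner product `β_p(ξ, η) = γ(ξ^*_p, η^*_p)` on the Lie algebra. -/
def fiberMetric (p : P) (ξ η : GroupLieAlgebra IG G) : ℝ :=
  γ.inner p (fund B p ξ) (fund B p η)

/-- The adjoint `ad^*_ζ` of `ad_ζ` for `β_p`: `β_p(ad^*_ζ ξ, χ) = β_p(ξ, [ζ, χ])`. -/
def adStar (p : P) (ζ ξ : GroupLieAlgebra IG G) : GroupLieAlgebra IG G :=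
  Classical.epsilon fun η : GroupLieAlgebra IG G =>
    ∀ χ : GroupLieAlgebra IG G, fiberMetric B γ p η χ = fiberMetric B γ p ξ ⁅ζ, χ⁆

/-- The connection `∇^{P,V}_u V = ω(∇^P_u V)` induced on the vertical bundle by the Levi-Civita
connection. -/
def nablaPV (V : Π q : P, TangentSpace IP q) (p : P) (u : TangentSpace IP p) : TangentSpace IP p :=
  vert B γ p (leviCivita γ V p u)

/-- The connection `dξ + ½ [ω̂, ξ]` on the trivial bundle with fibre the Lie algebra. -/
def hatNabla (ξ : Π q : P, Bundle.Trivial P EG q) (p : P) (u : TangentSpace IP p) :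
    Bundle.Trivial P EG p :=
  let c : GroupLieAlgebra IG G := ⁅connForm B γ p u, (ξ p : GroupLieAlgebra IG G)⁆
  let c' : EG := c
  mvfderiv IP (F := EG) ξ p u + (1 / 2 : ℝ) • c'

/-- The connection `∇^ω` on the vertical bundle, `∇^ω_u ξ^* = (dξ(u) + ½ [ω̂(u), ξ])^*`. -/
def nablaOmega (V : Π q : P, TangentSpace IP q) (p : P) (u : TangentSpace IP p) :
    TangentSpace IP p :=
  fund B p (hatNabla B γ (fun q => connForm B γ q (V q)) p u)

/-- The difference `∇^{P,V}_{D₁} D₂^V - ∇^ω_{D₁} D₂^V`, for vector fields. -/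
def thetaField (D₁ D₂ : Π q : P, TangentSpace IP q) (p : P) : TangentSpace IP p :=
  nablaPV B γ (fun q => vert B γ q (D₂ q)) p (D₁ p) -
    nablaOmega B γ (fun q => vert B γ q (D₂ q)) p (D₁ p)

/-- O'Neill's `T(D₁, D₂) = [∇^P_{D₁^V} D₂^H]^V + [∇^P_{D₁^V} D₂^V]^H`, for vector fields. -/
def oneillField (D₁ D₂ : Π q : P, TangentSpace IP q) (p : P) : TangentSpace IP p :=
  vert B γ p (leviCivita γ (fun q => horiz B γ q (D₂ q)) p (vert B γ p (D₁ p))) +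
    horiz B γ p (leviCivita γ (fun q => vert B γ q (D₂ q)) p (vert B γ p (D₁ p)))

/-- The difference tensor `Θ` at `p`. -/
def theta (p : P) (u v : TangentSpace IP p) : TangentSpace IP p :=
  thetaField B γ (constExt EP u) (constExt EP v) p

/-- O'Neill's tensor `T` at `p`. -/
def oneill (p : P) (u v : TangentSpace IP p) : TangentSpace IP p :=
  oneillField B γ (constExt EP u) (constExt EP v) p

/-- `V` is a smooth vertical `G`-invariant vector field on `P`. -/
def IsInvariantVertical (V : Π q : P, TangentSpace IP q) : Prop :=
  IsSmoothField IP V ∧ (∀ p, ∃ ξ, V p = fund B p ξ) ∧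
    ∀ (a : G) (p : P), V (B.act p a) = translate B a p (V p)

/-- `X` is a basic vector field on `P`: smooth, horizontal, and projectable to a smooth field `Y`
on `M`. -/
def IsBasic (X : Π q : P, TangentSpace IP q) : Prop :=
  IsSmoothField IP X ∧ (∀ p, vert B γ p (X p) = 0) ∧
    ∃ Y : Π x : M, TangentSpace IM x, IsSmoothField IM Y ∧
      ∀ p, mfderiv IP IM B.proj p (X p) = Y (B.proj p)

/-- The horizontal lift to `T_pP` of a tangent vector of `M` at `proj p`. -/
def hlift (p : P) (w : TangentSpace IM (B.proj p)) : TangentSpace IP p :=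
  Function.invFunOn (mfderiv IP IM B.proj p) {v : TangentSpace IP p | vert B γ p v = 0} w

/-- The fibre at `x` of the adjoint bundle `P ×_G 𝔤`, as the space of the maps `φ` from the fibre
of `P` over `x` to the Lie algebra with `φ(pa) = Ad_{a⁻¹} φ(p)`; the class of `(p, ξ)` is the `φ`
with `φ(p) = ξ`. -/
def adFiber (x : M) : Submodule ℝ ((B.proj ⁻¹' {x} : Set P) → GroupLieAlgebra IG G) where
  carrier := {φ | ∀ (a : G) (p : (B.proj ⁻¹' {x} : Set P)),
    φ ⟨B.act p a, (B.proj_act p a).trans p.2⟩ = Ad IG a⁻¹ (φ p)}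
  add_mem' h h' a p := by simp [h a p, h' a p]
  zero_mem' a p := by simp
  smul_mem' c φ h a p := by simp [h a p]

/-- The equivariant map `P → 𝔤` that represents a section of the adjoint bundle. -/
def equivariantMap (s : Π x : M, adFiber B x) (p : P) : GroupLieAlgebra IG G :=
  (s (B.proj p)).1 ⟨p, rfl⟩

/-- A smooth section of the adjoint bundle. -/
def IsSmoothSection (s : Π x : M, adFiber B x) : Prop :=
  ContMDiff IP 𝓘(ℝ, EG) (M' := EG) ∞ (equivariantMap B s)

/-- The space `Γ(M, ad P)` of the smooth sections of the adjoint bundle. -/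
abbrev AdSection := {s : Π x : M, adFiber B x // IsSmoothSection B s}

/-- The vertical field `p ↦ ν(p)^*_p` on `P` given by a section `ν` of the adjoint bundle. -/
def tilde (s : Π x : M, adFiber B x) (p : P) : TangentSpace IP p :=
  fund B p (equivariantMap B s p)

/-- A connection on the adjoint bundle. -/
@[ext]
structure AdConnection where
  /-- the covariant derivative `∇_w s` at `x`, for `w ∈ T_xM` -/
  toFun : AdSection B → Π x : M, TangentSpace IM x →ₗ[ℝ] adFiber B x
  add : ∀ s t u : AdSection B, (∀ x, u.1 x = s.1 x + t.1 x) →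
    ∀ x w, toFun u x w = toFun s x w + toFun t x w
  leibniz : ∀ (f : M → ℝ) (s u : AdSection B), ContMDiff IM 𝓘(ℝ, ℝ) ∞ f →
    (∀ x, u.1 x = f x • s.1 x) →
    ∀ x w, toFun u x w = mvfderiv IM f x w • s.1 x + f x • toFun s x w
  smooth : ∀ (s : AdSection B) (Y : Π x : M, TangentSpace IM x), IsSmoothField IM Y →
    IsSmoothSection B fun x => toFun s x (Y x)

/-- A smooth 1-form on `M` with values in the endomorphisms of the adjoint bundle. -/
@[ext]
structure AdEndForm where
  /-- the endomorphism given by `w ∈ T_xM` -/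
  toFun : Π x : M, TangentSpace IM x →ₗ[ℝ] adFiber B x →ₗ[ℝ] adFiber B x
  smooth : ∀ (s : AdSection B) (Y : Π x : M, TangentSpace IM x), IsSmoothField IM Y →
    IsSmoothSection B fun x => toFun x (Y x) (s.1 x)

/-- `∇` is the connection `∇^{ad,V}` on the adjoint bundle that `∇^{P,V}` induces: the vertical
field of `∇_w s` is the derivative with `∇^{P,V}`, along the horizontal lift of `w`, of that
of `s`. -/
def IsInducedByNablaPV (C : AdConnection B) : Prop :=
  ∀ (s : AdSection B) (p : P) (w : TangentSpace IM (B.proj p)),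
    fund B p ((C.toFun s (B.proj p) w).1 ⟨p, rfl⟩) =
      nablaPV B γ (tilde B s.1) p (hlift B γ p w)

/-- `∇` is the connection `∇^ad` on the adjoint bundle that the principal connection induces: the
equivariant map of `∇_w s` is the derivative, along the horizontal lift of `w`, of that of `s`. -/
def IsInducedByConnection (C : AdConnection B) : Prop :=
  ∀ (s : AdSection B) (p : P) (w : TangentSpace IM (B.proj p)),
    (C.toFun s (B.proj p) w).1 ⟨p, rfl⟩ =
      mvfderiv IP (F := EG) (equivariantMap B s.1) p (hlift B γ p w)

/-- `A` is the form `T^ad` induced by O'Neill's tensor: `A(w)φ` has the vertical vectors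
`T(φ(p)^*_p, w^h_p)`, with `w^h` the horizontal lift. -/
def IsInducedByOneill (A : AdEndForm B) : Prop :=
  ∀ (p : P) (w : TangentSpace IM (B.proj p)) (φ : adFiber B (B.proj p)),
    fund B p ((A.toFun (B.proj p) w φ).1 ⟨p, rfl⟩) =
      oneill B γ p (fund B p (φ.1 ⟨p, rfl⟩)) (hlift B γ p w)

/-- The pullback connection `Φ^*∇^ω` on the pullback by `Φ : N → P` of the vertical bundle. -/
def pullbackOmega {EN : Type*} [NormedAddCommGroup EN] [NormedSpace ℝ EN]
    {HN : Type*} [TopologicalSpace HN] {IN : ModelWithCorners ℝ EN HN}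
    {N : Type*} [TopologicalSpace N] [ChartedSpace HN N] (Φ : N → P)
    (S : Π y : N, TangentSpace IP (Φ y)) (x : N) (u : TangentSpace IN x) : TangentSpace IP (Φ x) :=
  fund B (Φ x) (pullbackCov EG (V := Bundle.Trivial P EG) (hatNabla B γ) Φ
    (fun y => connForm B γ (Φ y) (S y)) x u)

end Principal

end KK

end

set_option linter.unusedSectionVars false

noncomputable section

namespace KK

/-! ### Derivatives of vector-valued functions in charts -/

section ChartCalculus

variable {E : Type*} [NormedAddCommGroup E] [NormedSpace ℝ E]
  {H : Type*} [TopologicalSpace H] {I : ModelWithCorners ℝ E H}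
  {M : Type*} [TopologicalSpace M] [ChartedSpace H M]
  {E' : Type*} [NormedAddCommGroup E'] [NormedSpace ℝ E']
  {H' : Type*} [TopologicalSpace H'] {I' : ModelWithCorners ℝ E' H'}
  {N : Type*} [TopologicalSpace N] [ChartedSpace H' N]
  {F : Type*} [NormedAddCommGroup F] [NormedSpace ℝ F]

lemma mvfderiv_comp_map {g : M → F} {f : N → M} (x : N) (hg : MDifferentiableAt I 𝓘(ℝ, F) g (f x))
    (hf : MDifferentiableAt I' I f x) (v : TangentSpace I' x) :
    mvfderiv I' (fun y => g (f y)) x v = mvfderiv I g (f x) (mfderiv I' I f x v) :=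
  mfderiv_comp_apply x hg hf v

lemma mvfderiv_comp_map_of_eq {g : M → F} {f : N → M} {x : N} {y : M} (h : f x = y)
    (hg : MDifferentiableAt I 𝓘(ℝ, F) g y)
    (hf : MDifferentiableAt I' I f x) (v : TangentSpace I' x) :
    mvfderiv I' (fun y => g (f y)) x v = mvfderiv I g y (mfderiv I' I f x v : E) :=
  mfderiv_comp_apply_of_eq x hg hf h v

lemma mvfderiv_congr {f g : M → F} {x : M} (h : f =ᶠ[𝓝 x] g) :
    mvfderiv I f x = mvfderiv I g x := by
  have h1 : mfderiv I 𝓘(ℝ, F) f x = mfderiv I 𝓘(ℝ, F) g x := h.mfderiv_eq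
  exact h1

lemma mvfderiv_eq_fderiv_model (f : E → F) (x v : E) :
    mvfderiv 𝓘(ℝ, E) f x v = fderiv ℝ f x v := by
  rw [mvfderiv, mfderiv_eq_fderiv]
  rfl

variable [IsManifold I ∞ M]

lemma components_eq_mfderiv {x y : M} (hy : y ∈ (chartAt H x).source) (v : TangentSpace I y) :
    (components x v : E) = mfderiv I 𝓘(ℝ, E) (extChartAt I x) y v := by
  rw [components, TangentBundle.continuousLinearMapAt_trivializationAt hy]
  rfl

variable [I.Boundaryless]

lemma mdifferentiableAt_extChartAt_symm {x : M} {z : E} (hz : z ∈ (extChartAt I x).target) :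
    MDifferentiableAt 𝓘(ℝ, E) I (extChartAt I x).symm z := by
  have := mdifferentiableWithinAt_extChartAt_symm (I := I) hz
  rwa [I.range_eq_univ, mdifferentiableWithinAt_univ] at this

lemma differentiableAt_comp_extChartAt_symm {f : M → F} {x y : M} (hy : y ∈ (chartAt H x).source)
    (hf : MDifferentiableAt I 𝓘(ℝ, F) f y) :
    DifferentiableAt ℝ (f ∘ (extChartAt I x).symm) (extChartAt I x y) := by
  have hy' : y ∈ (extChartAt I x).source := by rwa [extChartAt_source]
  rw [← mdifferentiableAt_iff_differentiableAt]
  refine MDifferentiableAt.comp (I' := I) _ ?_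
    (mdifferentiableAt_extChartAt_symm ((extChartAt I x).map_source hy'))
  rwa [(extChartAt I x).left_inv hy']

lemma mvfderiv_eq_fderiv {f : M → F} {x y : M} (hy : y ∈ (chartAt H x).source)
    (hf : MDifferentiableAt I 𝓘(ℝ, F) f y) (v : TangentSpace I y) :
    mvfderiv I f y v =
      fderiv ℝ (f ∘ (extChartAt I x).symm) (extChartAt I x y) (components x v : E) := by
  have hy' : y ∈ (extChartAt I x).source := by rwa [extChartAt_source]
  have h1 : f =ᶠ[𝓝 y] fun y => (f ∘ (extChartAt I x).symm) (extChartAt I x y) := by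
    filter_upwards [extChartAt_source_mem_nhds' (I := I) hy'] with q hq
    simp only [Function.comp_apply, (extChartAt I x).left_inv hq]
  rw [mvfderiv_congr h1, components_eq_mfderiv hy]
  have h2 := mvfderiv_comp_map (I := 𝓘(ℝ, E)) y
    (differentiableAt_comp_extChartAt_symm hy hf).mdifferentiableAt
    (mdifferentiableAt_extChartAt hy) v
  exact h2.trans (mvfderiv_eq_fderiv_model _ _ _)

lemma contDiffAt_comp_extChartAt_symm {n : WithTop ℕ∞} (hn : n ≤ ∞) {f : M → F} {x : M}
    (hf : ContMDiffAt I 𝓘(ℝ, F) n f x) :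
    ContDiffAt ℝ n (f ∘ (extChartAt I x).symm) (extChartAt I x x) := by
  rw [← contMDiffAt_iff_contDiffAt]
  have h := contMDiffWithinAt_extChartAt_symm_target_self (I := I) (n := ∞) x
  refine ContMDiffAt.comp (I' := I) _ ?_ ((h.contMDiffAt (extChartAt_target_mem_nhds x)).of_le hn)
  rwa [extChartAt_to_inv]

variable (I M) in
/-- The operation that differentiates, at each point `x`, the components of a vector field in the
preferred chart at `x`. -/
def coordCov : CovariantDerivative I E (fun x : M => TangentSpace I x) where
  toFun σ x := (trivializationAt E (TangentSpace I) x).symmL ℝ x ∘L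
    mvfderiv I (fun y => (components x (σ y) : E)) x
  isCovariantDerivativeOnUniv :=
    { add := fun {σ σ' x} hσ hσ' _ => by
        rw [mdifferentiableAt_components] at hσ hσ'
        have : (fun y => (components x ((σ + σ') y) : E)) =
          (fun y => components x (σ y)) + (fun y => components x (σ' y)) := by
          ext y; simp [components]
        rw [this, mvfderiv_add hσ hσ']
        ext u
        simp
      leibniz := fun {σ f x} hσ hf _ => by
        rw [mdifferentiableAt_components] at hσ
        have : (fun y => (components x ((f • σ) y) : E)) =
          f • (fun y => components x (σ y)) := by
          ext y; simp [components]
        rw [this, mvfderiv_smul hf hσ]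
        ext u
        have h2 : (trivializationAt E (TangentSpace I) x).symmL ℝ x (components x (σ x)) = σ x :=
          constExt_self E (σ x)
        simp [h2] }

omit [I.Boundaryless] in
lemma coordCov_apply (σ : Π x : M, TangentSpace I x) (x : M) (u : TangentSpace I x) :
    coordCov I M σ x u = (trivializationAt E (TangentSpace I) x).symmL ℝ x
        (mvfderiv I (fun y => (components x (σ y) : E)) x u) := rfl

omit [I.Boundaryless] in
lemma components_symmL (x : M) (e : E) :
    (components x ((trivializationAt E (TangentSpace I) x).symmL ℝ x e) : E) = e :=
  (trivializationAt E (TangentSpace I) x).continuousLinearMapAt_symmL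
    (FiberBundle.mem_baseSet_trivializationAt E (TangentSpace I) x) e

omit [I.Boundaryless] in
lemma components_coordCov (σ : Π x : M, TangentSpace I x) (x : M) (u : TangentSpace I x) :
    (components x (coordCov I M σ x u) : E) = mvfderiv I (fun y => (components x (σ y) : E)) x u :=
  components_symmL x _

omit [I.Boundaryless] in
lemma coordCov_constExt {x : M} (v u : TangentSpace I x) : coordCov I M (constExt E v) x u = 0 := by
  rw [coordCov_apply, mvfderiv_congr (components_constExt E v), mvfderiv_const]
  simp

omit [I.Boundaryless] in
lemma mlieBracket_eq_coordCov [FiniteDimensional ℝ E] {x : M} {V W : Π y : M, TangentSpace I y}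
    (hV : MDiffAt (T% V) x) (hW : MDiffAt (T% W) x) :
    mlieBracket I V W x = coordCov I M W x (V x) - coordCov I M V x (W x) := by
  have h1 := CovariantDerivative.torsion_apply (coordCov I M) hV hW
  have h2 := CovariantDerivative.torsion_apply (coordCov I M) (mdifferentiableAt_constExt E (V x))
    (mdifferentiableAt_constExt E (W x))
  simp only [constExt_self, mlieBracket_constExt, coordCov_constExt, sub_zero] at h2
  rw [h2] at h1
  exact (sub_eq_zero.1 h1.symm).symm

lemma mvfderiv_mvfderiv {h : M → F} {x : M} {W : Π y : M, TangentSpace I y}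
    (hh : ContMDiffAt I 𝓘(ℝ, F) 2 h x) (hW : MDiffAt (T% W) x) (v : TangentSpace I x) :
    mvfderiv I (fun y => mvfderiv I h y (W y)) x v =
      fderiv ℝ (fderiv ℝ (h ∘ (extChartAt I x).symm)) (extChartAt I x x)
        (components x v) (components x (W x) : E) + mvfderiv I h x (coordCov I M W x v) := by
  set k := h ∘ (extChartAt I x).symm with hk
  have hkC : ContDiffAt ℝ 2 k (extChartAt I x x) :=
    contDiffAt_comp_extChartAt_symm (by norm_cast) hh
  have hk' : DifferentiableAt ℝ (fderiv ℝ k) (extChartAt I x x) :=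
    (hkC.fderiv_right (m := 1) (by norm_num)).differentiableAt (by norm_num)
  have hWc := (mdifferentiableAt_components E).1 hW
  have hnear : ∀ᶠ y in 𝓝 x, y ∈ (chartAt H x).source ∧ MDifferentiableAt I 𝓘(ℝ, F) h y := by
    refine Filter.Eventually.and ((chartAt H x).open_source.mem_nhds (mem_chart_source H x)) ?_
    filter_upwards [(contMDiffAt_iff_contMDiffAt_nhds (by simp)).1 hh] with y hy
    exact hy.mdifferentiableAt (by norm_num)
  have e1 : (fun y => mvfderiv I h y (W y)) =ᶠ[𝓝 x]
      fun y => fderiv ℝ k (extChartAt I x y) (components x (W y) : E) := by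
    filter_upwards [hnear] with y hy
    exact mvfderiv_eq_fderiv hy.1 hy.2 _
  have hd := differentiableAt_comp_extChartAt_symm (mem_chart_source H x) hWc
  have e2 : ((fun y => fderiv ℝ k (extChartAt I x y) (components x (W y) : E)) ∘
      (extChartAt I x).symm) =ᶠ[𝓝 (extChartAt I x x)] fun z => fderiv ℝ k z
        (((fun y => (components x (W y) : E)) ∘ (extChartAt I x).symm) z) := by
    filter_upwards [extChartAt_target_mem_nhds (I := I) x] with z hz
    simp only [Function.comp_apply, (extChartAt I x).right_inv hz]
  have hmd : MDifferentiableAt I 𝓘(ℝ, F)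
      (fun y => fderiv ℝ k (extChartAt I x y) (components x (W y) : E)) x := by
    have h1 : MDifferentiableAt I 𝓘(ℝ, E →L[ℝ] F) (fun y => fderiv ℝ k (extChartAt I x y)) x :=
      hk'.mdifferentiableAt.comp x (mdifferentiableAt_extChartAt (mem_chart_source H x))
    exact h1.clm_apply hWc
  rw [mvfderiv_congr e1, mvfderiv_eq_fderiv (mem_chart_source H x) hmd, e2.fderiv_eq,
    fderiv_clm_apply hk' hd, mvfderiv_eq_fderiv (mem_chart_source H x) hnear.self_of_nhds.2,
    components_coordCov, mvfderiv_eq_fderiv (mem_chart_source H x) hWc]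
  simp only [add_apply, ContinuousLinearMap.comp_apply,
    ContinuousLinearMap.flip_apply, Function.comp_apply, hk]
  rw [extChartAt_to_inv (I := I) x]
  abel

/-- Differentiation along a Lie bracket is the commutator of the differentiations. -/
lemma mvfderiv_mlieBracket [FiniteDimensional ℝ E] {h : M → F} {x : M}
    {V W : Π y : M, TangentSpace I y}
    (hh : ContMDiffAt I 𝓘(ℝ, F) 2 h x) (hV : MDiffAt (T% V) x) (hW : MDiffAt (T% W) x) :
    mvfderiv I h x (mlieBracket I V W x) =
      mvfderiv I (fun y => mvfderiv I h y (W y)) x (V x) -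
        mvfderiv I (fun y => mvfderiv I h y (V y)) x (W x) := by
  have hsymm : IsSymmSndFDerivAt ℝ (h ∘ (extChartAt I x).symm) (extChartAt I x x) :=
    (contDiffAt_comp_extChartAt_symm (by norm_cast) hh).isSymmSndFDerivAt (by simp)
  rw [mlieBracket_eq_coordCov hV hW, map_sub, mvfderiv_mvfderiv hh hW, mvfderiv_mvfderiv hh hV,
    hsymm.eq]
  abel

variable [IsManifold I' ∞ N] [I'.Boundaryless]

/-- Partial derivatives in the two factors of a product commute. -/
lemma mvfderiv_partial_comm {h : N × M → F} {a : N} {b : M}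
    (hh : ContMDiffAt (I'.prod I) 𝓘(ℝ, F) 2 h (a, b)) (u : TangentSpace I' a)
    (w : TangentSpace I b) :
    mvfderiv I' (fun a' => mvfderiv I (fun b' => h (a', b')) b w) a u =
      mvfderiv I (fun b' => mvfderiv I' (fun a' => h (a', b')) a u) b w := by
  set φ := extChartAt I' a with hφ
  set ψ := extChartAt I b with hψ
  set K : E' × E → F := fun z => h (φ.symm z.1, ψ.symm z.2) with hK
  have hKC : ContDiffAt ℝ 2 K (φ a, ψ b) := by
    have := contDiffAt_comp_extChartAt_symm (by norm_cast) hh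
    rw [extChartAt_prod] at this
    exact this
  have hK1 : ∀ᶠ z in 𝓝 (φ a, ψ b), DifferentiableAt ℝ K z := by
    filter_upwards [hKC.eventually (by simp)] with z hz
    exact hz.differentiableAt (by norm_num)
  have hK2 : DifferentiableAt ℝ (fderiv ℝ K) (φ a, ψ b) :=
    (hKC.fderiv_right (m := 1) (by norm_num)).differentiableAt (by norm_num)
  have hca : ContinuousAt φ a := continuousAt_extChartAt a
  have hcb : ContinuousAt ψ b := continuousAt_extChartAt b
  have hh1 : ∀ᶠ z in 𝓝 (a, b), MDifferentiableAt (I'.prod I) 𝓘(ℝ, F) h z := by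
    filter_upwards [(contMDiffAt_iff_contMDiffAt_nhds (by simp)).1 hh] with z hz
    exact hz.mdifferentiableAt (by norm_num)
  have hpa : Filter.Tendsto (fun a' : N => (a', b)) (𝓝 a) (𝓝 (a, b)) :=
    (continuous_id.prodMk continuous_const).tendsto' _ _ rfl
  have hpb : Filter.Tendsto (fun b' : M => (a, b')) (𝓝 b) (𝓝 (a, b)) :=
    (continuous_const.prodMk continuous_id).tendsto' _ _ rfl
  have hKa : Filter.Tendsto (fun a' : N => (φ a', ψ b)) (𝓝 a) (𝓝 (φ a, ψ b)) :=
    hca.prodMk_nhds tendsto_const_nhds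
  have hKb : Filter.Tendsto (fun b' : M => (φ a, ψ b')) (𝓝 b) (𝓝 (φ a, ψ b)) :=
    tendsto_const_nhds.prodMk_nhds hcb
  have hsa := (chartAt H' a).open_source.mem_nhds (mem_chart_source H' a)
  have hsb := (chartAt H b).open_source.mem_nhds (mem_chart_source H b)
  have e1 : (fun a' => mvfderiv I (fun b' => h (a', b')) b w) =ᶠ[𝓝 a]
      fun a' => fderiv ℝ K (φ a', ψ b) (0, (components b w : E)) := by
    filter_upwards [hpa.eventually hh1, hKa.eventually hK1, hsa] with a' h1 h2 h3
    have hd : MDifferentiableAt I 𝓘(ℝ, F) (fun b' => h (a', b')) b :=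
      h1.comp b (mdifferentiableAt_const.prodMk mdifferentiableAt_id)
    rw [mvfderiv_eq_fderiv (mem_chart_source H b) hd]
    have e : (fun b' => h (a', b')) ∘ ψ.symm = fun t => K (φ a', t) := by
      ext t
      simp only [hK, Function.comp_apply]
      rw [φ.left_inv (by rwa [hφ, extChartAt_source])]
    have h4 : HasFDerivAt (fun t => K (φ a', t)) _ (ψ b) :=
      HasFDerivAt.comp (g := K) (ψ b) h2.hasFDerivAt (hasFDerivAt_prodMk_right (φ a') (ψ b))
    rw [← hψ, e, h4.fderiv]
    rfl
  have e2 : (fun b' => mvfderiv I' (fun a' => h (a', b')) a u) =ᶠ[𝓝 b]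
      fun b' => fderiv ℝ K (φ a, ψ b') ((components a u : E'), 0) := by
    filter_upwards [hpb.eventually hh1, hKb.eventually hK1, hsb] with b' h1 h2 h3
    have hd : MDifferentiableAt I' 𝓘(ℝ, F) (fun a' => h (a', b')) a :=
      h1.comp a (mdifferentiableAt_id.prodMk mdifferentiableAt_const)
    rw [mvfderiv_eq_fderiv (mem_chart_source H' a) hd]
    have e : (fun a' => h (a', b')) ∘ φ.symm = fun t => K (t, ψ b') := by
      ext t
      simp only [hK, Function.comp_apply]
      rw [ψ.left_inv (by rwa [hψ, extChartAt_source])]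
    have h4 : HasFDerivAt (fun t => K (t, ψ b')) _ (φ a) :=
      HasFDerivAt.comp (g := K) (φ a) h2.hasFDerivAt (hasFDerivAt_prodMk_left (φ a) (ψ b'))
    rw [← hφ, e, h4.fderiv]
    rfl
  have hsymm : IsSymmSndFDerivAt ℝ K (φ a, ψ b) := hKC.isSymmSndFDerivAt (by simp)
  have d1 := (ContinuousLinearMap.apply ℝ F ((0 : E'), (components b w : E))).hasFDerivAt.comp
    (φ a) (hK2.hasFDerivAt.comp (φ a) (hasFDerivAt_prodMk_left (φ a) (ψ b)))
  have d2 := (ContinuousLinearMap.apply ℝ F ((components a u : E'), (0 : E))).hasFDerivAt.comp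
    (ψ b) (hK2.hasFDerivAt.comp (ψ b) (hasFDerivAt_prodMk_right (φ a) (ψ b)))
  rw [mvfderiv_congr e1, mvfderiv_congr e2]
  have f1 := mvfderiv_comp_map (I := 𝓘(ℝ, E')) (I' := I') a
    d1.differentiableAt.mdifferentiableAt (mdifferentiableAt_extChartAt (mem_chart_source H' a)) u
  have f2 := mvfderiv_comp_map (I := 𝓘(ℝ, E)) (I' := I) b
    d2.differentiableAt.mdifferentiableAt (mdifferentiableAt_extChartAt (mem_chart_source H b)) w
  rw [← components_eq_mfderiv (mem_chart_source H' a), mvfderiv_eq_fderiv_model, d1.fderiv] at f1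
  rw [← components_eq_mfderiv (mem_chart_source H b), mvfderiv_eq_fderiv_model, d2.fderiv] at f2
  refine f1.trans (Eq.trans ?_ f2.symm)
  exact hsymm.eq _ _

end ChartCalculus

/-! ### Families of linear maps and smoothness -/

section Families

variable {E : Type*} [NormedAddCommGroup E] [NormedSpace ℝ E]
  {H : Type*} [TopologicalSpace H] {I : ModelWithCorners ℝ E H}
  {M : Type*} [TopologicalSpace M] [ChartedSpace H M]
  {E' : Type*} [NormedAddCommGroup E'] [NormedSpace ℝ E']
  {H' : Type*} [TopologicalSpace H'] {I' : ModelWithCorners ℝ E' H'}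
  {N : Type*} [TopologicalSpace N] [ChartedSpace H' N]
  {F : Type*} [NormedAddCommGroup F] [NormedSpace ℝ F] [FiniteDimensional ℝ F]
  {F' : Type*} [NormedAddCommGroup F'] [NormedSpace ℝ F']

lemma toContinuousLinearMap_eq_sum (L : F →ₗ[ℝ] F') :
    LinearMap.toContinuousLinearMap L = ∑ i, (ContinuousLinearMap.smulRightL ℝ F F'
      (LinearMap.toContinuousLinearMap ((Module.finBasis ℝ F).coord i)))
        (L (Module.finBasis ℝ F i)) := by
  ext v
  simp only [LinearMap.coe_toContinuousLinearMap', sum_apply,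
    ContinuousLinearMap.smulRightL_apply_apply, ContinuousLinearMap.smulRight_apply]
  conv_lhs => rw [← (Module.finBasis ℝ F).sum_repr v]
  simp only [map_sum, map_smul, Module.Basis.coord_apply]

lemma contMDiffAt_toContinuousLinearMap {n : WithTop ℕ∞} {L : M → F →ₗ[ℝ] F'} {x : M}
    (hL : ∀ e, ContMDiffAt I 𝓘(ℝ, F') n (fun y => L y e) x) :
    ContMDiffAt I 𝓘(ℝ, F →L[ℝ] F') n (fun y => LinearMap.toContinuousLinearMap (L y)) x := by
  rw [funext fun y => toContinuousLinearMap_eq_sum (L y)]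
  refine ContMDiffAt.sum fun i _ => ?_
  exact (ContinuousLinearMap.contMDiff _).contMDiffAt.comp x (hL _)

lemma contMDiffAt_linear_apply {n : WithTop ℕ∞} {L : M → F →ₗ[ℝ] F'} {s : M → F} {x : M}
    (hL : ∀ e, ContMDiffAt I 𝓘(ℝ, F') n (fun y => L y e) x)
    (hs : ContMDiffAt I 𝓘(ℝ, F) n s x) :
    ContMDiffAt I 𝓘(ℝ, F') n (fun y => L y (s y)) x :=
  (contMDiffAt_toContinuousLinearMap hL).clm_apply hs

lemma mdifferentiableAt_toContinuousLinearMap [IsManifold I ∞ M] [I.Boundaryless]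
    {L : M → F →ₗ[ℝ] F'} {x : M}
    (hL : ∀ e, MDifferentiableAt I 𝓘(ℝ, F') (fun y => L y e) x) :
    MDifferentiableAt I 𝓘(ℝ, F →L[ℝ] F') (fun y => LinearMap.toContinuousLinearMap (L y)) x := by
  rw [funext fun y => toContinuousLinearMap_eq_sum (L y)]
  have h : ∀ i, MDifferentiableAt I 𝓘(ℝ, F →L[ℝ] F') (fun y =>
      (ContinuousLinearMap.smulRightL ℝ F F' (LinearMap.toContinuousLinearMap
        ((Module.finBasis ℝ F).coord i))) (L y (Module.finBasis ℝ F i))) x := fun i =>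
    (ContinuousLinearMap.mdifferentiableAt _).comp x (hL _)
  have hs := MDifferentiableAt.sum (t := Finset.univ) fun i _ => h i
  rwa [show (∑ i, _ : M → F →L[ℝ] F') = _ from Finset.sum_fn _ _] at hs

/-- The product rule for a family of linear maps applied to a vector-valued function. -/
lemma mvfderiv_linear_apply [IsManifold I ∞ M] [I.Boundaryless]
    {L : M → F →ₗ[ℝ] F'} {s : M → F} {x : M}
    (hL : ∀ e, MDifferentiableAt I 𝓘(ℝ, F') (fun y => L y e) x)
    (hs : MDifferentiableAt I 𝓘(ℝ, F) s x) (u : TangentSpace I x) :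
    mvfderiv I (fun y => L y (s y)) x u =
      mvfderiv I (fun y => L y (s x)) x u + L x (mvfderiv I s x u) := by
  have hc := mdifferentiableAt_toContinuousLinearMap hL
  have h1 := differentiableAt_comp_extChartAt_symm (mem_chart_source H x) hc
  have h2 := differentiableAt_comp_extChartAt_symm (mem_chart_source H x) hs
  have h3 : MDifferentiableAt I 𝓘(ℝ, F') (fun y => L y (s y)) x := hc.clm_apply hs
  rw [mvfderiv_eq_fderiv (mem_chart_source H x) h3,
    mvfderiv_eq_fderiv (mem_chart_source H x) (hL (s x)),
    mvfderiv_eq_fderiv (mem_chart_source H x) hs]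
  have e1 := fderiv_clm_apply h1 h2
  have e2 := fderiv_clm_apply h1 (differentiableAt_const (s x))
  refine (DFunLike.congr_fun e1 _).trans ((add_comm _ _).trans ?_)
  refine congrArg₂ _ ((DFunLike.congr_fun e2 _).trans ?_).symm ?_
  · simp only [add_apply, ContinuousLinearMap.comp_apply, ContinuousLinearMap.flip_apply,
      Function.comp_apply, fderiv_fun_const, Pi.zero_apply, zero_apply, map_zero,
      zero_add]
    rw [extChartAt_to_inv (I := I) x]
    rfl
  · simp only [Function.comp_apply]
    rw [extChartAt_to_inv (I := I) x]
    rfl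

/-- A vector-valued function is smooth if its pairings under a smooth family of nondegenerate
bilinear forms are. -/
lemma contMDiffAt_of_nondegenerate {n : WithTop ℕ∞} {A : M → F →ₗ[ℝ] F →ₗ[ℝ] ℝ} {ν : M → F} {x : M}
    (hA : ∀ e e', ContMDiffAt I 𝓘(ℝ, ℝ) n (fun y => A y e e') x)
    (hinj : ∀ y, Function.Injective (A y))
    (hν : ∀ e, ContMDiffAt I 𝓘(ℝ, ℝ) n (fun y => A y (ν y) e) x) :
    ContMDiffAt I 𝓘(ℝ, F) n ν x := by
  let D : (F →ₗ[ℝ] ℝ) ≃ₗ[ℝ] (F →L[ℝ] ℝ) := LinearMap.toContinuousLinearMap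
  let T : M → F →ₗ[ℝ] (F →L[ℝ] ℝ) := fun y => D.toLinearMap ∘ₗ A y
  have hT : ∀ e, ContMDiffAt I 𝓘(ℝ, F →L[ℝ] ℝ) n (fun y => T y e) x := fun e =>
    contMDiffAt_toContinuousLinearMap fun e' => hA e e'
  have hTc := contMDiffAt_toContinuousLinearMap hT
  have hTinj : ∀ y, Function.Injective (T y) := fun y => D.injective.comp (hinj y)
  have hfr : Module.finrank ℝ F = Module.finrank ℝ (F →L[ℝ] ℝ) := by
    rw [← D.finrank_eq]
    exact Subspace.dual_finrank_eq.symm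
  let e : ∀ y, F ≃L[ℝ] (F →L[ℝ] ℝ) := fun y =>
    (LinearEquiv.ofInjectiveOfFinrankEq (T y) (hTinj y) hfr).toContinuousLinearEquiv
  have he : ∀ y, (e y : F →L[ℝ] (F →L[ℝ] ℝ)) = LinearMap.toContinuousLinearMap (T y) := by
    intro y
    ext v
    rfl
  have hinv : ContMDiffAt I 𝓘(ℝ, (F →L[ℝ] ℝ) →L[ℝ] F) n
      (fun y => ContinuousLinearMap.inverse (LinearMap.toContinuousLinearMap (T y))) x := by
    have h := contDiffAt_map_inverse (n := n) (e x)
    rw [he] at h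
    exact h.contMDiffAt.comp x hTc
  have hc : ContMDiffAt I 𝓘(ℝ, F →L[ℝ] ℝ) n (fun y => T y (ν y)) x :=
    contMDiffAt_toContinuousLinearMap hν
  refine (hinv.clm_apply hc).congr_of_eventuallyEq (Filter.Eventually.of_forall fun y => ?_)
  simp only
  rw [← he, ContinuousLinearMap.inverse_equiv]
  exact ((e y).symm_apply_apply (ν y)).symm

variable [IsManifold I ∞ M]

/-- The derivative of a smooth function along a smooth family of tangent vectors is smooth. -/
lemma contMDiffAt_mvfderiv_apply {f : M → F'} (hf : ContMDiff I 𝓘(ℝ, F') ∞ f)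
    {b : N → M} {X : Π y, TangentSpace I (b y)} {x : N}
    (hX : ContMDiffAt I' I.tangent ∞ (fun y => (⟨b y, X y⟩ : TangentBundle I M)) x) :
    ContMDiffAt I' 𝓘(ℝ, F') ∞ (fun y => mvfderiv I f (b y) (X y)) x := by
  have h1 : ContMDiff I.tangent 𝓘(ℝ, F').tangent ∞ (tangentMap I 𝓘(ℝ, F') f) :=
    hf.contMDiff_tangentMap (by simp)
  have h2 := (contMDiff_snd_tangentBundle_modelSpace F' 𝓘(ℝ, F') (n := ∞)).comp h1
  exact h2.contMDiffAt.comp x hX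

/-- The inner product of two smooth families of tangent vectors is smooth. -/
lemma contMDiffAt_metric (γ : Metric I M) {b : N → M} {X Y : Π y, TangentSpace I (b y)} {x : N}
    (hX : ContMDiffAt I' I.tangent ∞ (fun y => (⟨b y, X y⟩ : TangentBundle I M)) x)
    (hY : ContMDiffAt I' I.tangent ∞ (fun y => (⟨b y, Y y⟩ : TangentBundle I M)) x) :
    ContMDiffAt I' 𝓘(ℝ, ℝ) ∞ (fun y => γ.inner (b y) (X y) (Y y)) x := by
  let _ : RiemannianBundle (fun x : M => TangentSpace I x) := ⟨γ.toRiemannianMetric⟩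
  exact ContMDiffAt.inner_bundle (F := E) (E := fun x : M => TangentSpace I x) hX hY

end Families

/-! ### Fundamental vector fields -/

section Fundamental

variable
  {EP : Type*} [NormedAddCommGroup EP] [NormedSpace ℝ EP]
  {HP : Type*} [TopologicalSpace HP] {IP : ModelWithCorners ℝ EP HP}
  {EM : Type*} [NormedAddCommGroup EM] [NormedSpace ℝ EM]
  {HM : Type*} [TopologicalSpace HM] {IM : ModelWithCorners ℝ EM HM}
  {EG : Type*} [NormedAddCommGroup EG] [NormedSpace ℝ EG]
  {HG : Type*} [TopologicalSpace HG] {IG : ModelWithCorners ℝ EG HG}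
  {P : Type*} [TopologicalSpace P] [ChartedSpace HP P]
  {M : Type*} [TopologicalSpace M] [ChartedSpace HM M]
  {G : Type*} [TopologicalSpace G] [ChartedSpace HG G] [Group G]
  (B : PrincipalBundle IP IM IG P M G)

lemma contMDiff_act_right (a : G) : ContMDiff IP IP ∞ fun p => B.act p a :=
  B.contMDiff_act.comp (contMDiff_id.prodMk contMDiff_const)

lemma contMDiff_orbit (p : P) : ContMDiff IG IP ∞ fun g => B.act p g :=
  B.contMDiff_act.comp (contMDiff_const.prodMk contMDiff_id)

lemma mdifferentiableAt_orbit (p : P) (g : G) : MDifferentiableAt IG IP (fun g => B.act p g) g :=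
  (contMDiff_orbit B p).mdifferentiable (by simp) g

lemma mdifferentiableAt_act_right (a : G) (p : P) :
    MDifferentiableAt IP IP (fun p => B.act p a) p :=
  (contMDiff_act_right B a).mdifferentiable (by simp) p

lemma mdifferentiableAt_proj (p : P) : MDifferentiableAt IP IM B.proj p :=
  B.contMDiff_proj.mdifferentiable (by simp) p

/-- The linear map `ξ ↦ ξ^*_p`. -/
def fundL (p : P) : GroupLieAlgebra IG G →ₗ[ℝ] TangentSpace IP p where
  toFun := fund B p
  map_add' ξ η := map_add (mfderiv IG IP (fun g => B.act p g) 1) ξ η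
  map_smul' c ξ := map_smul (mfderiv IG IP (fun g => B.act p g) 1) c ξ

lemma fund_add (p : P) (ξ η : GroupLieAlgebra IG G) :
    fund B p (ξ + η) = fund B p ξ + fund B p η := (fundL B p).map_add ξ η

lemma fund_sub (p : P) (ξ η : GroupLieAlgebra IG G) :
    fund B p (ξ - η) = fund B p ξ - fund B p η := (fundL B p).map_sub ξ η

lemma fund_smul (p : P) (c : ℝ) (ξ : GroupLieAlgebra IG G) :
    fund B p (c • ξ) = c • fund B p ξ := (fundL B p).map_smul c ξ

lemma fund_zero (p : P) : fund B p (0 : GroupLieAlgebra IG G) = 0 := (fundL B p).map_zero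

lemma fund_neg (p : P) (ξ : GroupLieAlgebra IG G) : fund B p (-ξ) = -fund B p ξ :=
  (fundL B p).map_neg ξ

/-- Vertical tangent vectors project to zero. -/
lemma mfderiv_proj_fund (p : P) (ξ : GroupLieAlgebra IG G) :
    mfderiv IP IM B.proj p (fund B p ξ) = 0 := by
  have h := mfderiv_comp_apply_of_eq (I := IG) (I' := IP) (I'' := IM) (g := B.proj)
    (f := fun g => B.act p g) (y := p) 1
    (mdifferentiableAt_proj B p) (mdifferentiableAt_orbit B p 1) (B.act_one p) ξ
  have e : B.proj ∘ (fun g => B.act p g) = fun _ => B.proj p := by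
    ext g
    exact B.proj_act p g
  rw [e, mfderiv_const] at h
  exact h.symm

/-- Right translations are compatible with the projection. -/
lemma mfderiv_proj_translate (a : G) (p : P) (v : TangentSpace IP p) :
    (mfderiv IP IM B.proj (B.act p a) (translate B a p v) : EM) = mfderiv IP IM B.proj p v := by
  have h := mfderiv_comp_apply (I := IP) (I' := IP) (I'' := IM) (g := B.proj)
    (f := fun q => B.act q a) p (mdifferentiableAt_proj B _) (mdifferentiableAt_act_right B a p) v
  have e : B.proj ∘ (fun q => B.act q a) = B.proj := by
    ext g
    exact B.proj_act g a
  rw [e] at h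
  exact h.symm

variable [LieGroup IG ∞ G]

lemma mdifferentiableAt_mul_left (a b : G) : MDifferentiableAt IG IG (fun g => a * g) b :=
  ((contMDiff_mul_left (I := IG) (n := ∞) (a := a)).mdifferentiable (by simp)) b

lemma mdifferentiableAt_conj (a b : G) : MDifferentiableAt IG IG (fun g => a * g * a⁻¹) b :=
  (((contMDiff_mul_right (I := IG) (n := ∞) (a := a⁻¹)).comp
    (contMDiff_mul_left (I := IG) (n := ∞) (a := a))).mdifferentiable (by simp)) b

lemma Ad_inv_Ad (a : G) (ξ : GroupLieAlgebra IG G) : Ad IG a⁻¹ (Ad IG a ξ) = ξ := by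
  have h := mfderiv_comp_apply_of_eq (I := IG) (I' := IG) (I'' := IG)
    (g := fun h : G => a⁻¹ * h * a⁻¹⁻¹) (f := fun h : G => a * h * a⁻¹) (y := 1) 1
    (mdifferentiableAt_conj a⁻¹ 1) (mdifferentiableAt_conj a 1) (by simp) ξ
  have e : (fun h : G => a⁻¹ * h * a⁻¹⁻¹) ∘ (fun h : G => a * h * a⁻¹) = id := by
    ext g
    simp [mul_assoc]
  rw [e, mfderiv_id] at h
  exact h.symm

lemma Ad_Ad_inv (a : G) (ξ : GroupLieAlgebra IG G) : Ad IG a (Ad IG a⁻¹ ξ) = ξ := by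
  have := Ad_inv_Ad a⁻¹ ξ
  rwa [inv_inv] at this

/-- Fundamental vector fields are equivariant. -/
lemma translate_fund (a : G) (p : P) (ξ : GroupLieAlgebra IG G) :
    translate B a p (fund B p ξ) = fund B (B.act p a) (Ad IG a⁻¹ ξ) := by
  have h1 := mfderiv_comp_apply_of_eq (I := IG) (I' := IP) (I'' := IP) (g := fun q => B.act q a)
    (f := fun g => B.act p g) (y := p) 1
    (mdifferentiableAt_act_right B a p) (mdifferentiableAt_orbit B p 1) (B.act_one p) ξ
  have h2 := mfderiv_comp_apply_of_eq (I := IG) (I' := IG) (I'' := IP)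
    (g := fun g => B.act (B.act p a) g)
    (f := fun h : G => a⁻¹ * h * a⁻¹⁻¹) (y := 1) 1
    (mdifferentiableAt_orbit B _ 1) (mdifferentiableAt_conj a⁻¹ 1) (by simp) ξ
  have e : (fun q => B.act q a) ∘ (fun g => B.act p g) =
      (fun g => B.act (B.act p a) g) ∘ (fun h : G => a⁻¹ * h * a⁻¹⁻¹) := by
    ext g
    simp [B.act_mul, mul_assoc]
  rw [e] at h1
  exact h1.symm.trans h2

/-- The orbit maps push left-invariant fields forward to fundamental fields. -/
lemma mfderiv_orbit_mulInvariantVectorField (p : P) (a : G) (ξ : GroupLieAlgebra IG G) :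
    mfderiv IG IP (fun g => B.act p g) a (mulInvariantVectorField ξ a) =
      fund B (B.act p a) ξ := by
  have h := mfderiv_comp_apply_of_eq (I := IG) (I' := IG) (I'' := IP)
    (g := fun g => B.act p g) (f := fun h : G => a * h) (y := a) 1
    (mdifferentiableAt_orbit B p a) (mdifferentiableAt_mul_left a 1) (mul_one a) ξ
  have e : (fun g => B.act p g) ∘ (fun h : G => a * h) = fun g => B.act (B.act p a) g := by
    ext g
    simp [B.act_mul]
  rw [e] at h
  exact h.symm

variable [IsManifold IP ∞ P]

/-- Fundamental vector fields are smooth. -/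
lemma contMDiff_fund (ξ : GroupLieAlgebra IG G) :
    ContMDiff IP IP.tangent ∞ fun p => (⟨p, fund B p ξ⟩ : TangentBundle IP P) := by
  let f₁ : P → TangentBundle IP P := fun p => TotalSpace.mk' EP p 0
  have s₁ : ContMDiff IP IP.tangent ∞ f₁ := contMDiff_zeroSection _ _
  let f₂ : P → TangentBundle IG G := fun _ => TotalSpace.mk' EG 1 ξ
  have s₂ : ContMDiff IP IG.tangent ∞ f₂ := contMDiff_const
  have S₂ : ContMDiff (IP.tangent.prod IG.tangent) (IP.prod IG).tangent ∞
      (equivTangentBundleProd IP P IG G).symm := contMDiff_equivTangentBundleProd_symm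
  have S₃ : ContMDiff (IP.prod IG).tangent IP.tangent ∞
      (tangentMap (IP.prod IG) IP fun q : P × G => B.act q.1 q.2) :=
    B.contMDiff_act.contMDiff_tangentMap (by simp)
  have S := (S₃.comp S₂).comp (s₁.prodMk s₂)
  convert! S with p
  · simp [f₁, f₂, B.act_one]
  · simp only [Function.comp_apply, tangentMap, f₁, f₂]
    rw [mfderiv_prod_eq_add_apply (B.contMDiff_act.mdifferentiable (by simp) _)]
    refine Eq.symm ((congrArg₂ (fun s t : EP => s + t) (map_zero
      (mfderiv IP IP (fun z => B.act z (1 : G)) p)) rfl).trans (zero_add (fund B p ξ : EP)))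

end Fundamental

/-! ### Consequences of local triviality -/

section LocalTriviality

variable
  {EP : Type*} [NormedAddCommGroup EP] [NormedSpace ℝ EP]
  {HP : Type*} [TopologicalSpace HP] {IP : ModelWithCorners ℝ EP HP}
  {EM : Type*} [NormedAddCommGroup EM] [NormedSpace ℝ EM]
  {HM : Type*} [TopologicalSpace HM] {IM : ModelWithCorners ℝ EM HM}
  {EG : Type*} [NormedAddCommGroup EG] [NormedSpace ℝ EG]
  {HG : Type*} [TopologicalSpace HG] {IG : ModelWithCorners ℝ EG HG}
  {P : Type*} [TopologicalSpace P] [ChartedSpace HP P]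
  {M : Type*} [TopologicalSpace M] [ChartedSpace HM M]
  {G : Type*} [TopologicalSpace G] [ChartedSpace HG G] [Group G] [LieGroup IG ∞ G]
  (B : PrincipalBundle IP IM IG P M G)

omit [Group G] [LieGroup IG ∞ G] in
lemma tangentBundle_mk_congr {a b : P} (h : a = b) {v w : EP} (hv : v = w) :
    (⟨a, v⟩ : TangentBundle IP P) = ⟨b, w⟩ := by
  subst h hv
  rfl

/-- The action is infinitesimally free. -/
lemma fund_injective (p : P) : Function.Injective (fund B p : GroupLieAlgebra IG G → _) := by
  obtain ⟨e, hx, he, -, heq⟩ := B.locally_trivial (B.proj p)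
  have hp : p ∈ e.source := e.mem_source.2 hx
  have hd : MDifferentiableAt IP IG (fun q => (e p).2⁻¹ * (e q).2) p :=
    (mdifferentiableAt_mul_left (IG := IG) (e p).2⁻¹ _).comp p
      (mdifferentiableAt_snd.comp p
        ((he.contMDiffAt (e.open_source.mem_nhds hp)).mdifferentiableAt (by simp)))
  intro ξ η h
  have key : ∀ ζ : GroupLieAlgebra IG G,
      (mfderiv IP IG (fun q => (e p).2⁻¹ * (e q).2) p (fund B p ζ) : EG) = ζ := by
    intro ζ
    have h := mfderiv_comp_apply_of_eq (I := IG) (I' := IP) (I'' := IG)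
      (g := fun q => (e p).2⁻¹ * (e q).2)
      (f := fun g => B.act p g) (y := p) 1 hd (mdifferentiableAt_orbit B p 1) (B.act_one p) ζ
    have e : (fun q => (e p).2⁻¹ * (e q).2) ∘ (fun g => B.act p g) = id := by
      ext g
      simp [heq p hp g]
    rw [e, mfderiv_id] at h
    exact h.symm
  exact (key ξ).symm.trans ((congrArg (fun v : TangentSpace IP p =>
    (mfderiv IP IG (fun q => (e p).2⁻¹ * (e q).2) p v : EG)) h).trans (key η))

/-- The kernel of the differential of the projection consists of the vertical vectors. -/
lemma exists_fund_of_mfderiv_proj_eq_zero {p : P} {v : TangentSpace IP p}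
    (hv : mfderiv IP IM B.proj p v = 0) : ∃ ξ : GroupLieAlgebra IG G, v = fund B p ξ := by
  obtain ⟨e, hx, he, he', heq⟩ := B.locally_trivial (B.proj p)
  have hp : p ∈ e.source := e.mem_source.2 hx
  have hep : e p = (B.proj p, (e p).2) := Prod.ext (e.coe_fst hp) rfl
  have ht : e p ∈ e.target := e.map_source hp
  set σ := e.toOpenPartialHomeomorph.symm with hσ
  have hde : MDifferentiableAt IP (IM.prod IG) e p :=
    (he.contMDiffAt (e.open_source.mem_nhds hp)).mdifferentiableAt (by simp)
  have hds : MDifferentiableAt (IM.prod IG) IP σ (e p) :=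
    (he'.contMDiffAt (e.open_target.mem_nhds ht)).mdifferentiableAt (by simp)
  have h1 := mfderiv_comp_apply p hds hde v
  have hid : σ ∘ e =ᶠ[𝓝 p] id := by
    filter_upwards [e.open_source.mem_nhds hp] with q hq
    exact e.left_inv hq
  rw [hid.mfderiv_eq, mfderiv_id] at h1
  have hd1 : (mfderiv IP (IM.prod IG) e p v).1 = (0 : EM) := by
    have h2 := mfderiv_comp_apply p (mdifferentiableAt_fst (I := IM) (I' := IG)) hde v
    have h3 : Prod.fst ∘ e =ᶠ[𝓝 p] B.proj := by
      filter_upwards [e.open_source.mem_nhds hp] with q hq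
      exact e.coe_fst hq
    rw [h3.mfderiv_eq, mfderiv_fst] at h2
    exact h2.symm.trans hv
  set k : EG := (mfderiv IP (IM.prod IG) e p v).2 with hk
  have hsa : ∀ g, σ ((e p).1, g) = B.act p ((e p).2⁻¹ * g) := by
    intro g
    have : B.act p ((e p).2⁻¹ * g) ∈ e.source := by
      rw [e.mem_source, B.proj_act]
      exact hx
    have h2 := e.left_inv this
    have h3 : e (B.act p ((e p).2⁻¹ * g)) = ((e p).1, g) := by simp [heq p hp]
    exact (congrArg σ h3.symm).trans h2
  refine ⟨(mfderiv IG IG (fun g => (e p).2⁻¹ * g) (e p).2 k : EG), ?_⟩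
  have h4 := mfderiv_comp_apply_of_eq (I := IG) (I' := IM.prod IG) (I'' := IP) (g := σ)
    (f := fun g => ((e p).1, g)) (y := e p) (e p).2 hds
    (mdifferentiableAt_const.prodMk mdifferentiableAt_id) rfl k
  have h5 := mfderiv_comp_apply_of_eq (I := IG) (I' := IG) (I'' := IP) (g := fun g => B.act p g)
    (f := fun g => (e p).2⁻¹ * g) (y := 1) (e p).2 (mdifferentiableAt_orbit B p 1)
    (mdifferentiableAt_mul_left _ _) (by simp) k
  have h6 : σ ∘ (fun g => ((e p).1, g)) = (fun g => B.act p g) ∘ (fun g => (e p).2⁻¹ * g) :=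
    funext hsa
  rw [h6] at h4
  have h7 : (mfderiv IP (IM.prod IG) e p v : EM × EG) =
      mfderiv IG (IM.prod IG) (fun g => ((e p).1, g)) (e p).2 k := by
    rw [mfderiv_prod_right]
    exact Prod.ext hd1 rfl
  refine h1.trans (Eq.trans ?_ (h4.symm.trans h5))
  exact congrArg (fun t : EM × EG => (mfderiv (IM.prod IG) IP σ (e p) t : EP)) h7

variable [IsManifold IP ∞ P] [IsManifold IM ∞ M]

/-- A vector field on the base lifts, near each point, to a vector field that is smooth if the
original one is. -/
lemma exists_local_lift (p : P) (Y : Π x : M, TangentSpace IM x) :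
    ∃ Z : Π q : P, TangentSpace IP q,
      (ContMDiff IM IM.tangent ∞ (fun x => (⟨x, Y x⟩ : TangentBundle IM M)) →
        ContMDiffAt IP IP.tangent ∞ (fun q => (⟨q, Z q⟩ : TangentBundle IP P)) p) ∧
      ∀ᶠ q in 𝓝 p, mfderiv IP IM B.proj q (Z q) = Y (B.proj q) := by
  obtain ⟨e, hx, he, he', heq⟩ := B.locally_trivial (B.proj p)
  have hp : p ∈ e.source := e.mem_source.2 hx
  set σ := e.toOpenPartialHomeomorph.symm with hσ
  let Z : Π q : P, TangentSpace IP q := fun q =>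
    (mfderivWithin (IM.prod IG) IP σ e.target (B.proj q, (e q).2)
      ((Y (B.proj q) : EM), (0 : EG)) : EP)
  have hep : ∀ q ∈ e.source, e q = (B.proj q, (e q).2) := fun q hq => Prod.ext (e.coe_fst hq) rfl
  have hσe : ∀ q ∈ e.source, σ (B.proj q, (e q).2) = q := fun q hq =>
    (congrArg σ (hep q hq).symm).trans (e.left_inv hq)
  refine ⟨Z, fun hY => ?_, ?_⟩
  · have S₁ : ContMDiffAt IP IM.tangent ∞
        (fun q => (⟨B.proj q, Y (B.proj q)⟩ : TangentBundle IM M)) p :=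
      (hY.comp B.contMDiff_proj).contMDiffAt
    have S₂ : ContMDiffAt IP IG.tangent ∞ (fun q => (⟨(e q).2, 0⟩ : TangentBundle IG G)) p := by
      have h0 : ContMDiff IG IG.tangent ∞ (fun g => (⟨g, 0⟩ : TangentBundle IG G)) :=
        contMDiff_zeroSection _ _
      exact h0.contMDiffAt.comp p
        (contMDiffAt_snd.comp p (he.contMDiffAt (e.open_source.mem_nhds hp)))
    have S₃ : ContMDiff (IM.tangent.prod IG.tangent) (IM.prod IG).tangent ∞
        (equivTangentBundleProd IM M IG G).symm := contMDiff_equivTangentBundleProd_symm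
    have S₄ : ContMDiffOn (IM.prod IG).tangent IP.tangent ∞
        (tangentMapWithin (IM.prod IG) IP σ e.target) (π (EM × EG) _ ⁻¹' e.target) :=
      he'.contMDiffOn_tangentMapWithin (by simp) e.open_target.uniqueMDiffOn
    have hmem : ∀ᶠ q in 𝓝 p, q ∈ e.source := e.open_source.mem_nhds hp
    have hopen : IsOpen (π (EM × EG) (TangentSpace (IM.prod IG) : M × G → Type _) ⁻¹' e.target) :=
      e.open_target.preimage (FiberBundle.continuous_proj _ _)
    have S := ContMDiffAt.comp p (S₄.contMDiffAt (hopen.mem_nhds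
      (x := (equivTangentBundleProd IM M IG G).symm
        ((⟨B.proj p, Y (B.proj p)⟩ : TangentBundle IM M), (⟨(e p).2, 0⟩ : TangentBundle IG G)))
      (by
        have hmem : (B.proj p, (e p).2) ∈ e.target := hep p hp ▸ e.map_source hp
        exact hmem)))
      (S₃.contMDiffAt.comp p (S₁.prodMk S₂))
    refine S.congr_of_eventuallyEq ?_
    filter_upwards [hmem] with q hq
    exact tangentBundle_mk_congr (hσe q hq).symm rfl
  · filter_upwards [e.open_source.mem_nhds hp] with q hq
    have ht : (B.proj q, (e q).2) ∈ e.target := hep q hq ▸ e.map_source hq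
    have hds : MDifferentiableAt (IM.prod IG) IP σ (B.proj q, (e q).2) :=
      (he'.contMDiffAt (e.open_target.mem_nhds ht)).mdifferentiableAt (by simp)
    have h1 := mfderiv_comp_apply_of_eq (g := B.proj) (y := q) _ (mdifferentiableAt_proj B q) hds
      (hσe q hq) ((Y (B.proj q) : EM), (0 : EG))
    have h2 : B.proj ∘ σ =ᶠ[𝓝 (B.proj q, (e q).2)] Prod.fst := by
      filter_upwards [e.open_target.mem_nhds ht] with z hz
      exact e.proj_symm_apply hz
    rw [h2.mfderiv_eq, mfderiv_fst] at h1
    refine Eq.trans ?_ h1.symm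
    exact congrArg (fun L : EM × EG →L[ℝ] EP =>
      (mfderiv IP IM B.proj q (L ((Y (B.proj q) : EM), (0 : EG))) : EM))
      (mfderivWithin_of_isOpen e.open_target ht)

end LocalTriviality

/-! ### The connection form of an invariant metric -/

section ConnectionForm

variable
  {EP : Type*} [NormedAddCommGroup EP] [NormedSpace ℝ EP]
  {HP : Type*} [TopologicalSpace HP] {IP : ModelWithCorners ℝ EP HP}
  {EM : Type*} [NormedAddCommGroup EM] [NormedSpace ℝ EM]
  {HM : Type*} [TopologicalSpace HM] {IM : ModelWithCorners ℝ EM HM}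
  {EG : Type*} [NormedAddCommGroup EG] [NormedSpace ℝ EG] [FiniteDimensional ℝ EG]
  {HG : Type*} [TopologicalSpace HG] {IG : ModelWithCorners ℝ EG HG}
  {P : Type*} [TopologicalSpace P] [ChartedSpace HP P] [IsManifold IP ∞ P]
  {M : Type*} [TopologicalSpace M] [ChartedSpace HM M]
  {G : Type*} [TopologicalSpace G] [ChartedSpace HG G] [Group G] [LieGroup IG ∞ G]
  (B : PrincipalBundle IP IM IG P M G) (γ : Metric IP P)

/-- The inner product `β_p` as a bilinear form. -/
def fiberForm (p : P) : GroupLieAlgebra IG G →ₗ[ℝ] GroupLieAlgebra IG G →ₗ[ℝ] ℝ :=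
  LinearMap.mk₂ ℝ (fiberMetric B γ p)
    (fun ξ ξ' η => by simp [fiberMetric, fund_add])
    (fun c ξ η => by simp [fiberMetric, fund_smul])
    (fun ξ η η' => by simp [fiberMetric, fund_add])
    (fun c ξ η => by simp [fiberMetric, fund_smul])

lemma fiberForm_symm (p : P) (ξ η : GroupLieAlgebra IG G) :
    fiberForm B γ p ξ η = fiberForm B γ p η ξ := γ.symm p _ _

lemma fiberForm_injective (p : P) : Function.Injective (fiberForm B γ p) := by
  refine (injective_iff_map_eq_zero _).2 fun ξ h => ?_
  by_contra hξ
  have h0 : fund B p ξ ≠ 0 := fun h' => hξ (fund_injective B p (h'.trans (fund_zero B p).symm))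
  exact (γ.pos p _ h0).ne' (LinearMap.congr_fun h ξ)

lemma fiberForm_ext {p : P} {ξ ξ' : GroupLieAlgebra IG G}
    (h : ∀ η, fiberForm B γ p ξ η = fiberForm B γ p ξ' η) : ξ = ξ' :=
  fiberForm_injective B γ p (LinearMap.ext h)

/-- Linear forms on the Lie algebra are represented by `β_p`. -/
lemma exists_fiberForm_eq (p : P) (c : GroupLieAlgebra IG G →ₗ[ℝ] ℝ) :
    ∃ ξ, ∀ η, fiberForm B γ p ξ η = c η := by
  have := (LinearMap.injective_iff_surjective_of_finrank_eq_finrank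
    (f := fiberForm B γ p) Subspace.dual_finrank_eq.symm).1 (fiberForm_injective B γ p) c
  obtain ⟨ξ, rfl⟩ := this
  exact ⟨ξ, fun _ => rfl⟩

lemma contMDiff_fiberForm (ξ η : GroupLieAlgebra IG G) :
    ContMDiff IP 𝓘(ℝ, ℝ) ∞ (fun p => fiberForm B γ p ξ η) := fun _ =>
  contMDiffAt_metric γ (b := fun p => p) (contMDiff_fund B ξ).contMDiffAt
    (contMDiff_fund B η).contMDiffAt

lemma inner_sub_fund_connForm (p : P) (v : TangentSpace IP p) (η : GroupLieAlgebra IG G) :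
    γ.inner p (v - fund B p (connForm B γ p v)) (fund B p η) = 0 := by
  have h : ∃ ξ : GroupLieAlgebra IG G, ∀ η, γ.inner p (v - fund B p ξ) (fund B p η) = 0 := by
    obtain ⟨ξ, hξ⟩ := exists_fiberForm_eq B γ p ((γ.inner p v).toLinearMap ∘ₗ fundL B p)
    refine ⟨ξ, fun η => ?_⟩
    rw [map_sub, sub_apply, sub_eq_zero]
    exact (hξ η).symm
  exact Classical.epsilon_spec h η

/-- The defining property of the connection form. -/
lemma fiberForm_connForm (p : P) (v : TangentSpace IP p) (η : GroupLieAlgebra IG G) :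
    fiberForm B γ p (connForm B γ p v) η = γ.inner p v (fund B p η) := by
  have := inner_sub_fund_connForm B γ p v η
  rw [map_sub, sub_apply, sub_eq_zero] at this
  exact this.symm

lemma connForm_fund (p : P) (ξ : GroupLieAlgebra IG G) : connForm B γ p (fund B p ξ) = ξ :=
  fiberForm_ext B γ fun η => fiberForm_connForm B γ p _ η

/-- The connection form as a linear map. -/
def connFormL (p : P) : TangentSpace IP p →ₗ[ℝ] GroupLieAlgebra IG G where
  toFun := connForm B γ p
  map_add' v w := fiberForm_ext B γ (p := p) fun η => by simp [fiberForm_connForm]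
  map_smul' c v := fiberForm_ext B γ (p := p) fun η => by simp [fiberForm_connForm]

/-- The vertical projection as a linear map. -/
def vertL (p : P) : TangentSpace IP p →ₗ[ℝ] TangentSpace IP p := fundL B p ∘ₗ connFormL B γ p

lemma vertL_apply (p : P) (v : TangentSpace IP p) : vertL B γ p v = vert B γ p v := rfl

lemma vert_add (p : P) (v w : TangentSpace IP p) :
    vert B γ p (v + w) = vert B γ p v + vert B γ p w := (vertL B γ p).map_add v w

lemma vert_sub (p : P) (v w : TangentSpace IP p) :
    vert B γ p (v - w) = vert B γ p v - vert B γ p w := (vertL B γ p).map_sub v w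

lemma vert_fund (p : P) (ξ : GroupLieAlgebra IG G) : vert B γ p (fund B p ξ) = fund B p ξ := by
  rw [vert, connForm_fund]

lemma connForm_vert (p : P) (v : TangentSpace IP p) :
    connForm B γ p (vert B γ p v) = connForm B γ p v := connForm_fund B γ p _

lemma vert_vert (p : P) (v : TangentSpace IP p) : vert B γ p (vert B γ p v) = vert B γ p v :=
  vert_fund B γ p _

lemma vert_horiz (p : P) (v : TangentSpace IP p) : vert B γ p (horiz B γ p v) = 0 := by
  rw [horiz, vert_sub, vert_vert, sub_self]

lemma horiz_of_vert_eq_zero {p : P} {v : TangentSpace IP p} (h : vert B γ p v = 0) :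
    horiz B γ p v = v := by
  rw [horiz, h, sub_zero]

lemma vert_add_horiz (p : P) (v : TangentSpace IP p) :
    vert B γ p v + horiz B γ p v = v := add_sub_cancel _ _

variable {B γ} in
lemma connForm_eq_zero_iff {p : P} {v : TangentSpace IP p} :
    connForm B γ p v = 0 ↔ vert B γ p v = 0 := by
  refine ⟨fun h => by rw [vert, h, fund_zero], fun h => ?_⟩
  exact fund_injective B p (h.trans (fund_zero B p).symm)

variable {B γ} in
/-- Horizontal vectors are the vectors that are orthogonal to the vertical ones. -/
lemma vert_eq_zero_iff {p : P} {v : TangentSpace IP p} :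
    vert B γ p v = 0 ↔ ∀ η : GroupLieAlgebra IG G, γ.inner p v (fund B p η) = 0 := by
  rw [← connForm_eq_zero_iff]
  refine ⟨fun h η => ?_, fun h => fiberForm_ext B γ (p := p) fun η => ?_⟩
  · rw [← fiberForm_connForm B γ, h, map_zero, LinearMap.zero_apply]
  · rw [fiberForm_connForm, h, map_zero, LinearMap.zero_apply]

lemma lieGroup_minSmoothness : LieGroup IG (minSmoothness ℝ 3) G :=
  LieGroup.of_le (n := ∞) (by simp; norm_cast)

/-- The defining property of `ad^*`. -/
lemma fiberForm_adStar (p : P) (ζ ξ χ : GroupLieAlgebra IG G) :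
    fiberForm B γ p (adStar B γ p ζ ξ) χ = fiberForm B γ p ξ ⁅ζ, χ⁆ := by
  have : LieGroup IG (minSmoothness ℝ 3) G := lieGroup_minSmoothness
  have : CompleteSpace EG := FiniteDimensional.complete ℝ EG
  have h : ∃ η : GroupLieAlgebra IG G, ∀ χ : GroupLieAlgebra IG G,
      fiberMetric B γ p η χ = fiberMetric B γ p ξ ⁅ζ, χ⁆ := by
    obtain ⟨η, hη⟩ := exists_fiberForm_eq B γ p (fiberForm B γ p ξ ∘ₗ
      (LieAlgebra.ad ℝ (GroupLieAlgebra IG G) ζ))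
    exact ⟨η, hη⟩
  exact Classical.epsilon_spec h χ

variable {EN : Type*} [NormedAddCommGroup EN] [NormedSpace ℝ EN]
  {HN : Type*} [TopologicalSpace HN] {IN : ModelWithCorners ℝ EN HN}
  {N : Type*} [TopologicalSpace N] [ChartedSpace HN N]

/-- The connection form is smooth. -/
lemma contMDiffAt_connForm {b : N → P} {X : Π y, TangentSpace IP (b y)} {x : N}
    (hX : ContMDiffAt IN IP.tangent ∞ (fun y => (⟨b y, X y⟩ : TangentBundle IP P)) x) :
    ContMDiffAt IN 𝓘(ℝ, EG) (M' := EG) ∞ (fun y => connForm B γ (b y) (X y)) x := by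
  have hb : ContMDiffAt IN IP ∞ b x := (contMDiffAt_totalSpace.1 hX).1
  refine contMDiffAt_of_nondegenerate (F := EG) (A := fun y => fiberForm B γ (b y))
    (fun ξ η => ?_) (fun y => fiberForm_injective B γ (b y)) (fun η => ?_)
  · exact (contMDiff_fiberForm B γ ξ η).contMDiffAt.comp x hb
  · have h := contMDiffAt_metric γ hX ((contMDiff_fund B η).contMDiffAt.comp x hb)
    exact h.congr_of_eventuallyEq (Filter.Eventually.of_forall fun y =>
      fiberForm_connForm B γ (b y) (X y) η)

lemma mdifferentiableAt_connForm {b : N → P} {X : Π y, TangentSpace IP (b y)} {x : N}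
    (hX : MDifferentiableAt IN IP.tangent (fun y => (⟨b y, X y⟩ : TangentBundle IP P)) x) :
    MDifferentiableAt IN 𝓘(ℝ, EG) (M' := EG) (fun y => connForm B γ (b y) (X y)) x := by
  have h : ContMDiffAt IP.tangent 𝓘(ℝ, EG) (M' := EG) ∞
      (fun v : TangentBundle IP P => connForm B γ v.proj v.2) ⟨b x, X x⟩ :=
    contMDiffAt_connForm B γ contMDiffAt_id
  exact MDifferentiableAt.comp (I' := IP.tangent) (M'' := EG)
    (g := fun v : TangentBundle IP P => connForm B γ v.proj v.2)
    (f := fun y => (⟨b y, X y⟩ : TangentBundle IP P)) x (h.mdifferentiableAt (by simp)) hX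

/-- The vertical field of a Lie algebra valued function is as smooth as the function. -/
lemma contMDiffAt_fund {n : WithTop ℕ∞} (hn : n ≤ ∞) {ν : P → GroupLieAlgebra IG G} {p : P}
    (hν : ContMDiffAt IP 𝓘(ℝ, EG) (M' := EG) n ν p) :
    ContMDiffAt IP IP.tangent n (fun q => (⟨q, fund B q (ν q)⟩ : TangentBundle IP P)) p := by
  let b := Module.finBasis ℝ EG
  have e : ∀ q, fund B q (ν q) = ∑ i, b.coord i (ν q) • fund B q (b i : EG) := by
    intro q
    have h := map_sum (fundL B q) (fun i => (b.repr (ν q) i • b i : EG)) Finset.univ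
    have h2 : (∑ i, b.repr (ν q) i • b i : EG) = ν q := b.sum_repr (ν q)
    refine (congrArg (fund B q) h2).symm.trans (h.trans (Finset.sum_congr rfl fun i _ => ?_))
    exact (fundL B q).map_smul (b.repr (ν q) i) (b i : EG)
  simp only [e]
  refine ContMDiffAt.sum_section fun i _ => ?_
  refine ContMDiffAt.smul_section ?_ ((contMDiff_fund B _).contMDiffAt.of_le hn)
  exact (LinearMap.toContinuousLinearMap (b.coord i)).contMDiff.contMDiffAt.comp p hν

end ConnectionForm

/-! ### Metric differentiation along a map -/

section AlongMaps

variable {E : Type*} [NormedAddCommGroup E] [NormedSpace ℝ E]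
  {H : Type*} [TopologicalSpace H] {I : ModelWithCorners ℝ E H}
  {M : Type*} [TopologicalSpace M] [ChartedSpace H M] [IsManifold I ∞ M]
  {E' : Type*} [NormedAddCommGroup E'] [NormedSpace ℝ E']
  {H' : Type*} [TopologicalSpace H'] {I' : ModelWithCorners ℝ E' H'}
  {N : Type*} [TopologicalSpace N] [ChartedSpace H' N]

lemma components_along_eventuallyEq {f : N → M} {x : N} {p : M} (hp : f x = p)
    (hf : ContinuousAt f x) : ∀ᶠ y in 𝓝 x, f y ∈ (chartAt H p).source := by
  subst hp
  exact hf ((chartAt H (f x)).open_source.mem_nhds (mem_chart_source H (f x)))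

lemma mdifferentiableAt_components_along {f : N → M} {S : Π y, TangentSpace I (f y)} {x : N} {p : M}
    (hp : f x = p)
    (hS : MDifferentiableAt I' I.tangent (fun y => (⟨f y, S y⟩ : TangentBundle I M)) x) :
    MDifferentiableAt I' 𝓘(ℝ, E) (fun y => (components p (S y) : E)) x := by
  subst hp
  have h := (mdifferentiableAt_totalSpace I
    (fun y => (⟨f y, S y⟩ : TangentBundle I M))).1 hS
  refine h.2.congr_of_eventuallyEq ?_
  filter_upwards [components_along_eventuallyEq (H := H) rfl h.1.continuousAt] with y hy
  rw [components, Trivialization.continuousLinearMapAt_apply,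
    Trivialization.coe_linearMapAt_of_mem _ hy]

variable [FiniteDimensional ℝ E] [IsManifold I' ∞ N] [I'.Boundaryless]

/-- The derivative of the inner product of two fields along a map. -/
lemma mvfderiv_metric_along (γ : Metric I M) {f : N → M} {S S' : Π y, TangentSpace I (f y)} {x : N}
    (hS : MDifferentiableAt I' I.tangent (fun y => (⟨f y, S y⟩ : TangentBundle I M)) x)
    (hS' : MDifferentiableAt I' I.tangent (fun y => (⟨f y, S' y⟩ : TangentBundle I M)) x)
    (u : TangentSpace I' x) :
    mvfderiv I' (fun y => γ.inner (f y) (S y) (S' y)) x u =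
      γ.inner (f x) (pullbackCov E (fun X q w => leviCivita γ X q w) f S x u) (S' x) +
      γ.inner (f x) (S x) (pullbackCov E (fun X q w => leviCivita γ X q w) f S' x u) := by
  set t := trivializationAt E (TangentSpace I : M → Type _) (f x) with ht
  have hf : MDifferentiableAt I' I f x :=
    ((mdifferentiableAt_totalSpace I (fun y => (⟨f y, S y⟩ : TangentBundle I M))).1 hS).1
  have hc := mdifferentiableAt_components_along rfl hS
  have hc' := mdifferentiableAt_components_along rfl hS'
  let Γ : N → E →ₗ[ℝ] E →ₗ[ℝ] ℝ := fun y =>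
    LinearMap.mk₂ ℝ (fun e e' => γ.inner (f y) (t.symmL ℝ (f y) e) (t.symmL ℝ (f y) e'))
      (by simp) (by simp) (by simp) (by simp)
  have hΓ : ∀ v w : TangentSpace I (f x), ∀ y, Γ y (components (f x) v) (components (f x) w) =
    γ.inner (f y) (constExt E v (f y)) (constExt E w (f y)) := fun v w y => rfl
  have hmd : ∀ e e', MDifferentiableAt I' 𝓘(ℝ, ℝ) (fun y => Γ y e e') x := by
    intro e e'
    have h := (mdifferentiableAt_metric_constExt γ (t.symmL ℝ (f x) e)
      (t.symmL ℝ (f x) e')).comp x hf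
    refine h.congr_of_eventuallyEq (Filter.Eventually.of_forall fun y => ?_)
    have := hΓ (t.symmL ℝ (f x) e) (t.symmL ℝ (f x) e') y
    rw [components_symmL, components_symmL] at this
    exact this
  have e0 : (fun y => γ.inner (f y) (S y) (S' y)) =ᶠ[𝓝 x]
      fun y => (Γ y).flip (components (f x) (S' y)) (components (f x) (S y)) := by
    filter_upwards [components_along_eventuallyEq (H := H) rfl hf.continuousAt] with y hy
    have h1 := t.symmL_continuousLinearMapAt (R := ℝ) hy (S y)
    have h2 := t.symmL_continuousLinearMapAt (R := ℝ) hy (S' y)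
    conv_lhs => rw [← h1, ← h2]
    rfl
  have hmd1 : ∀ e, MDifferentiableAt I' 𝓘(ℝ, ℝ) (fun y => Γ y e (components (f x) (S' y))) x :=
    fun e => (mdifferentiableAt_toContinuousLinearMap (hmd e)).clm_apply hc'
  rw [mvfderiv_congr e0, mvfderiv_linear_apply (L := fun y => (Γ y).flip (components (f x) (S' y)))
    hmd1 hc]
  simp only [LinearMap.flip_apply]
  rw [mvfderiv_linear_apply (L := fun y => Γ y (components (f x) (S x))) (hmd _) hc']
  have e1 : mvfderiv I' (fun y => Γ y (components (f x) (S x)) (components (f x) (S' x))) x u =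
      _ := (mvfderiv_comp_map x (mdifferentiableAt_metric_constExt γ (S x) (S' x)) hf u).trans
    (leviCivita_metric γ (mdifferentiableAt_constExt E (S x))
      (mdifferentiableAt_constExt E (S' x)) _)
  have e2 : ∀ v : TangentSpace I (f x), ∀ e : E, Γ x e (components (f x) v) =
      γ.inner (f x) (t.symmL ℝ (f x) e) v := fun v e =>
    congrArg (γ.inner (f x) (t.symmL ℝ (f x) e)) (constExt_self E v)
  have e3 : ∀ v : TangentSpace I (f x), ∀ e : E, Γ x (components (f x) v) e =
      γ.inner (f x) v (t.symmL ℝ (f x) e) := fun v e =>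
    congrArg (fun w => γ.inner (f x) w (t.symmL ℝ (f x) e)) (constExt_self E v)
  rw [e1, e2, e3, constExt_self, constExt_self, pullbackCov, pullbackCov, map_add, map_add,
    add_apply]
  ring

lemma christoffel_symm (γ : Metric I M) (p : M) (v w : TangentSpace I p) :
    christoffel γ p v w = christoffel γ p w v := by
  apply (flat γ p).injective
  ext u
  rw [flat_apply, flat_apply, christoffel_apply, christoffel_apply, metricDeriv_symm γ p w v u]
  ring

lemma mvfderiv_metric_along_of_eq (γ : Metric I M) {f : N → M} {S S' : Π y, TangentSpace I (f y)}
    {x : N} {p : M} (hp : f x = p)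
    (hS : MDifferentiableAt I' I.tangent (fun y => (⟨f y, S y⟩ : TangentBundle I M)) x)
    (hS' : MDifferentiableAt I' I.tangent (fun y => (⟨f y, S' y⟩ : TangentBundle I M)) x)
    (u : TangentSpace I' x) {v w w' : TangentSpace I p} (hv : (mfderiv I' I f x u : E) = v)
    (hw : (S x : E) = w) (hw' : (S' x : E) = w') :
    mvfderiv I' (fun y => γ.inner (f y) (S y) (S' y)) x u =
      γ.inner p ((trivializationAt E (TangentSpace I) p).symmL ℝ p
        (mvfderiv I' (fun y => (components p (S y) : E)) x u) + christoffel γ p w v) w' +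
      γ.inner p w ((trivializationAt E (TangentSpace I) p).symmL ℝ p
        (mvfderiv I' (fun y => (components p (S' y) : E)) x u) + christoffel γ p w' v) := by
  subst hp hv hw hw'
  rw [mvfderiv_metric_along γ hS hS']
  simp only [pullbackCov, leviCivita_constExt]

end AlongMaps

/-! ### Fundamental fields are Killing fields, and their brackets -/

section Killing

variable
  {EP : Type*} [NormedAddCommGroup EP] [NormedSpace ℝ EP] [FiniteDimensional ℝ EP]
  {HP : Type*} [TopologicalSpace HP] {IP : ModelWithCorners ℝ EP HP} [IP.Boundaryless]
  {EM : Type*} [NormedAddCommGroup EM] [NormedSpace ℝ EM]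
  {HM : Type*} [TopologicalSpace HM] {IM : ModelWithCorners ℝ EM HM}
  {EG : Type*} [NormedAddCommGroup EG] [NormedSpace ℝ EG] [FiniteDimensional ℝ EG]
  {HG : Type*} [TopologicalSpace HG] {IG : ModelWithCorners ℝ EG HG} [IG.Boundaryless]
  {P : Type*} [TopologicalSpace P] [ChartedSpace HP P] [IsManifold IP ∞ P]
  {M : Type*} [TopologicalSpace M] [ChartedSpace HM M]
  {G : Type*} [TopologicalSpace G] [ChartedSpace HG G] [Group G] [LieGroup IG ∞ G]
  (B : PrincipalBundle IP IM IG P M G) (γ : Metric IP P)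

lemma mulInvariantVectorField_one (ξ : GroupLieAlgebra IG G) :
    mulInvariantVectorField ξ (1 : G) = ξ := by
  have h : (fun g : G => 1 * g) = id := funext one_mul
  have h2 : mfderiv IG IG (fun g : G => 1 * g) 1 = mfderiv IG IG id 1 := by rw [h]
  rw [mfderiv_id] at h2
  exact DFunLike.congr_fun h2 ξ

lemma mdifferentiableAt_fund (ξ : GroupLieAlgebra IG G) (p : P) :
    MDiffAt (T% fun q => fund B q ξ) p :=
  (contMDiff_fund B ξ).mdifferentiable (by simp) p

lemma mfderiv_act_one (p : P) (u : TangentSpace IP p) : (translate B 1 p u : EP) = u := by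
  have h : (fun q => B.act q 1) = id := funext B.act_one
  have h2 := mfderiv_id (I := IP) (x := p)
  rw [← h] at h2
  exact DFunLike.congr_fun h2 u

lemma contMDiffAt_extChartAt_act (p : P) :
    ContMDiffAt (IP.prod IG) 𝓘(ℝ, EP) 2 (fun z : P × G => extChartAt IP p (B.act z.1 z.2))
      (p, 1) := by
  have h : ContMDiffAt IP 𝓘(ℝ, EP) ∞ (extChartAt IP p) (B.act p 1) := by
    rw [B.act_one]
    exact contMDiffAt_extChartAt
  exact (h.comp (f := fun z : P × G => B.act z.1 z.2) (p, 1) B.contMDiff_act.contMDiffAt).of_le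
    (by norm_cast)

lemma components_fund (p : P) {q : P} (hq : q ∈ (chartAt HP p).source)
    (ξ : GroupLieAlgebra IG G) : (components p (fund B q ξ) : EP) =
      mvfderiv IG (fun a => extChartAt IP p (B.act q a)) 1 ξ := by
  rw [mvfderiv_comp_map_of_eq (I := IP) (B.act_one q) (mdifferentiableAt_extChartAt hq)
    (mdifferentiableAt_orbit B q 1), components_eq_mfderiv hq]
  rfl

/-- The fundamental vector fields of a right action form a representation of the Lie algebra. -/
lemma mlieBracket_fund (ξ η : GroupLieAlgebra IG G) (p : P) :
    mlieBracket IP (fun q => fund B q ξ) (fun q => fund B q η) p = fund B p ⁅ξ, η⁆ := by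
  have : LieGroup IG (minSmoothness ℝ 3) G := lieGroup_minSmoothness
  have hIG : IsManifold IG ∞ G := inferInstance
  have hp := mem_chart_source HP p
  have hG : ContMDiffAt IG 𝓘(ℝ, EP) 2 (fun a : G => extChartAt IP p (B.act p a)) 1 := by
    have := contMDiffAt_extChartAt_act B p
    exact this.comp (f := fun a : G => (p, a)) 1
      (contMDiffAt_const.prodMk contMDiffAt_id)
  have hbr : mvfderiv IG (fun a : G => extChartAt IP p (B.act p a)) 1
      (⁅ξ, η⁆ : GroupLieAlgebra IG G) = _ := mvfderiv_mlieBracket hG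
    (mdifferentiableAt_mulInvariantVectorField ξ) (mdifferentiableAt_mulInvariantVectorField η)
  have key : ∀ ξ η : GroupLieAlgebra IG G,
      mvfderiv IG (fun a => mvfderiv IG (fun a : G => extChartAt IP p (B.act p a)) a
        (mulInvariantVectorField η a)) 1 (mulInvariantVectorField ξ (1 : G)) =
      mvfderiv IP (fun q => (components p (fund B q η) : EP)) p (fund B p ξ) := by
    intro ξ η
    have hnear : ∀ᶠ a in 𝓝 (1 : G), B.act p a ∈ (chartAt HP p).source :=
      components_along_eventuallyEq (B.act_one p) (contMDiff_orbit B p).continuous.continuousAt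
    have e : (fun a => mvfderiv IG (fun a : G => extChartAt IP p (B.act p a)) a
        (mulInvariantVectorField η a)) =ᶠ[𝓝 1]
        fun a => (components p (fund B (B.act p a) η) : EP) := by
      filter_upwards [hnear] with a ha
      rw [mvfderiv_comp_map (I := IP) a (mdifferentiableAt_extChartAt ha)
        (mdifferentiableAt_orbit B p a), mfderiv_orbit_mulInvariantVectorField,
        components_eq_mfderiv ha]
      rfl
    rw [mvfderiv_congr e, mulInvariantVectorField_one,
      mvfderiv_comp_map_of_eq (I := IP) (g := fun q => (components p (fund B q η) : EP))
        (B.act_one p) ((mdifferentiableAt_components EP).1 (mdifferentiableAt_fund B η p))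
        (mdifferentiableAt_orbit B p 1)]
    rfl
  rw [key, key, ← components_fund B p hp] at hbr
  rw [mlieBracket_eq_coordCov (mdifferentiableAt_fund B ξ p) (mdifferentiableAt_fund B η p)]
  rw [← components_coordCov, ← components_coordCov] at hbr
  have h1 := constExt_self EP (fund B p ⁅ξ, η⁆)
  rw [← h1, constExt]
  have h2 : (components p (fund B p ⁅ξ, η⁆) : EP) = components p
      (coordCov IP P (fun q => fund B q η) p (fund B p ξ) -
        coordCov IP P (fun q => fund B q ξ) p (fund B p η)) := by
    rw [hbr, components, components, components, map_sub]
  rw [components] at h2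
  rw [h2]
  exact (constExt_self EP _).symm

/-- The torsion of the Levi-Civita connection vanishes on fundamental fields. -/
lemma leviCivita_fund_sub (ξ η : GroupLieAlgebra IG G) (p : P) :
    leviCivita γ (fun q => fund B q η) p (fund B p ξ) -
      leviCivita γ (fun q => fund B q ξ) p (fund B p η) = fund B p ⁅ξ, η⁆ := by
  have h := CovariantDerivative.torsion_apply (leviCivita γ) (mdifferentiableAt_fund B ξ p)
    (mdifferentiableAt_fund B η p)
  rw [leviCivita_torsion, mlieBracket_fund] at h
  exact sub_eq_zero.1 h.symm

/-- The derivative of the differential of the action. -/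
lemma mvfderiv_components_translate (ξ : GroupLieAlgebra IG G) (p : P) (u : TangentSpace IP p) :
    mvfderiv IG (fun a : G => (components p (translate B a p u) : EP)) 1 ξ =
      mvfderiv IP (fun q => (components p (fund B q ξ) : EP)) p u := by
  have hIG : IsManifold IG ∞ G := inferInstance
  have hnear : ∀ᶠ a in 𝓝 (1 : G), B.act p a ∈ (chartAt HP p).source :=
    components_along_eventuallyEq (B.act_one p) (contMDiff_orbit B p).continuous.continuousAt
  have e1 : (fun a : G => (components p (translate B a p u) : EP)) =ᶠ[𝓝 1]
      fun a => mvfderiv IP (fun q => extChartAt IP p (B.act q a)) p u := by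
    filter_upwards [hnear] with a ha
    rw [mvfderiv_comp_map (I := IP) p (mdifferentiableAt_extChartAt ha)
      (mdifferentiableAt_act_right B a p), components_eq_mfderiv ha]
    rfl
  have e2 : (fun q => (components p (fund B q ξ) : EP)) =ᶠ[𝓝 p]
      fun q => mvfderiv IG (fun a => extChartAt IP p (B.act q a)) 1 ξ := by
    filter_upwards [(chartAt HP p).open_source.mem_nhds (mem_chart_source HP p)] with q hq
    exact components_fund B p hq ξ
  rw [mvfderiv_congr e1, mvfderiv_congr e2]
  exact (mvfderiv_partial_comm (contMDiffAt_extChartAt_act B p) u ξ).symm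

lemma mdifferentiableAt_translate (p : P) (u : TangentSpace IP p) (a : G) :
    MDifferentiableAt IG IP.tangent
      (fun a => (⟨B.act p a, translate B a p u⟩ : TangentBundle IP P)) a := by
  let f₁ : G → TangentBundle IP P := fun _ => TotalSpace.mk' EP p u
  have s₁ : ContMDiff IG IP.tangent ∞ f₁ := contMDiff_const
  let f₂ : G → TangentBundle IG G := fun a => TotalSpace.mk' EG a 0
  have s₂ : ContMDiff IG IG.tangent ∞ f₂ := contMDiff_zeroSection _ _
  have S₂ : ContMDiff (IP.tangent.prod IG.tangent) (IP.prod IG).tangent ∞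
      (equivTangentBundleProd IP P IG G).symm := contMDiff_equivTangentBundleProd_symm
  have S₃ : ContMDiff (IP.prod IG).tangent IP.tangent ∞
      (tangentMap (IP.prod IG) IP fun q : P × G => B.act q.1 q.2) :=
    B.contMDiff_act.contMDiff_tangentMap (by simp)
  have S := (S₃.comp S₂).comp (s₁.prodMk s₂)
  refine ContMDiffAt.mdifferentiableAt (n := ∞) ?_ (by simp)
  refine ContMDiff.contMDiffAt ?_
  convert! S with a
  simp only [Function.comp_apply, tangentMap, f₁, f₂]
  rw [mfderiv_prod_eq_add_apply (B.contMDiff_act.mdifferentiable (by simp) _)]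
  refine Eq.symm ((congrArg₂ (fun s t : EP => s + t) rfl (map_zero
    (mfderiv IG IP (fun z => B.act p z) a))).trans (add_zero (translate B a p u : EP)))

/-- Fundamental vector fields of an isometric action are Killing fields. -/
lemma killing_fund {γ : Metric IP P} (hγ : IsKaluzaKlein B γ) (ξ : GroupLieAlgebra IG G) (p : P)
    (u w : TangentSpace IP p) :
    γ.inner p (leviCivita γ (fun q => fund B q ξ) p u) w +
      γ.inner p u (leviCivita γ (fun q => fund B q ξ) p w) = 0 := by
  have hIG : IsManifold IG ∞ G := inferInstance
  have h := mvfderiv_metric_along_of_eq γ (B.act_one p) (mdifferentiableAt_translate B p u 1)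
    (mdifferentiableAt_translate B p w 1) ξ (v := fund B p ξ) rfl (mfderiv_act_one B p u)
    (mfderiv_act_one B p w)
  have e : (fun a => γ.inner (B.act p a) (translate B a p u) (translate B a p w)) =
      fun _ => γ.inner p u w := funext fun a => hγ a p u w
  rw [e, mvfderiv_const, mvfderiv_components_translate, mvfderiv_components_translate,
    christoffel_symm, christoffel_symm γ p w] at h
  rw [leviCivita_apply, leviCivita_apply]
  exact h.symm

end Killing

/-! ### The vertical derivatives of fundamental fields -/

section Vertical

variable
  {EP : Type*} [NormedAddCommGroup EP] [NormedSpace ℝ EP] [FiniteDimensional ℝ EP]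
  {HP : Type*} [TopologicalSpace HP] {IP : ModelWithCorners ℝ EP HP} [IP.Boundaryless]
  {EM : Type*} [NormedAddCommGroup EM] [NormedSpace ℝ EM]
  {HM : Type*} [TopologicalSpace HM] {IM : ModelWithCorners ℝ EM HM}
  {EG : Type*} [NormedAddCommGroup EG] [NormedSpace ℝ EG] [FiniteDimensional ℝ EG]
  {HG : Type*} [TopologicalSpace HG] {IG : ModelWithCorners ℝ EG HG} [IG.Boundaryless]
  {P : Type*} [TopologicalSpace P] [ChartedSpace HP P] [IsManifold IP ∞ P]
  {M : Type*} [TopologicalSpace M] [ChartedSpace HM M]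
  {G : Type*} [TopologicalSpace G] [ChartedSpace HG G] [Group G] [LieGroup IG ∞ G]
  (B : PrincipalBundle IP IM IG P M G) (γ : Metric IP P)
  {EN : Type*} [NormedAddCommGroup EN] [NormedSpace ℝ EN]
  {HN : Type*} [TopologicalSpace HN] {IN : ModelWithCorners ℝ EN HN}
  {N : Type*} [TopologicalSpace N] [ChartedSpace HN N]

lemma contMDiffAt_fund_along {b : N → P} {ν : N → GroupLieAlgebra IG G} {x : N}
    (hb : ContMDiffAt IN IP ∞ b x) (hν : ContMDiffAt IN 𝓘(ℝ, EG) (M' := EG) ∞ ν x) :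
    ContMDiffAt IN IP.tangent ∞ (fun y => (⟨b y, fund B (b y) (ν y)⟩ : TangentBundle IP P)) x := by
  rw [contMDiffAt_totalSpace]
  refine ⟨hb, ?_⟩
  let t := trivializationAt EP (TangentSpace IP : P → Type _) (b x)
  let L : N → EG →ₗ[ℝ] EP := fun y =>
    (t.continuousLinearMapAt ℝ (b y)).toLinearMap ∘ₗ fundL B (b y)
  have hmem : ∀ᶠ y in 𝓝 x, b y ∈ (chartAt HP (b x)).source :=
    components_along_eventuallyEq rfl hb.continuousAt
  have htr : ∀ ν : N → GroupLieAlgebra IG G, (fun y => L y (ν y)) =ᶠ[𝓝 x]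
      fun y => (t ⟨b y, fund B (b y) (ν y)⟩).2 := by
    intro ν
    filter_upwards [hmem] with y hy
    exact congrFun (Trivialization.coe_linearMapAt_of_mem (R := ℝ) t hy) _
  have hL : ∀ e, ContMDiffAt IN 𝓘(ℝ, EP) ∞ (fun y => L y e) x := by
    intro e
    have h := (contMDiff_fund B (e : GroupLieAlgebra IG G)).contMDiffAt.comp x hb
    rw [contMDiffAt_totalSpace] at h
    exact h.2.congr_of_eventuallyEq (htr fun _ => e)
  exact (contMDiffAt_linear_apply hL hν).congr_of_eventuallyEq (htr ν).symm

lemma contMDiff_vert :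
    ContMDiff IP.tangent IP.tangent ∞
      (fun v : TangentBundle IP P => (⟨v.1, vert B γ v.1 v.2⟩ : TangentBundle IP P)) := fun _ =>
  contMDiffAt_fund_along B (contMDiff_proj _).contMDiffAt
    (contMDiffAt_connForm B γ (b := fun v : TangentBundle IP P => v.1) contMDiffAt_id)

lemma contMDiffAt_vert {b : N → P} {S : Π y, TangentSpace IP (b y)} {x : N}
    (hS : ContMDiffAt IN IP.tangent ∞ (fun y => (⟨b y, S y⟩ : TangentBundle IP P)) x) :
    ContMDiffAt IN IP.tangent ∞ (fun y => (⟨b y, vert B γ (b y) (S y)⟩ : TangentBundle IP P)) x :=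
  (contMDiff_vert B γ).contMDiffAt.comp x hS

lemma mdifferentiableAt_vert {b : N → P} {S : Π y, TangentSpace IP (b y)} {x : N}
    (hS : MDifferentiableAt IN IP.tangent (fun y => (⟨b y, S y⟩ : TangentBundle IP P)) x) :
    MDifferentiableAt IN IP.tangent
      (fun y => (⟨b y, vert B γ (b y) (S y)⟩ : TangentBundle IP P)) x :=
  ((contMDiff_vert B γ).mdifferentiable (by simp) _).comp x hS

lemma contMDiffAt_horiz {D : Π q, TangentSpace IP q} {p : P}
    (hD : ContMDiffAt IP IP.tangent ∞ (fun q => (⟨q, D q⟩ : TangentBundle IP P)) p) :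
    ContMDiffAt IP IP.tangent ∞ (fun q => (⟨q, horiz B γ q (D q)⟩ : TangentBundle IP P)) p :=
  ContMDiffAt.sub_section hD (contMDiffAt_vert B γ (b := fun q => q) hD)

lemma mdifferentiableAt_horiz {D : Π q, TangentSpace IP q} {p : P} (hD : MDiffAt (T% D) p) :
    MDiffAt (T% fun q => horiz B γ q (D q)) p :=
  mdifferentiableAt_sub_section hD (mdifferentiableAt_vert B γ (b := fun q => q) hD)

lemma mvfderiv_clm_comp {F F' : Type*} [NormedAddCommGroup F] [NormedSpace ℝ F]
    [NormedAddCommGroup F'] [NormedSpace ℝ F'] (L : F →L[ℝ] F') {f : N → F} {x : N}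
    (hf : MDifferentiableAt IN 𝓘(ℝ, F) f x) (u : TangentSpace IN x) :
    mvfderiv IN (fun y => L (f y)) x u = L (mvfderiv IN f x u) := by
  have h := mvfderiv_comp_map (I := 𝓘(ℝ, F)) x L.mdifferentiableAt hf u
  refine h.trans ((mvfderiv_eq_fderiv_model L (f x) _).trans ?_)
  rw [L.fderiv]
  rfl

lemma exists_mvfderiv_bilin {F : Type*} [AddCommGroup F] [Module ℝ F]
    {A : N → F →ₗ[ℝ] F →ₗ[ℝ] ℝ} {x : N}
    (hA : ∀ e e', MDifferentiableAt IN 𝓘(ℝ, ℝ) (fun y => A y e e') x) (u : TangentSpace IN x) :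
    ∃ D : F →ₗ[ℝ] F →ₗ[ℝ] ℝ, ∀ e e', D e e' = mvfderiv IN (fun y => A y e e') x u := by
  have hc : ∀ (c : ℝ) e e', mvfderiv IN (fun y => c * A y e e') x u =
      c * mvfderiv IN (fun y => A y e e') x u := fun c e e' =>
    mvfderiv_clm_comp (c • ContinuousLinearMap.id ℝ ℝ) (hA e e') u
  refine ⟨LinearMap.mk₂ ℝ (fun e e' => mvfderiv IN (fun y => A y e e') x u)
    (fun e f e' => ?_) (fun c e e' => ?_) (fun e e' f => ?_) (fun c e e' => ?_), fun e e' => rfl⟩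
  · simp only [map_add, LinearMap.add_apply]
    exact DFunLike.congr_fun (mvfderiv_add (hA e e') (hA f e')) u
  · simp only [map_smul, LinearMap.smul_apply, smul_eq_mul, hc]
  · simp only [map_add]
    exact DFunLike.congr_fun (mvfderiv_add (hA e e') (hA e f)) u
  · simp only [map_smul, smul_eq_mul, hc]

lemma exists_fiberDeriv (p : P) (u : TangentSpace IP p) :
    ∃ D : GroupLieAlgebra IG G →ₗ[ℝ] GroupLieAlgebra IG G →ₗ[ℝ] ℝ,
      ∀ ξ ζ, D ξ ζ = mvfderiv IP (fun q => fiberForm B γ q ξ ζ) p u :=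
  exists_mvfderiv_bilin (fun ξ ζ => (contMDiff_fiberForm B γ ξ ζ).mdifferentiable (by simp) p) u

/-- The derivative of the fibre metric. -/
def fiberDeriv (p : P) (u : TangentSpace IP p) :
    GroupLieAlgebra IG G →ₗ[ℝ] GroupLieAlgebra IG G →ₗ[ℝ] ℝ := (exists_fiberDeriv B γ p u).choose

lemma fiberDeriv_apply (p : P) (u : TangentSpace IP p) (ξ ζ : GroupLieAlgebra IG G) :
    fiberDeriv B γ p u ξ ζ = mvfderiv IP (fun q => fiberForm B γ q ξ ζ) p u :=
  (exists_fiberDeriv B γ p u).choose_spec ξ ζ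

lemma exists_shape (p : P) (ξ : GroupLieAlgebra IG G) (u : TangentSpace IP p) :
    ∃ η, ∀ ζ, fiberForm B γ p η ζ = 1 / 2 * fiberDeriv B γ p u ξ ζ := by
  obtain ⟨η, hη⟩ := exists_fiberForm_eq B γ p ((1 / 2 : ℝ) • fiberDeriv B γ p u ξ)
  exact ⟨η, hη⟩

/-- Half of the derivative of the fibre metric, as a family of endomorphisms of the Lie algebra. -/
def shape (p : P) (ξ : GroupLieAlgebra IG G) (u : TangentSpace IP p) : GroupLieAlgebra IG G :=
  (exists_shape B γ p ξ u).choose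

lemma fiberForm_shape (p : P) (ξ ζ : GroupLieAlgebra IG G) (u : TangentSpace IP p) :
    fiberForm B γ p (shape B γ p ξ u) ζ = 1 / 2 * fiberDeriv B γ p u ξ ζ :=
  (exists_shape B γ p ξ u).choose_spec ζ

/-- `shape` as a bilinear map. -/
def shapeL (p : P) :
    TangentSpace IP p →ₗ[ℝ] GroupLieAlgebra IG G →ₗ[ℝ] GroupLieAlgebra IG G :=
  LinearMap.mk₂ ℝ (fun u ξ => shape B γ p ξ u)
    (fun u u' ξ => fiberForm_ext B γ (p := p) fun ζ => by
      simp only [map_add, LinearMap.add_apply, fiberForm_shape, fiberDeriv_apply]; ring)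
    (fun c u ξ => fiberForm_ext B γ (p := p) fun ζ => by
      simp only [map_smul, LinearMap.smul_apply, fiberForm_shape, fiberDeriv_apply, smul_eq_mul]
      ring)
    (fun u ξ ξ' => fiberForm_ext B γ (p := p) fun ζ => by
      simp only [map_add, LinearMap.add_apply, fiberForm_shape]; ring)
    (fun c u ξ => fiberForm_ext B γ (p := p) fun ζ => by
      simp only [map_smul, LinearMap.smul_apply, fiberForm_shape, smul_eq_mul]; ring)

lemma shapeL_apply (p : P) (ξ : GroupLieAlgebra IG G) (u : TangentSpace IP p) :
    shapeL B γ p u ξ = shape B γ p ξ u := rfl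

variable {B γ} in
lemma vert_eq_fund {p : P} {v : TangentSpace IP p} {ξ : GroupLieAlgebra IG G}
    (h : ∀ ζ, γ.inner p v (fund B p ζ) = fiberForm B γ p ξ ζ) : vert B γ p v = fund B p ξ :=
  congrArg (fund B p) (fiberForm_ext B γ (p := p) fun ζ =>
    (fiberForm_connForm B γ p v ζ).trans (h ζ))

variable {γ}
variable (hγ : IsKaluzaKlein B γ)
include hγ

lemma inner_leviCivita_fund_comm (p : P) (ξ ζ : GroupLieAlgebra IG G) (u : TangentSpace IP p)
    (hu : vert B γ p u = 0) :
    γ.inner p (leviCivita γ (fun q => fund B q ξ) p u) (fund B p ζ) =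
      γ.inner p (leviCivita γ (fun q => fund B q ζ) p u) (fund B p ξ) := by
  have h1 := killing_fund B hγ ξ p u (fund B p ζ)
  have h2 := killing_fund B hγ ζ p u (fund B p ξ)
  have h3 := congrArg (γ.inner p u) (leviCivita_fund_sub B γ ξ ζ p)
  rw [vert_eq_zero_iff.1 hu, map_sub] at h3
  linarith

/-- The vertical part of the horizontal derivative of a fundamental field. -/
lemma vert_leviCivita_fund_of_horizontal (p : P) (ξ : GroupLieAlgebra IG G) (u : TangentSpace IP p)
    (hu : vert B γ p u = 0) :
    vert B γ p (leviCivita γ (fun q => fund B q ξ) p u) = fund B p (shape B γ p ξ u) := by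
  refine vert_eq_fund fun ζ => ?_
  have h1 := leviCivita_metric γ (mdifferentiableAt_fund B ξ p) (mdifferentiableAt_fund B ζ p) u
  have h2 := inner_leviCivita_fund_comm B hγ p ξ ζ u hu
  rw [γ.symm p (fund B p ξ), ← h2] at h1
  rw [fiberForm_shape, fiberDeriv_apply, show (fun q => fiberForm B γ q ξ ζ) =
    fun q => γ.inner q (fund B q ξ) (fund B q ζ) from rfl, h1]
  ring

omit hγ in
/-- The vertical part of the derivative of a horizontal field. -/
lemma inner_leviCivita_horizontal {D : Π q : P, TangentSpace IP q} {p : P}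
    (hD : MDiffAt (T% D) p) (hh : ∀ q, vert B γ q (D q) = 0) (w : TangentSpace IP p)
    (ζ : GroupLieAlgebra IG G) :
    γ.inner p (leviCivita γ D p w) (fund B p ζ) =
      -γ.inner p (D p) (leviCivita γ (fun q => fund B q ζ) p w) := by
  have h1 := leviCivita_metric γ hD (mdifferentiableAt_fund B ζ p) w
  rw [show (fun q => γ.inner q (D q) (fund B q ζ)) = fun _ => (0 : ℝ) from
    funext fun q => vert_eq_zero_iff.1 (hh q) ζ, mvfderiv_const] at h1
  have h2 : (0 : ℝ) = _ := h1
  linarith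

lemma vert_leviCivita_horizontal {D : Π q : P, TangentSpace IP q} {p : P}
    (hD : MDiffAt (T% D) p) (hh : ∀ q, vert B γ q (D q) = 0) (ξ : GroupLieAlgebra IG G) :
    vert B γ p (leviCivita γ D p (fund B p ξ)) = fund B p (shape B γ p ξ (D p)) := by
  rw [← vert_leviCivita_fund_of_horizontal B hγ p ξ (D p) (hh p)]
  refine vert_eq_fund fun ζ => ?_
  rw [fiberForm_connForm, inner_leviCivita_horizontal B hD hh,
    inner_leviCivita_fund_comm B hγ p ξ ζ (D p) (hh p)]
  have := killing_fund B hγ ζ p (D p) (fund B p ξ)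
  linarith

/-- The vertical part of the vertical derivative of a fundamental field. -/
lemma vert_leviCivita_fund_fund (p : P) (ξ η : GroupLieAlgebra IG G) :
    vert B γ p (leviCivita γ (fun q => fund B q ξ) p (fund B p η)) =
      fund B p ((1 / 2 : ℝ) • (adStar B γ p ξ η + adStar B γ p η ξ + ⁅η, ξ⁆)) := by
  refine vert_eq_fund fun ζ => ?_
  have A : ∀ η ξ ζ : GroupLieAlgebra IG G,
      γ.inner p (leviCivita γ (fun q => fund B q ξ) p (fund B p η)) (fund B p ζ) +
      γ.inner p (leviCivita γ (fun q => fund B q ξ) p (fund B p ζ)) (fund B p η) = 0 := by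
    intro η ξ ζ
    rw [γ.symm p _ (fund B p η)]
    exact killing_fund B hγ ξ p _ _
  have C : ∀ ξ η ζ : GroupLieAlgebra IG G,
      γ.inner p (leviCivita γ (fun q => fund B q η) p (fund B p ξ)) (fund B p ζ) -
      γ.inner p (leviCivita γ (fun q => fund B q ξ) p (fund B p η)) (fund B p ζ) =
      fiberForm B γ p ζ ⁅ξ, η⁆ := by
    intro ξ η ζ
    have h := congrArg (γ.inner p (fund B p ζ)) (leviCivita_fund_sub B γ ξ η p)
    rw [map_sub, γ.symm p (fund B p ζ), γ.symm p (fund B p ζ)] at h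
    exact h
  simp only [map_smul, map_add, LinearMap.smul_apply, LinearMap.add_apply, smul_eq_mul,
    fiberForm_adStar, fiberForm_symm B γ p ⁅η, ξ⁆ ζ]
  linarith [A η ξ ζ, A ξ η ζ, A ξ ζ η, C η ξ ζ, C η ζ ξ, C ξ ζ η]

end Vertical

/-! ### Closed forms of the tensors `Θ` and `T` -/

section Tensors

variable
  {EP : Type*} [NormedAddCommGroup EP] [NormedSpace ℝ EP] [FiniteDimensional ℝ EP]
  {HP : Type*} [TopologicalSpace HP] {IP : ModelWithCorners ℝ EP HP} [IP.Boundaryless]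
  {EM : Type*} [NormedAddCommGroup EM] [NormedSpace ℝ EM]
  {HM : Type*} [TopologicalSpace HM] {IM : ModelWithCorners ℝ EM HM}
  {EG : Type*} [NormedAddCommGroup EG] [NormedSpace ℝ EG] [FiniteDimensional ℝ EG]
  {HG : Type*} [TopologicalSpace HG] {IG : ModelWithCorners ℝ EG HG} [IG.Boundaryless]
  {P : Type*} [TopologicalSpace P] [ChartedSpace HP P] [IsManifold IP ∞ P]
  {M : Type*} [TopologicalSpace M] [ChartedSpace HM M]
  {G : Type*} [TopologicalSpace G] [ChartedSpace HG G] [Group G] [LieGroup IG ∞ G]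
  (B : PrincipalBundle IP IM IG P M G) (γ : Metric IP P)

/-- The derivative of a Lie algebra valued function. -/
def lieDeriv {EN : Type*} [NormedAddCommGroup EN] [NormedSpace ℝ EN]
    {HN : Type*} [TopologicalSpace HN] {IN : ModelWithCorners ℝ EN HN}
    {N : Type*} [TopologicalSpace N] [ChartedSpace HN N] (ν : N → GroupLieAlgebra IG G) (x : N)
    (u : TangentSpace IN x) : GroupLieAlgebra IG G :=
  (mvfderiv IN (F := EG) ν x u : EG)

/-- The derivative of the vertical field of a Lie algebra valued function. -/
lemma leviCivita_fund_function {ν : P → GroupLieAlgebra IG G} {p : P}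
    (hν : MDifferentiableAt IP 𝓘(ℝ, EG) (M' := EG) ν p) (u : TangentSpace IP p) :
    leviCivita γ (fun q => fund B q (ν q)) p u =
      fund B p (lieDeriv ν p u) +
        leviCivita γ (fun q => fund B q (ν p)) p u := by
  let t := trivializationAt EP (TangentSpace IP : P → Type _) p
  let L : P → EG →ₗ[ℝ] EP := fun q => (t.continuousLinearMapAt ℝ q).toLinearMap ∘ₗ fundL B q
  have hL : ∀ e, MDifferentiableAt IP 𝓘(ℝ, EP) (fun q => L q e) p := fun e =>
    (mdifferentiableAt_components EP).1 (mdifferentiableAt_fund B (e : GroupLieAlgebra IG G) p)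
  have h := mvfderiv_linear_apply (L := L) hL hν u
  have h' : mvfderiv IP (fun q => (components p (fund B q (ν q)) : EP)) p u =
      mvfderiv IP (fun q => (components p (fund B q (ν p)) : EP)) p u +
        components p (fund B p (lieDeriv ν p u)) := h
  rw [leviCivita_apply, leviCivita_apply, h', map_add,
    show t.symmL ℝ p (components p (fund B p (lieDeriv ν p u))) = _ from
      constExt_self EP (fund B p (lieDeriv ν p u))]
  abel

lemma leviCivita_zero_section {σ : Π q : P, TangentSpace IP q} (hσ : ∀ q, σ q = 0) (p : P)
    (u : TangentSpace IP p) : leviCivita γ σ p u = 0 := by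
  have h := congrArg (fun f => (f : EP →L[ℝ] EP) u)
    ((leviCivita γ).isCovariantDerivativeOnUniv.zero (x := p))
  have h0 : σ = 0 := funext hσ
  rw [h0]
  exact h

lemma nablaOmega_vert {D : Π q : P, TangentSpace IP q} (p : P) (u : TangentSpace IP p) :
    nablaOmega B γ (fun q => vert B γ q (D q)) p u =
      fund B p (lieDeriv (fun q => connForm B γ q (D q)) p u) +
        fund B p ((1 / 2 : ℝ) • ⁅connForm B γ p u, connForm B γ p (D p)⁆) := by
  rw [← fund_add]
  simp only [nablaOmega, connForm_vert]
  rfl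

lemma thetaField_eq {D₁ D₂ : Π q : P, TangentSpace IP q} {p : P} (hD : MDiffAt (T% D₂) p) :
    thetaField B γ D₁ D₂ p =
      vert B γ p (leviCivita γ (fun q => fund B q (connForm B γ p (D₂ p))) p (D₁ p)) -
        fund B p ((1 / 2 : ℝ) • ⁅connForm B γ p (D₁ p), connForm B γ p (D₂ p)⁆) := by
  have h := leviCivita_fund_function B γ (mdifferentiableAt_connForm B γ (b := fun q => q) hD)
    (D₁ p)
  have h' : leviCivita γ (fun q => vert B γ q (D₂ q)) p (D₁ p) = _ := h
  rw [thetaField, nablaOmega_vert, nablaPV, h', vert_add, vert_fund]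
  abel

variable {γ}
variable (hγ : IsKaluzaKlein B γ)
include hγ

lemma oneillField_eq {D₁ D₂ : Π q : P, TangentSpace IP q} {p : P} (hD : MDiffAt (T% D₂) p) :
    oneillField B γ D₁ D₂ p =
      fund B p (shape B γ p (connForm B γ p (D₁ p)) (horiz B γ p (D₂ p))) +
        horiz B γ p (leviCivita γ (fun q => fund B q (connForm B γ p (D₂ p))) p
          (vert B γ p (D₁ p))) := by
  have h := leviCivita_fund_function B γ (mdifferentiableAt_connForm B γ (b := fun q => q) hD)
    (vert B γ p (D₁ p))
  have h' : leviCivita γ (fun q => vert B γ q (D₂ q)) p (vert B γ p (D₁ p)) = _ := h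
  have h2 := vert_leviCivita_horizontal B hγ (mdifferentiableAt_horiz B γ hD)
    (fun q => vert_horiz B γ q (D₂ q)) (connForm B γ p (D₁ p))
  rw [oneillField, h', horiz, vert_add, vert_fund, add_sub_add_left_eq_sub]
  exact congrArg (· + _) h2

omit hγ in
theorem thetaField_eq_theta {D₁ D₂ : Π q : P, TangentSpace IP q} {p : P}
    (hD : MDiffAt (T% D₂) p) :
    thetaField B γ D₁ D₂ p = theta B γ p (D₁ p) (D₂ p) := by
  rw [theta, thetaField_eq B γ hD, thetaField_eq B γ (mdifferentiableAt_constExt EP (D₂ p)),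
    constExt_self, constExt_self]

theorem oneillField_eq_oneill {D₁ D₂ : Π q : P, TangentSpace IP q} {p : P}
    (hD : MDiffAt (T% D₂) p) :
    oneillField B γ D₁ D₂ p = oneill B γ p (D₁ p) (D₂ p) := by
  rw [oneill, oneillField_eq B hγ hD, oneillField_eq B hγ (mdifferentiableAt_constExt EP (D₂ p)),
    constExt_self, constExt_self]

lemma oneill_eq (p : P) (u v : TangentSpace IP p) :
    oneill B γ p u v = fund B p (shape B γ p (connForm B γ p u) (horiz B γ p v)) +
        horiz B γ p (leviCivita γ (fun q => fund B q (connForm B γ p v)) p (vert B γ p u)) := by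
  rw [oneill, oneillField_eq B hγ (mdifferentiableAt_constExt EP v), constExt_self, constExt_self]

lemma oneill_fund_of_horizontal (p : P) (ξ : GroupLieAlgebra IG G) {v : TangentSpace IP p}
    (hv : vert B γ p v = 0) : oneill B γ p (fund B p ξ) v = fund B p (shape B γ p ξ v) := by
  rw [oneill_eq B hγ, connForm_fund, horiz_of_vert_eq_zero B γ hv, connForm_eq_zero_iff.2 hv,
    leviCivita_zero_section γ (fun q => fund_zero B q), horiz, sub_eq_self.2, add_zero]
  exact (vertL B γ p).map_zero

/-- The vertical part of the derivative of a fundamental field. -/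
lemma vert_leviCivita_fund (p : P) (ξ : GroupLieAlgebra IG G) (u : TangentSpace IP p) :
    vert B γ p (leviCivita γ (fun q => fund B q ξ) p u) =
      fund B p ((1 / 2 : ℝ) • (adStar B γ p ξ (connForm B γ p u) +
        adStar B γ p (connForm B γ p u) ξ + ⁅connForm B γ p u, ξ⁆)) +
      fund B p (shape B γ p ξ (horiz B γ p u)) := by
  conv_lhs => rw [← vert_add_horiz B γ p u, map_add, vert_add]
  rw [vert_leviCivita_fund_of_horizontal B hγ p ξ _ (vert_horiz B γ p u)]
  exact congrArg (· + _) (vert_leviCivita_fund_fund B hγ p ξ (connForm B γ p u))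

theorem thetaField_fund {D : Π q : P, TangentSpace IP q} {ξ : P → GroupLieAlgebra IG G}
    {p : P} (hD : MDiffAt (T% D) p)
    (hξ : MDiffAt (T% fun q => fund B q (ξ q)) p) :
    thetaField B γ D (fun q => fund B q (ξ q)) p =
      fund B p ((1 / 2 : ℝ) • (adStar B γ p (ξ p) (connForm B γ p (D p)) +
        adStar B γ p (connForm B γ p (D p)) (ξ p))) +
      oneillField B γ (fun q => fund B q (ξ q)) (fun q => horiz B γ q (D q)) p := by
  rw [thetaField_eq B γ hξ, oneillField_eq_oneill B hγ (mdifferentiableAt_horiz B γ hD),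
    oneill_fund_of_horizontal B hγ _ _ (vert_horiz B γ p _), connForm_fund,
    vert_leviCivita_fund B hγ, smul_add _ _ (⁅connForm B γ p (D p), ξ p⁆), fund_add]
  abel

end Tensors

/-! ### Horizontal lifts and equivariance -/

section Lifts

variable
  {EP : Type*} [NormedAddCommGroup EP] [NormedSpace ℝ EP] [FiniteDimensional ℝ EP]
  {HP : Type*} [TopologicalSpace HP] {IP : ModelWithCorners ℝ EP HP} [IP.Boundaryless]
  {EM : Type*} [NormedAddCommGroup EM] [NormedSpace ℝ EM]
  {HM : Type*} [TopologicalSpace HM] {IM : ModelWithCorners ℝ EM HM}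
  {EG : Type*} [NormedAddCommGroup EG] [NormedSpace ℝ EG] [FiniteDimensional ℝ EG]
  {HG : Type*} [TopologicalSpace HG] {IG : ModelWithCorners ℝ EG HG} [IG.Boundaryless]
  {P : Type*} [TopologicalSpace P] [ChartedSpace HP P] [IsManifold IP ∞ P]
  {M : Type*} [TopologicalSpace M] [ChartedSpace HM M] [IsManifold IM ∞ M]
  {G : Type*} [TopologicalSpace G] [ChartedSpace HG G] [Group G] [LieGroup IG ∞ G]
  (B : PrincipalBundle IP IM IG P M G) (γ : Metric IP P)

lemma mfderiv_proj_horiz (p : P) (v : TangentSpace IP p) :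
    mfderiv IP IM B.proj p (horiz B γ p v) = mfderiv IP IM B.proj p v := by
  rw [horiz, map_sub, vert, mfderiv_proj_fund, sub_zero]

lemma exists_horizontal (p : P) (w : TangentSpace IM (B.proj p)) :
    ∃ v ∈ {v : TangentSpace IP p | vert B γ p v = 0}, mfderiv IP IM B.proj p v = w := by
  obtain ⟨Z, -, hZ⟩ := exists_local_lift B p fun x => (w : EM)
  exact ⟨horiz B γ p (Z p), vert_horiz B γ p _, (mfderiv_proj_horiz B γ p _).trans hZ.self_of_nhds⟩

lemma vert_hlift (p : P) (w : TangentSpace IM (B.proj p)) : vert B γ p (hlift B γ p w) = 0 :=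
  Function.invFunOn_mem (exists_horizontal B γ p w)

lemma mfderiv_proj_hlift (p : P) (w : TangentSpace IM (B.proj p)) :
    mfderiv IP IM B.proj p (hlift B γ p w) = w :=
  Function.invFunOn_eq (exists_horizontal B γ p w)

variable {B γ} in
lemma eq_of_horizontal {p : P} {u v : TangentSpace IP p} (hu : vert B γ p u = 0)
    (hv : vert B γ p v = 0) (h : mfderiv IP IM B.proj p u = mfderiv IP IM B.proj p v) : u = v := by
  have h0 : mfderiv IP IM B.proj p (u - v) = 0 := by rw [map_sub, h, sub_self]
  obtain ⟨ξ, hξ⟩ := exists_fund_of_mfderiv_proj_eq_zero B h0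
  have h1 : vert B γ p (u - v) = 0 := by rw [vert_sub, hu, hv, sub_self]
  rw [hξ, vert_fund, ← hξ] at h1
  exact sub_eq_zero.1 h1

/-- The horizontal lift as a linear map. -/
def hliftL (p : P) : TangentSpace IM (B.proj p) →ₗ[ℝ] TangentSpace IP p where
  toFun := hlift B γ p
  map_add' w w' := by
    refine eq_of_horizontal (B := B) (γ := γ) (vert_hlift B γ p _) ?_ ?_
    · rw [vert_add, vert_hlift, vert_hlift, add_zero]
    · rw [map_add, mfderiv_proj_hlift, mfderiv_proj_hlift, mfderiv_proj_hlift]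
  map_smul' c w := by
    refine eq_of_horizontal (B := B) (γ := γ) (vert_hlift B γ p _) ?_ ?_
    · rw [RingHom.id_apply, ← vertL_apply, map_smul, vertL_apply, vert_hlift, smul_zero]
    · rw [RingHom.id_apply, map_smul, mfderiv_proj_hlift, mfderiv_proj_hlift]

/-- The horizontal lift of a smooth vector field is smooth. -/
lemma contMDiffAt_hlift {Y : Π x : M, TangentSpace IM x} (hY : IsSmoothField IM Y) (p : P) :
    ContMDiffAt IP IP.tangent ∞
      (fun q => (⟨q, hlift B γ q (Y (B.proj q))⟩ : TangentBundle IP P)) p := by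
  obtain ⟨Z, hZ, hπ⟩ := exists_local_lift B p Y
  refine (contMDiffAt_horiz B γ (hZ hY)).congr_of_eventuallyEq ?_
  filter_upwards [hπ] with q hq
  congr 1
  refine eq_of_horizontal (B := B) (γ := γ) (vert_hlift B γ q _) (vert_horiz B γ q _) ?_
  rw [mfderiv_proj_hlift, mfderiv_proj_horiz, hq]

/-- The derivative of a Lie algebra valued function as a linear map. -/
def lieDerivL (ν : P → GroupLieAlgebra IG G) (p : P) :
    TangentSpace IP p →ₗ[ℝ] GroupLieAlgebra IG G where
  toFun := lieDeriv ν p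
  map_add' u v := map_add (mvfderiv IP (F := EG) ν p) u v
  map_smul' c u := map_smul (mvfderiv IP (F := EG) ν p) c u

lemma lieDeriv_add {ν ν' : P → GroupLieAlgebra IG G} {p : P}
    (hν : MDifferentiableAt IP 𝓘(ℝ, EG) (M' := EG) ν p)
    (hν' : MDifferentiableAt IP 𝓘(ℝ, EG) (M' := EG) ν' p) (u : TangentSpace IP p) :
    lieDeriv (fun q => ν q + ν' q) p u = lieDeriv ν p u + lieDeriv ν' p u :=
  DFunLike.congr_fun (mvfderiv_add hν hν') u

lemma lieDeriv_smul {f : P → ℝ} {ν : P → GroupLieAlgebra IG G} {p : P}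
    (hf : MDifferentiableAt IP 𝓘(ℝ, ℝ) f p)
    (hν : MDifferentiableAt IP 𝓘(ℝ, EG) (M' := EG) ν p) (u : TangentSpace IP p) :
    lieDeriv (fun q => f q • ν q) p u = mvfderiv IP f p u • ν p + f p • lieDeriv ν p u :=
  (DFunLike.congr_fun (mvfderiv_smul hf hν) u).trans (add_comm _ _)

/-- The derivative of an equivariant function is equivariant. -/
lemma lieDeriv_translate {ν : P → GroupLieAlgebra IG G}
    (hν : ContMDiff IP 𝓘(ℝ, EG) (M' := EG) ∞ ν)
    (heq : ∀ (a : G) p, ν (B.act p a) = Ad IG a⁻¹ (ν p)) (a : G) (p : P) (u : TangentSpace IP p) :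
    lieDeriv ν (B.act p a) (translate B a p u) = Ad IG a⁻¹ (lieDeriv ν p u) := by
  have h1 := mvfderiv_comp_map (I := IP) (I' := IP) (F := EG) (g := ν) (f := fun q => B.act q a) p
    (hν.mdifferentiable (by simp) _) (mdifferentiableAt_act_right B a p) u
  have h2 := mvfderiv_clm_comp (IN := IP) (F := EG) (F' := EG)
    (mfderiv IG IG (fun h : G => a⁻¹ * h * a⁻¹⁻¹) 1 : EG →L[ℝ] EG) (f := ν)
    (hν.mdifferentiable (by simp) p) u
  have e : (fun q => ν (B.act q a)) = fun q => Ad IG a⁻¹ (ν q) := funext fun q => heq a q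
  rw [e] at h1
  exact h1.symm.trans h2

/-- The shape operator depends smoothly on the point. -/
lemma contMDiffAt_shape {ν : P → GroupLieAlgebra IG G} {X : Π q : P, TangentSpace IP q} {p : P}
    (hν : ContMDiffAt IP 𝓘(ℝ, EG) (M' := EG) ∞ ν p)
    (hX : ContMDiffAt IP IP.tangent ∞ (fun q => (⟨q, X q⟩ : TangentBundle IP P)) p) :
    ContMDiffAt IP 𝓘(ℝ, EG) (M' := EG) ∞ (fun q => shape B γ q (ν q) (X q)) p := by
  refine contMDiffAt_of_nondegenerate (F := EG) (A := fun q => fiberForm B γ q)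
    (fun ξ η => (contMDiff_fiberForm B γ ξ η).contMDiffAt)
    (fun q => fiberForm_injective B γ q) (fun η => ?_)
  have h := contMDiffAt_linear_apply (I := IP) (F := EG) (F' := ℝ) (n := ∞)
    (L := fun q => (fiberDeriv B γ q (X q)).flip η) (s := ν) (x := p) (fun e => ?_) hν
  · refine ((((1 / 2 : ℝ) • ContinuousLinearMap.id ℝ ℝ).contMDiff (n := ∞)).contMDiffAt.comp p
      h).congr_of_eventuallyEq (Filter.Eventually.of_forall fun q => fiberForm_shape B γ q _ _ _)
  · refine (contMDiffAt_mvfderiv_apply (contMDiff_fiberForm B γ e η) (b := fun q => q)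
      hX).congr_of_eventuallyEq (Filter.Eventually.of_forall fun q => ?_)
    exact fiberDeriv_apply B γ q (X q) e η

variable {γ}
variable (hγ : IsKaluzaKlein B γ)
include hγ

lemma fiberForm_act (a : G) (p : P) (ξ η : GroupLieAlgebra IG G) :
    fiberForm B γ (B.act p a) ξ η = fiberForm B γ p (Ad IG a ξ) (Ad IG a η) := by
  have h := hγ a p (fund B p (Ad IG a ξ)) (fund B p (Ad IG a η))
  rw [translate_fund, translate_fund, Ad_inv_Ad, Ad_inv_Ad] at h
  exact h

/-- The connection form is equivariant. -/
lemma connForm_translate (a : G) (p : P) (v : TangentSpace IP p) :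
    connForm B γ (B.act p a) (translate B a p v) = Ad IG a⁻¹ (connForm B γ p v) := by
  refine fiberForm_ext B γ (p := B.act p a) fun η => ?_
  rw [fiberForm_connForm, fiberForm_act B hγ, Ad_Ad_inv, fiberForm_connForm,
    ← hγ a p v, translate_fund, Ad_inv_Ad]

lemma vert_translate {a : G} {p : P} {v : TangentSpace IP p} (hv : vert B γ p v = 0) :
    vert B γ (B.act p a) (translate B a p v) = 0 := by
  rw [← connForm_eq_zero_iff] at hv ⊢
  rw [connForm_translate B hγ, hv, map_zero]

lemma hlift_act (a : G) (p : P) (w : TangentSpace IM (B.proj p)) :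
    hlift B γ (B.act p a) (w : EM) = translate B a p (hlift B γ p w) := by
  refine eq_of_horizontal (B := B) (γ := γ) (vert_hlift B γ _ _)
    (vert_translate B hγ (vert_hlift B γ p w)) ?_
  exact (mfderiv_proj_hlift B γ (B.act p a) (w : EM)).trans
    ((mfderiv_proj_translate B a p _).trans (mfderiv_proj_hlift B γ p w)).symm

lemma shape_translate (a : G) (p : P) (ξ : GroupLieAlgebra IG G) (u : TangentSpace IP p) :
    shape B γ (B.act p a) (Ad IG a⁻¹ ξ) (translate B a p u) = Ad IG a⁻¹ (shape B γ p ξ u) := by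
  refine fiberForm_ext B γ (p := B.act p a) fun ζ => ?_
  rw [fiberForm_shape, fiberForm_act B hγ, Ad_Ad_inv, fiberForm_shape, fiberDeriv_apply,
    fiberDeriv_apply]
  have h := mvfderiv_comp_map (I := IP) (I' := IP)
    (g := fun q => fiberForm B γ q (Ad IG a⁻¹ ξ) ζ) (f := fun q => B.act q a) p
    ((contMDiff_fiberForm B γ _ ζ).mdifferentiable (by simp) _)
    (mdifferentiableAt_act_right B a p) u
  simp only [fiberForm_act B hγ, Ad_Ad_inv] at h
  exact congrArg (1 / 2 * ·) h.symm

/-- The derivative of a vertical field along a horizontal vector. -/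
lemma nablaPV_fund {ν : P → GroupLieAlgebra IG G} {p : P}
    (hν : MDifferentiableAt IP 𝓘(ℝ, EG) (M' := EG) ν p) {u : TangentSpace IP p}
    (hu : vert B γ p u = 0) : nablaPV B γ (fun q => fund B q (ν q)) p u =
      fund B p (lieDeriv ν p u + shape B γ p (ν p) u) := by
  rw [nablaPV, leviCivita_fund_function B γ hν, vert_add, vert_fund, fund_add,
    vert_leviCivita_fund_of_horizontal B hγ p _ u hu]

end Lifts

/-! ### The adjoint bundle -/

section Adjoint

variable
  {EP : Type*} [NormedAddCommGroup EP] [NormedSpace ℝ EP] [FiniteDimensional ℝ EP]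
  {HP : Type*} [TopologicalSpace HP] {IP : ModelWithCorners ℝ EP HP} [IP.Boundaryless]
  {EM : Type*} [NormedAddCommGroup EM] [NormedSpace ℝ EM]
  {HM : Type*} [TopologicalSpace HM] {IM : ModelWithCorners ℝ EM HM}
  {EG : Type*} [NormedAddCommGroup EG] [NormedSpace ℝ EG] [FiniteDimensional ℝ EG]
  {HG : Type*} [TopologicalSpace HG] {IG : ModelWithCorners ℝ EG HG} [IG.Boundaryless]
  {P : Type*} [TopologicalSpace P] [ChartedSpace HP P] [IsManifold IP ∞ P]
  {M : Type*} [TopologicalSpace M] [ChartedSpace HM M] [IsManifold IM ∞ M]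
  {G : Type*} [TopologicalSpace G] [ChartedSpace HG G] [Group G] [LieGroup IG ∞ G]
  (B : PrincipalBundle IP IM IG P M G) {γ : Metric IP P} (hγ : IsKaluzaKlein B γ)

lemma apply_eq_equivariantMap (s : Π x : M, adFiber B x) {x : M}
    (q : (B.proj ⁻¹' {x} : Set P)) : (s x).1 q = equivariantMap B s q.1 := by
  obtain ⟨p, rfl⟩ := q
  rfl

lemma equivariantMap_act (s : Π x : M, adFiber B x) (a : G) (p : P) :
    equivariantMap B s (B.act p a) = Ad IG a⁻¹ (equivariantMap B s p) :=
  (apply_eq_equivariantMap B s _).symm.trans ((s (B.proj p)).2 a ⟨p, rfl⟩)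

variable {B} in
lemma adFiber_ext {x : M} {φ ψ : adFiber B x}
    (h : ∀ (p : P) (hp : B.proj p = x), φ.1 ⟨p, hp⟩ = ψ.1 ⟨p, hp⟩) : φ = ψ :=
  Subtype.ext (funext fun q => h q.1 q.2)

lemma mdifferentiableAt_equivariantMap (s : AdSection B) (p : P) :
    MDifferentiableAt IP 𝓘(ℝ, EG) (M' := EG) (equivariantMap B s.1) p :=
  s.2.mdifferentiable (by simp) p

lemma isInvariantVertical_fund {ν : P → GroupLieAlgebra IG G}
    (hν : ContMDiff IP 𝓘(ℝ, EG) (M' := EG) ∞ ν)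
    (heq : ∀ (a : G) p, ν (B.act p a) = Ad IG a⁻¹ (ν p)) :
    IsInvariantVertical B fun p => fund B p (ν p) :=
  ⟨fun _ => contMDiffAt_fund B le_rfl hν.contMDiffAt, fun p => ⟨ν p, rfl⟩,
    fun a p => by
      rw [translate_fund, ← heq]⟩

theorem isInvariantVertical_tilde (s : AdSection B) : IsInvariantVertical B (tilde B s.1) :=
  isInvariantVertical_fund B s.2 (equivariantMap_act B s.1)

include hγ

lemma IsInvariantVertical.exists_eq {V : Π q : P, TangentSpace IP q}
    (hV : IsInvariantVertical B V) : ∃ ν : P → GroupLieAlgebra IG G,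
      ContMDiff IP 𝓘(ℝ, EG) (M' := EG) ∞ ν ∧
      (∀ (a : G) p, ν (B.act p a) = Ad IG a⁻¹ (ν p)) ∧ V = fun p => fund B p (ν p) := by
  refine ⟨fun p => connForm B γ p (V p), fun p => contMDiffAt_connForm B γ (b := fun q => q)
    hV.1.contMDiffAt, fun a p => ?_, funext fun p => ?_⟩
  · exact (congrArg _ (hV.2.2 a p)).trans (connForm_translate B hγ a p (V p))
  · obtain ⟨ξ, hξ⟩ := hV.2.1 p
    exact (hξ.trans (vert_fund B γ p ξ).symm).trans (congrArg (vert B γ p) hξ.symm)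

theorem existsUnique_tilde_eq {V : Π q : P, TangentSpace IP q} (hV : IsInvariantVertical B V) :
    ∃! s : AdSection B, tilde B s.1 = V := by
  obtain ⟨ν, hν, heq, rfl⟩ := hV.exists_eq B hγ
  refine ⟨⟨fun x => ⟨fun q => ν q.1, fun a q => heq a q.1⟩, hν⟩, rfl, fun s hs => ?_⟩
  refine Subtype.ext (funext fun x => adFiber_ext fun p hp => ?_)
  rw [apply_eq_equivariantMap]
  exact fund_injective B p (congrFun hs p)

lemma IsBasic.act {X : Π q : P, TangentSpace IP q} (hX : IsBasic B γ X) (a : G) (p : P) :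
    X (B.act p a) = translate B a p (X p) := by
  obtain ⟨-, hh, Y, -, hY⟩ := hX
  refine eq_of_horizontal (B := B) (γ := γ) (hh _) (vert_translate B hγ (hh p)) ?_
  have h1 : (mfderiv IP IM B.proj (B.act p a) (X (B.act p a)) : EM) = Y (B.proj (B.act p a)) :=
    hY _
  have h2 : (mfderiv IP IM B.proj p (X p) : EM) = Y (B.proj p) := hY p
  refine h1.trans (Eq.trans ?_ (h2.symm.trans (mfderiv_proj_translate B a p (X p)).symm))
  rw [B.proj_act]

theorem isInvariantVertical_nablaPV {X V : Π q : P, TangentSpace IP q} (hX : IsBasic B γ X)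
    (hV : IsInvariantVertical B V) :
    IsInvariantVertical B fun p => nablaPV B γ V p (X p) := by
  obtain ⟨ν, hν, heq, rfl⟩ := hV.exists_eq B hγ
  have e : (fun p => nablaPV B γ (fun q => fund B q (ν q)) p (X p)) =
      fun p => fund B p (lieDeriv ν p (X p) + shape B γ p (ν p) (X p)) :=
    funext fun p => nablaPV_fund B hγ (hν.mdifferentiable (by simp) p) (hX.2.1 p)
  rw [e]
  refine isInvariantVertical_fund B (fun p => ?_) fun a p => ?_
  · exact ContMDiffAt.add (G := EG) (I := 𝓘(ℝ, EG))
      (contMDiffAt_mvfderiv_apply (F' := EG) hν (b := fun q => q)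
      hX.1.contMDiffAt) (contMDiffAt_shape B γ hν.contMDiffAt hX.1.contMDiffAt)
  · rw [hX.act B hγ, heq, lieDeriv_translate B hν heq, shape_translate B hγ, map_add]

/-- An equivariant family of linear maps on the tangent spaces along a fibre of `P` descends to a
linear map with values in the adjoint bundle. -/
def descend {x : M}
    (Λ : Π q : (B.proj ⁻¹' {x} : Set P), TangentSpace IP q.1 →ₗ[ℝ] GroupLieAlgebra IG G)
    (hΛ : ∀ (a : G) (q : (B.proj ⁻¹' {x} : Set P)) (u : TangentSpace IP q.1),
      Λ ⟨B.act q a, (B.proj_act q a).trans q.2⟩ (translate B a q u) = Ad IG a⁻¹ (Λ q u)) :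
    TangentSpace IM x →ₗ[ℝ] adFiber B x where
  toFun w := ⟨fun q => Λ q (hliftL B γ q.1 (w : EM)), fun a q => by
    rw [← hΛ]
    exact congrArg _ (hlift_act B hγ a q.1 (w : EM))⟩
  map_add' w w' := adFiber_ext fun p hp => by
    have h := (hliftL B γ p).map_add (w : EM) (w' : EM)
    exact (congrArg (Λ ⟨p, hp⟩) h).trans (map_add _ _ _)
  map_smul' c w := adFiber_ext fun p hp => by
    have h := (hliftL B γ p).map_smul c (w : EM)
    exact (congrArg (Λ ⟨p, hp⟩) h).trans (map_smul _ _ _)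

omit hγ in
lemma isSmooth_lieDeriv_add_smul_shape (c : ℝ) (s : AdSection B) {Y : Π x : M, TangentSpace IM x}
    (hY : IsSmoothField IM Y) :
    ContMDiff IP 𝓘(ℝ, EG) (M' := EG) ∞ fun p =>
      lieDeriv (equivariantMap B s.1) p (hlift B γ p (Y (B.proj p))) +
        c • shape B γ p (equivariantMap B s.1 p) (hlift B γ p (Y (B.proj p))) := fun p =>
  ContMDiffAt.add (G := EG) (I := 𝓘(ℝ, EG))
    (contMDiffAt_mvfderiv_apply (F' := EG) s.2 (b := fun q => q)
    (contMDiffAt_hlift B γ hY p)) (((c • ContinuousLinearMap.id ℝ EG).contMDiff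
      (n := ∞)).contMDiffAt.comp p
        (contMDiffAt_shape B γ s.2.contMDiffAt (contMDiffAt_hlift B γ hY p)))

/-- The connections `∇^ad + c T^ad` on the adjoint bundle. -/
def adConnection (c : ℝ) : AdConnection B where
  toFun s x := descend B hγ (fun q => lieDerivL (equivariantMap B s.1) q.1 +
      c • (shapeL B γ q.1).flip (equivariantMap B s.1 q.1)) fun a q u => by
    simp only [LinearMap.add_apply, LinearMap.smul_apply, LinearMap.flip_apply, shapeL_apply,
      equivariantMap_act, shape_translate B hγ, map_add, map_smul]
    exact congrArg (· + _) (lieDeriv_translate B s.2 (equivariantMap_act B s.1) a q.1 u)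
  add s t u h x w := adFiber_ext fun p hp => by
    have e : equivariantMap B u.1 = fun q => equivariantMap B s.1 q + equivariantMap B t.1 q :=
      funext fun q => congrArg (fun φ : adFiber B (B.proj q) => φ.1 ⟨q, rfl⟩) (h (B.proj q))
    have h1 := lieDeriv_add (mdifferentiableAt_equivariantMap B s p)
      (mdifferentiableAt_equivariantMap B t p) (hlift B γ p (w : EM))
    rw [← e] at h1
    have h2 := congrArg (fun ξ => c • shapeL B γ p (hlift B γ p (w : EM)) ξ) (congrFun e p)
    simp only [map_add, smul_add] at h2
    exact (congrArg₂ (· + ·) h1 h2).trans (add_add_add_comm _ _ _ _)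
  leibniz f s u hf h x w := adFiber_ext fun p hp => by
    subst hp
    have e : equivariantMap B u.1 = fun q => f (B.proj q) • equivariantMap B s.1 q :=
      funext fun q => congrArg (fun φ : adFiber B (B.proj q) => φ.1 ⟨q, rfl⟩) (h (B.proj q))
    have hf' := hf.mdifferentiable (by simp) (B.proj p)
    have h1 := lieDeriv_smul (hf'.comp p (mdifferentiableAt_proj B p))
      (mdifferentiableAt_equivariantMap B s p) (hlift B γ p w)
    have h3 := mvfderiv_comp_map p hf' (mdifferentiableAt_proj B p) (hlift B γ p w)
    rw [mfderiv_proj_hlift] at h3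
    rw [show mvfderiv IP (f ∘ B.proj) p (hlift B γ p w) = _ from h3] at h1
    simp only [Function.comp_apply] at h1
    rw [← e] at h1
    have h2 := congrArg (fun ξ => c • shapeL B γ p (hlift B γ p w) ξ) (congrFun e p)
    simp only [map_smul] at h2
    rw [smul_comm] at h2
    refine (congrArg₂ (· + ·) h1 h2).trans ?_
    rw [add_assoc, ← smul_add]
    rfl
  smooth s Y hY p := (isSmooth_lieDeriv_add_smul_shape B (γ := γ) c s hY
    p).congr_of_eventuallyEq (Filter.Eventually.of_forall fun _ => rfl)

lemma adConnection_apply (c : ℝ) (s : AdSection B) (p : P) (w : TangentSpace IM (B.proj p)) :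
    ((adConnection B hγ c).toFun s (B.proj p) w).1 ⟨p, rfl⟩ =
      lieDeriv (equivariantMap B s.1) p (hlift B γ p w) +
        c • shape B γ p (equivariantMap B s.1 p) (hlift B γ p w) := rfl

/-- The form `T^ad`. -/
def adShape : AdEndForm B where
  toFun x := LinearMap.mk₂ ℝ (fun w φ => descend B hγ
      (fun q => (shapeL B γ q.1).flip (φ.1 q)) (fun a q u => by
        rw [φ.2 a q]
        exact shape_translate B hγ a q.1 _ u) w)
    (fun w w' φ => map_add _ w w') (fun c w φ => map_smul _ c w)
    (fun w φ ψ => adFiber_ext fun p hp => (shapeL B γ p _).map_add _ _)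
    (fun c w φ => adFiber_ext fun p hp => (shapeL B γ p _).map_smul _ _)
  smooth s Y hY p := contMDiffAt_shape B γ s.2.contMDiffAt (contMDiffAt_hlift B γ hY p)

lemma adShape_apply (p : P) (w : TangentSpace IM (B.proj p)) (φ : adFiber B (B.proj p)) :
    ((adShape B hγ).toFun (B.proj p) w φ).1 ⟨p, rfl⟩ =
      shape B γ p (φ.1 ⟨p, rfl⟩) (hlift B γ p w) := rfl

omit hγ in
variable {B} in
lemma adConnection_ext {C C' : AdConnection B}
    (h : ∀ (s : AdSection B) (p : P) (w : TangentSpace IM (B.proj p)),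
      (C.toFun s (B.proj p) w).1 ⟨p, rfl⟩ = (C'.toFun s (B.proj p) w).1 ⟨p, rfl⟩) : C = C' := by
  refine AdConnection.ext (funext fun s => funext fun x => LinearMap.ext fun w =>
    adFiber_ext fun p hp => ?_)
  subst hp
  exact h s p w

lemma nablaPV_tilde (s : AdSection B) (p : P) (w : TangentSpace IM (B.proj p)) :
    nablaPV B γ (tilde B s.1) p (hlift B γ p w) =
      fund B p (lieDeriv (equivariantMap B s.1) p (hlift B γ p w) +
        shape B γ p (equivariantMap B s.1 p) (hlift B γ p w)) :=
  nablaPV_fund B hγ (mdifferentiableAt_equivariantMap B s p) (vert_hlift B γ p w)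

theorem existsUnique_inducedByNablaPV : ∃! C : AdConnection B, IsInducedByNablaPV B γ C := by
  refine ⟨adConnection B hγ 1, fun s p w => ?_, fun C hC => adConnection_ext fun s p w => ?_⟩
  · rw [adConnection_apply, one_smul, nablaPV_tilde B hγ]
  · refine fund_injective B p ((hC s p w).trans ?_)
    rw [adConnection_apply, one_smul, nablaPV_tilde B hγ]

theorem existsUnique_inducedByConnection :
    ∃! C : AdConnection B, IsInducedByConnection B γ C := by
  have h : ∀ (s : AdSection B) (p : P) (w : TangentSpace IM (B.proj p)),
      ((adConnection B hγ 0).toFun s (B.proj p) w).1 ⟨p, rfl⟩ =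
        lieDeriv (equivariantMap B s.1) p (hlift B γ p w) := by
    intro s p w
    rw [adConnection_apply, zero_smul, add_zero]
  exact ⟨adConnection B hγ 0, h, fun C hC => adConnection_ext fun s p w =>
    (hC s p w).trans (h s p w).symm⟩

theorem existsUnique_inducedByOneill : ∃! A : AdEndForm B, IsInducedByOneill B γ A := by
  refine ⟨adShape B hγ, fun p w φ => ?_, fun A hA => AdEndForm.ext (funext fun x =>
    LinearMap.ext fun w => LinearMap.ext fun φ => adFiber_ext fun p hp => ?_)⟩
  · rw [adShape_apply, oneill_fund_of_horizontal B hγ _ _ (vert_hlift B γ p w)]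
  · subst hp
    refine fund_injective B p ((hA p w φ).trans ?_)
    rw [adShape_apply, oneill_fund_of_horizontal B hγ _ _ (vert_hlift B γ p w)]

theorem inducedByNablaPV_sub_inducedByConnection {C C' : AdConnection B} {A : AdEndForm B}
    (hC : IsInducedByNablaPV B γ C) (hC' : IsInducedByConnection B γ C')
    (hA : IsInducedByOneill B γ A) (s : AdSection B) (x : M) (w : TangentSpace IM x) :
    C.toFun s x w - C'.toFun s x w = A.toFun x w (s.1 x) := by
  refine adFiber_ext fun p hp => ?_
  subst hp
  refine fund_injective B p ?_
  have h2 : (C'.toFun s (B.proj p) w).1 ⟨p, rfl⟩ =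
    lieDeriv (equivariantMap B s.1) p (hlift B γ p w) := hC' s p w
  rw [hA, oneill_fund_of_horizontal B hγ _ _ (vert_hlift B γ p w)]
  refine (fund_sub B p _ _).trans ?_
  rw [hC, h2, nablaPV_tilde B hγ, ← fund_sub, add_sub_cancel_left]
  rfl

end Adjoint

/-! ### Metric traces -/

section Trace

variable {EN : Type*} [NormedAddCommGroup EN] [NormedSpace ℝ EN] [FiniteDimensional ℝ EN]
  {HN : Type*} [TopologicalSpace HN] {IN : ModelWithCorners ℝ EN HN}
  {N : Type*} [TopologicalSpace N] [ChartedSpace HN N] [IsManifold IN ∞ N]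
  (g : Metric IN N) (x : N) {W W' : Type*} [AddCommGroup W] [Module ℝ W]
  [AddCommGroup W'] [Module ℝ W']

lemma metricTrace_map (L : W →ₗ[ℝ] W') (b : TangentSpace IN x → TangentSpace IN x → W) :
    L (metricTrace g x b) = metricTrace g x fun u v => L (b u v) := by
  simp only [metricTrace, map_sum, map_smul]

lemma metricTrace_add (b c : TangentSpace IN x → TangentSpace IN x → W) :
    metricTrace g x (fun u v => b u v + c u v) = metricTrace g x b + metricTrace g x c := by
  simp only [metricTrace, smul_add, Finset.sum_add_distrib]

/-- The trace of an antisymmetric map vanishes. -/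
lemma metricTrace_eq_zero {b : TangentSpace IN x → TangentSpace IN x → W}
    (h : ∀ u v, b u v = -b v u) : metricTrace g x b = 0 := by
  set e := Module.finBasis ℝ (TangentSpace IN x) with he
  set A : Matrix _ _ ℝ := Matrix.of fun i j => g.inner x (e i) (e j) with hA
  have hsymm : A.transpose = A := by
    ext i j
    exact g.symm x _ _
  have hinv : ∀ i j, A⁻¹ i j = A⁻¹ j i := by
    intro i j
    have := Matrix.transpose_nonsing_inv A
    rw [hsymm] at this
    exact (congrFun (congrFun this i) j).symm
  have h1 : metricTrace g x b = ∑ i, ∑ j, A⁻¹ i j • b (e i) (e j) := rfl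
  have h2 : metricTrace g x b = -metricTrace g x b := by
    conv_lhs => rw [h1, Finset.sum_comm]
    rw [h1, ← Finset.sum_neg_distrib]
    refine Finset.sum_congr rfl fun i _ => ?_
    rw [← Finset.sum_neg_distrib]
    refine Finset.sum_congr rfl fun j _ => ?_
    rw [hinv, h, smul_neg]
  have h3 : (2 : ℝ) • metricTrace g x b = 0 := by
    rw [two_smul]
    nth_rewrite 2 [h2]
    exact add_neg_cancel _
  exact (smul_eq_zero.1 h3).resolve_left two_ne_zero

end Trace

/-! ### The vertical part of the tension field -/

section Tension

variable
  {EP : Type*} [NormedAddCommGroup EP] [NormedSpace ℝ EP] [FiniteDimensional ℝ EP]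
  {HP : Type*} [TopologicalSpace HP] {IP : ModelWithCorners ℝ EP HP} [IP.Boundaryless]
  {EM : Type*} [NormedAddCommGroup EM] [NormedSpace ℝ EM]
  {HM : Type*} [TopologicalSpace HM] {IM : ModelWithCorners ℝ EM HM}
  {EG : Type*} [NormedAddCommGroup EG] [NormedSpace ℝ EG] [FiniteDimensional ℝ EG]
  {HG : Type*} [TopologicalSpace HG] {IG : ModelWithCorners ℝ EG HG} [IG.Boundaryless]
  {P : Type*} [TopologicalSpace P] [ChartedSpace HP P] [IsManifold IP ∞ P]
  {M : Type*} [TopologicalSpace M] [ChartedSpace HM M]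
  {G : Type*} [TopologicalSpace G] [ChartedSpace HG G] [Group G] [LieGroup IG ∞ G]
  (B : PrincipalBundle IP IM IG P M G) (γ : Metric IP P)
  {EN : Type*} [NormedAddCommGroup EN] [NormedSpace ℝ EN] [FiniteDimensional ℝ EN]
  {HN : Type*} [TopologicalSpace HN] {IN : ModelWithCorners ℝ EN HN} [IN.Boundaryless]
  {N : Type*} [TopologicalSpace N] [ChartedSpace HN N] [IsManifold IN ∞ N]

/-- The derivative of the connection form evaluated on a field along a map. -/
lemma lieDeriv_connForm_along {Φ : N → P} {S : Π y, TangentSpace IP (Φ y)} {x : N}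
    (hS : MDifferentiableAt IN IP.tangent (fun y => (⟨Φ y, S y⟩ : TangentBundle IP P)) x)
    (u : TangentSpace IN x) :
    lieDeriv (fun y => connForm B γ (Φ y) (S y)) x u =
      lieDeriv (fun q => connForm B γ q (constExt EP (S x) q)) (Φ x) (mfderiv IN IP Φ x u) +
        connForm B γ (Φ x) ((trivializationAt EP (TangentSpace IP) (Φ x)).symmL ℝ (Φ x)
          (mvfderiv IN (fun y => (components (Φ x) (S y) : EP)) x u)) := by
  set t := trivializationAt EP (TangentSpace IP : P → Type _) (Φ x) with ht
  have hΦ : MDifferentiableAt IN IP Φ x :=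
    ((mdifferentiableAt_totalSpace IP (fun y => (⟨Φ y, S y⟩ : TangentBundle IP P))).1 hS).1
  have hc := mdifferentiableAt_components_along rfl hS
  let K : P → EP →ₗ[ℝ] EG := fun q => connFormL B γ q ∘ₗ (t.symmL ℝ q).toLinearMap
  have hK : ∀ e, MDifferentiableAt IP 𝓘(ℝ, EG) (fun q => K q e) (Φ x) := by
    intro e
    have h := mdifferentiableAt_connForm B γ (b := fun q => q)
      (mdifferentiableAt_constExt (I := IP) EP (t.symmL ℝ (Φ x) e))
    refine h.congr_of_eventuallyEq (Filter.Eventually.of_forall fun q => ?_)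
    exact congrArg (fun e => connForm B γ q (t.symmL ℝ q e)) (components_symmL (Φ x) e).symm
  have e0 : (fun y => connForm B γ (Φ y) (S y)) =ᶠ[𝓝 x]
      fun y => K (Φ y) (components (Φ x) (S y)) := by
    filter_upwards [components_along_eventuallyEq (H := HP) rfl hΦ.continuousAt] with y hy
    exact congrArg (connForm B γ (Φ y)) (t.symmL_continuousLinearMapAt (R := ℝ) hy (S y)).symm
  have h1 := mvfderiv_linear_apply (L := fun y => K (Φ y)) (fun e => (hK e).comp x hΦ) hc u
  have h2 := mvfderiv_comp_map (g := fun q => K q (components (Φ x) (S x))) x (hK _) hΦ u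
  rw [h2] at h1
  exact (DFunLike.congr_fun (mvfderiv_congr (F := EG) e0) u).trans h1

/-- The pullback of `∇^ω` in terms of the connection form. -/
lemma pullbackOmega_eq (Φ : N → P) (S : Π y, TangentSpace IP (Φ y)) (x : N)
    (u : TangentSpace IN x) :
    pullbackOmega B γ Φ S x u = fund B (Φ x) (lieDeriv (fun y => connForm B γ (Φ y) (S y)) x u +
      (1 / 2 : ℝ) • ⁅connForm B γ (Φ x) (mfderiv IN IP Φ x u), connForm B γ (Φ x) (S x)⁆) := by
  have hcomp : ∀ (q : P) (c : EG),
      (components (V := Bundle.Trivial P EG) (Φ x) (y := q) c : EG) = c := by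
    intro q c
    exact congrFun (congrArg DFunLike.coe (Bundle.Trivial.continuousLinearMapAt_trivialization
      ℝ P EG q)) c
  have hsymm : ∀ (q : P) (c : EG),
      (trivializationAt EG (Bundle.Trivial P EG) (Φ x)).symmL ℝ q c = c := by
    intro q c
    exact congrFun (congrArg DFunLike.coe (Bundle.Trivial.symmL_trivialization ℝ P EG q)) c
  have hc : ∀ (c : EG), constExt EG (V := Bundle.Trivial P EG) (x := Φ x) c = fun _ => c := by
    intro c
    funext q
    exact (hsymm q _).trans (hcomp (Φ x) c)
  have h0 : mvfderiv IP (F := EG) (fun _ => connForm B γ (Φ x) (S x)) (Φ x) = 0 :=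
    mvfderiv_const (F := EG) _
  refine congrArg (fund B (Φ x)) ?_
  refine congrArg₂ (fun a b : EG => a + b) ?_ ?_
  · exact (hsymm _ _).trans <| DFunLike.congr_fun (congrArg (fun f : N → EG => mvfderiv IN f x)
      (funext fun y => hcomp (Φ y) _)) u
  · have h := congrArg (fun σ => hatNabla B γ σ (Φ x) (mfderiv IN IP Φ x u))
      (hc (connForm B γ (Φ x) (S x)))
    refine h.trans ?_
    refine (congrArg (fun a : EG => a + _) (DFunLike.congr_fun h0 _)).trans (zero_add _)

variable {γ}

/-- The difference of the vertical derivative along a map and of the derivative with `∇^ω`. -/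
lemma vert_pullbackCov {Φ : N → P} {S : Π y, TangentSpace IP (Φ y)} {x : N}
    (hS : MDifferentiableAt IN IP.tangent (fun y => (⟨Φ y, S y⟩ : TangentBundle IP P)) x)
    (u : TangentSpace IN x) :
    vert B γ (Φ x) (pullbackCov EP (fun X q w => leviCivita γ X q w) Φ S x u) =
      pullbackOmega B γ Φ (fun y => vert B γ (Φ y) (S y)) x u +
        vert B γ (Φ x) (theta B γ (Φ x) (mfderiv IN IP Φ x u) (S x) +
          oneill B γ (Φ x) (mfderiv IN IP Φ x u) (S x)) +
        vert B γ (Φ x) (leviCivita γ (fun q => horiz B γ q (constExt EP (S x) q)) (Φ x)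
          (horiz B γ (Φ x) (mfderiv IN IP Φ x u))) := by
  set p := Φ x with hp
  set U := mfderiv IN IP Φ x u with hU
  have hX := mdifferentiableAt_constExt (I := IP) EP (S x)
  have hh := mdifferentiableAt_horiz B γ hX
  have hv : MDiffAt (T% fun q => vert B γ q (constExt EP (S x) q)) p :=
    mdifferentiableAt_vert B γ (b := fun q => q) hX
  have hsplit : leviCivita γ (constExt EP (S x)) p U =
      leviCivita γ (fun q => vert B γ q (constExt EP (S x) q)) p U +
        leviCivita γ (fun q => horiz B γ q (constExt EP (S x) q)) p U := by
    have h := (leviCivita γ).isCovariantDerivativeOnUniv.add hv hh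
    have e : (fun q => vert B γ q (constExt EP (S x) q)) +
        (fun q => horiz B γ q (constExt EP (S x) q)) = constExt EP (S x) :=
      funext fun q => vert_add_horiz B γ q _
    rw [e] at h
    rw [h]
    rfl
  have hθ : vert B γ p (leviCivita γ (fun q => vert B γ q (constExt EP (S x) q)) p U) =
      theta B γ p U (S x) +
        (fund B p (lieDeriv (fun q => connForm B γ q (constExt EP (S x) q)) p U) +
          fund B p ((1 / 2 : ℝ) • ⁅connForm B γ p U, connForm B γ p (S x)⁆)) := by
    have h := nablaOmega_vert B γ (D := constExt EP (S x)) p U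
    rw [constExt_self] at h
    rw [theta, thetaField, constExt_self, h, nablaPV]
    abel
  have hT : vert B γ p (oneill B γ p U (S x)) =
      vert B γ p (leviCivita γ (fun q => horiz B γ q (constExt EP (S x) q)) p (vert B γ p U)) := by
    rw [oneill, oneillField, vert_add, vert_vert, vert_horiz, add_zero, constExt_self]
  have hvθ : vert B γ p (theta B γ p U (S x)) = theta B γ p U (S x) := by
    rw [theta, thetaField, nablaPV, nablaOmega, vert_sub, vert_vert]
    exact congrArg (_ - ·) (vert_fund B γ p _)
  have hU' : leviCivita γ (fun q => horiz B γ q (constExt EP (S x) q)) p U =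
      leviCivita γ (fun q => horiz B γ q (constExt EP (S x) q)) p (vert B γ p U) +
        leviCivita γ (fun q => horiz B γ q (constExt EP (S x) q)) p (horiz B γ p U) := by
    rw [← map_add, vert_add_horiz]
  have hω := pullbackOmega_eq B γ Φ (fun y => vert B γ (Φ y) (S y)) x u
  simp only [connForm_vert] at hω
  rw [hω, lieDeriv_connForm_along B γ hS, pullbackCov, hsplit, hU', vert_add, vert_add, vert_add,
    vert_add, hθ, hT, hvθ, fund_add, fund_add, vert]
  abel

/-- The vertical part of the horizontal derivative of a horizontal field is antisymmetric. -/
lemma vert_leviCivita_horiz_antisymm (hγ : IsKaluzaKlein B γ) (p : P) (u v : TangentSpace IP p) :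
    vert B γ p (leviCivita γ (fun q => horiz B γ q (constExt EP v q)) p (horiz B γ p u)) =
      -vert B γ p (leviCivita γ (fun q => horiz B γ q (constExt EP u q)) p (horiz B γ p v)) := by
  have h := fun u v : TangentSpace IP p => inner_leviCivita_horizontal B (γ := γ)
    (mdifferentiableAt_horiz B γ (mdifferentiableAt_constExt (I := IP) EP v))
    (fun q => vert_horiz B γ q _) (horiz B γ p u)
  simp only [constExt_self] at h
  rw [vert, vert, ← fund_neg]
  congr 1
  refine fiberForm_ext B γ (p := p) fun ζ => ?_
  rw [map_neg, LinearMap.neg_apply, fiberForm_connForm, fiberForm_connForm, h, h]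
  have := killing_fund B hγ ζ p (horiz B γ p u) (horiz B γ p v)
  rw [γ.symm p] at this
  linarith

/-- The vertical part of the tension field of a map to a principal bundle. -/
theorem vert_tension (hγ : IsKaluzaKlein B γ) (g : Metric IN N) {Φ : N → P}
    (hΦ : ContMDiff IN IP ∞ Φ) (x : N) :
    vert B γ (Φ x) (tension g γ Φ x) =
      -codifferential g (W := fun y => TangentSpace IP (Φ y)) (pullbackOmega B γ Φ)
          (fun y v => vert B γ (Φ y) (mfderiv IN IP Φ y v)) x +
        vert B γ (Φ x) (metricTrace g x fun u v =>
          theta B γ (Φ x) (mfderiv IN IP Φ x u) (mfderiv IN IP Φ x v) +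
          oneill B γ (Φ x) (mfderiv IN IP Φ x u) (mfderiv IN IP Φ x v)) := by
  have hS : ∀ v : TangentSpace IN x, MDifferentiableAt IN IP.tangent (fun y =>
      (⟨Φ y, mfderiv IN IP Φ y (constExt EN v y)⟩ : TangentBundle IP P)) x := fun v =>
    ((hΦ.contMDiff_tangentMap (m := ∞) (by simp)).mdifferentiable (by simp) _).comp x
      (mdifferentiableAt_constExt (I := IN) EN v)
  have hz := metricTrace_eq_zero g x (b := fun u v => vert B γ (Φ x)
    (leviCivita γ (fun q => horiz B γ q (constExt EP (mfderiv IN IP Φ x v) q)) (Φ x)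
      (horiz B γ (Φ x) (mfderiv IN IP Φ x u))))
    fun u v => vert_leviCivita_horiz_antisymm B hγ (Φ x) _ _
  rw [codifferential, neg_neg, tension, ← vertL_apply, ← vertL_apply, metricTrace_map,
    metricTrace_map, ← metricTrace_add]
  refine Eq.trans ?_ ((congrArg (_ + ·) hz).trans (add_zero _))
  rw [← metricTrace_add]
  congr 1
  funext u v
  have h := vert_pullbackCov B (γ := γ) (hS v) u
  simp only [constExt_self] at h
  rw [vertL_apply, vertL_apply, secondFund, vert_sub, h]
  abel

end Tension

end KK

end

theorem mainTheorem11
    {EP : Type*} [NormedAddCommGroup EP] [NormedSpace ℝ EP] [FiniteDimensional ℝ EP]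
    {HP : Type*} [TopologicalSpace HP] (IP : ModelWithCorners ℝ EP HP) [IP.Boundaryless]
    {EM : Type*} [NormedAddCommGroup EM] [NormedSpace ℝ EM] [FiniteDimensional ℝ EM]
    {HM : Type*} [TopologicalSpace HM] (IM : ModelWithCorners ℝ EM HM) [IM.Boundaryless]
    {EG : Type*} [NormedAddCommGroup EG] [NormedSpace ℝ EG] [FiniteDimensional ℝ EG]
    {HG : Type*} [TopologicalSpace HG] (IG : ModelWithCorners ℝ EG HG) [IG.Boundaryless]
    {P : Type*} [TopologicalSpace P] [ChartedSpace HP P] [IsManifold IP ∞ P]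
    [T2Space P] [ParacompactSpace P]
    {M : Type*} [TopologicalSpace M] [ChartedSpace HM M] [IsManifold IM ∞ M]
    [T2Space M] [ParacompactSpace M]
    {G : Type*} [TopologicalSpace G] [ChartedSpace HG G] [Group G] [LieGroup IG ∞ G]
    (B : KK.PrincipalBundle IP IM IG P M G) (γ : KK.Metric IP P) (hγ : KK.IsKaluzaKlein B γ) :
    -- `Θ` and `T` are tensors, and the formula for `Θ`
    ((∀ D₁ D₂ : Π q : P, TangentSpace IP q,
        KK.IsSmoothField IP D₁ → KK.IsSmoothField IP D₂ → ∀ p : P,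
          KK.thetaField B γ D₁ D₂ p = KK.theta B γ p (D₁ p) (D₂ p) ∧
          KK.oneillField B γ D₁ D₂ p = KK.oneill B γ p (D₁ p) (D₂ p)) ∧
      ∀ (D : Π q : P, TangentSpace IP q) (ξ : P → GroupLieAlgebra IG G),
        KK.IsSmoothField IP D → ContMDiff IP 𝓘(ℝ, EG) (M' := EG) ∞ ξ → ∀ p : P,
          KK.thetaField B γ D (fun q => KK.fund B q (ξ q)) p =
            KK.fund B p ((1 / 2 : ℝ) • (KK.adStar B γ p (ξ p) (KK.connForm B γ p (D p)) +
              KK.adStar B γ p (KK.connForm B γ p (D p)) (ξ p))) +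
            KK.oneillField B γ (fun q => KK.fund B q (ξ q)) (fun q => KK.horiz B γ q (D q)) p) ∧
    -- the connections on the adjoint bundle
    ((∀ X V : Π q : P, TangentSpace IP q, KK.IsBasic B γ X → KK.IsInvariantVertical B V →
        KK.IsInvariantVertical B fun p => KK.nablaPV B γ V p (X p)) ∧
      (∀ s : KK.AdSection B, KK.IsInvariantVertical B (KK.tilde B s.1)) ∧
      (∀ V : Π q : P, TangentSpace IP q, KK.IsInvariantVertical B V →
        ∃! s : KK.AdSection B, KK.tilde B s.1 = V) ∧
      (∃! C : KK.AdConnection B, KK.IsInducedByNablaPV B γ C) ∧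
      (∃! C : KK.AdConnection B, KK.IsInducedByConnection B γ C) ∧
      (∃! A : KK.AdEndForm B, KK.IsInducedByOneill B γ A) ∧
      ∀ (C C' : KK.AdConnection B) (A : KK.AdEndForm B), KK.IsInducedByNablaPV B γ C →
        KK.IsInducedByConnection B γ C' → KK.IsInducedByOneill B γ A →
        ∀ (s : KK.AdSection B) (x : M) (w : TangentSpace IM x),
          C.toFun s x w - C'.toFun s x w = A.toFun x w (s.1 x)) ∧
    -- the vertical part of the tension field
    (∀ {EN : Type*} [NormedAddCommGroup EN] [NormedSpace ℝ EN] [FiniteDimensional ℝ EN]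
        {HN : Type*} [TopologicalSpace HN] (IN : ModelWithCorners ℝ EN HN) [IN.Boundaryless]
        {N : Type*} [TopologicalSpace N] [ChartedSpace HN N] [IsManifold IN ∞ N]
        [T2Space N] [ParacompactSpace N] (g : KK.Metric IN N) (Φ : N → P),
        ContMDiff IN IP ∞ Φ → ∀ x : N,
          KK.vert B γ (Φ x) (KK.tension g γ Φ x) =
            -KK.codifferential g (W := fun y => TangentSpace IP (Φ y)) (KK.pullbackOmega B γ Φ)
                (fun y v => KK.vert B γ (Φ y) (mfderiv IN IP Φ y v)) x +
              KK.vert B γ (Φ x) (KK.metricTrace g x fun u v =>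
                KK.theta B γ (Φ x) (mfderiv IN IP Φ x u) (mfderiv IN IP Φ x v) +
                KK.oneill B γ (Φ x) (mfderiv IN IP Φ x u) (mfderiv IN IP Φ x v))) := by
  refine ⟨⟨fun D₁ D₂ _ h₂ p => ?_, fun D ξ hD hξ p => ?_⟩,
    ⟨fun X V hX hV => KK.isInvariantVertical_nablaPV B hγ hX hV,
      fun s => KK.isInvariantVertical_tilde B s, fun V hV => KK.existsUnique_tilde_eq B hγ hV,
      KK.existsUnique_inducedByNablaPV B hγ, KK.existsUnique_inducedByConnection B hγ,
      KK.existsUnique_inducedByOneill B hγ, fun C C' A hC hC' hA s x w =>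
        KK.inducedByNablaPV_sub_inducedByConnection B hγ hC hC' hA s x w⟩,
    by
      intros
      exact KK.vert_tension B hγ _ ‹_› _⟩
  · have h := ContMDiff.mdifferentiable h₂ (by simp) p
    exact ⟨KK.thetaField_eq_theta B h, KK.oneillField_eq_oneill B hγ h⟩
  · exact KK.thetaField_fund B hγ (ContMDiff.mdifferentiable hD (by simp) p)
      ((KK.contMDiffAt_fund B le_rfl (hξ p)).mdifferentiableAt (by simp))
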